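/- Let $R\ge 2$ be an integer and let $\mathbf G_{n,R}$ be the set of simple graphs with vertex set $\{1,\dots,n\}$ in which every vertex has degree at most $R$. "Proportion" means proportion among the members of $\mathbf G_{n,R}$. A $p$-path is a path with $p$ edges, a $p$-cycle is a cycle with $p$ edges; in counting, paths and cycles are regarded as subgraphs. (i) For every integer $k>0$, the proportion of graphs $G\in\mathbf G_{n,R}$ having all of the following properties tends to $1$ as $n\to\infty$. 1. For every $p\le k$, no subgraph of $G$ with exactly $p$ vertices has more than $p$ edges. Moreover, whenever $p_1,p_2\ge 3$, $p_3\ge 0$ and $p_1+p_2+p_3\le k$, there are no two different cycles in $G$, one a $p_1$-cycle and the other a $p_2$-cycle, joined by a $p_3$-path from a vertex of the first to a vertex of the second. 2. For $0\le p\le k$ and $q\le k$, there is no $p$-path from a vertex of degree less than $R$ to a vertex of a $q$-cycle; in particular (the case $p=0$) no such cycle contains a vertex of degree less than $R$. 3. There are no three distinct vertices of degree at most $R-1$ that are pairwise joined by paths of length at most $k$. 4. There are no distinct vertices $v,w$ with $\deg v\le R-1$ and $\deg w\le R-2$ that are joined by a path of length at most $k$. (ii) Let $k\ge 3$, and put $\lambda_p=\frac{(R-1)^p}{2p}$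 for $3\le p\le k$ and $\mu_p=\frac{(R-1)^{p+1}}{2}$ for $1\le p\le k$. For all $r_3,\dots,r_k,s_1,\dots,s_k\in\mathbb N$, the proportion of $G\in\mathbf G_{n,R}$ which have exactly $r_p$ $p$-cycles for $p=3,\dots,k$ and exactly $s_p$ $p$-paths with both endpoints of degree $R-1$ for $p=1,\dots,k$ tends, as $n\to\infty$, to $$\Pi=\prod_{p=3}^k\frac{\lambda_p^{r_p}e^{-\lambda_p}}{r_p!}\;\prod_{p=1}^k\frac{\mu_p^{s_p}e^{-\mu_p}}{s_p!}.$$ Moreover, these counts are asymptotically independent of the number of vertices of degree $R-2$, which is asymptotically Poisson with mean $R-1$: for every $q\in\mathbb N$, the proportion of $G\in\mathbf G_{n,R}$ which have these counts and exactly $q$ vertices of degree $R-2$ tends to $\Pi\cdot\frac{(R-1)^q e^{-(R-1)}}{q!}$, and among the $G\in\mathbf G_{n,R}$ with exactly $q$ vertices of degree $R-2$ the proportion of those which have these counts tends to $\Pi$. (iii) If $R\ge 3$, then for every $k\in\mathbb N$ the proportion of $G\in\mathbf G_{n,R}$ which have a connected component with at most $k$ vertices tends to $0$ as $n\to\infty$.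 -/

import Mathlib

open Filter Topology

noncomputable section

namespace BoundedDegree

open Classical in
/-- The degree of a vertex of a graph on `n` labelled vertices. -/
def deg {n : ℕ} (G : SimpleGraph (Fin n)) (v : Fin n) : ℕ :=
  G.degree v

/-- The set of all graphs on `n` labelled vertices with maximum degree at most `R`. -/
def graphs (n R : ℕ) : Set (SimpleGraph (Fin n)) :=
  {G | ∀ v, deg G v ≤ R}

/-- The proportion of the members of `S` that have the property `P`. -/
def proportion {n : ℕ} (S : Set (SimpleGraph (Fin n))) (P : SimpleGraph (Fin n) → Prop) : ℝ :=
  ({G | G ∈ S ∧ P G}.ncard : ℝ) / (S.ncard : ℝ)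

/-- The number of `p`-cycles of `G`, a cycle being a subgraph (so that a choice of a starting
vertex and of an orientation is not counted). -/
def numCycles {n : ℕ} (G : SimpleGraph (Fin n)) (p : ℕ) : ℕ :=
  {H : G.Subgraph | ∃ (v : Fin n) (c : G.Walk v v),
    c.IsCycle ∧ c.length = p ∧ c.toSubgraph = H}.ncard

/-- The number of `p`-paths of `G` (paths with `p` edges) with both endpoints of degree `d`,
a path being a subgraph (so that a path and its reverse are the same). -/
def numPaths {n : ℕ} (G : SimpleGraph (Fin n)) (d p : ℕ) : ℕ :=
  {H : G.Subgraph | ∃ (u v : Fin n) (w : G.Walk u v),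
    w.IsPath ∧ w.length = p ∧ deg G u = d ∧ deg G v = d ∧ w.toSubgraph = H}.ncard

/-- The number of vertices of `G` of degree `d`. -/
def numDeg {n : ℕ} (G : SimpleGraph (Fin n)) (d : ℕ) : ℕ :=
  {v : Fin n | deg G v = d}.ncard

/-- No subgraph of `G` with `p ≤ k` vertices has more than `p` edges. -/
def NoDenseSubgraph {n : ℕ} (k : ℕ) (G : SimpleGraph (Fin n)) : Prop :=
  ∀ p ≤ k, ¬ ∃ H : G.Subgraph, H.verts.ncard = p ∧ p < H.edgeSet.ncard

/-- There are no two different cycles of `G` and a path from a vertex of the first to a vertex of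
the second such that the three lengths add up to at most `k`. -/
def NoCloseCycles {n : ℕ} (k : ℕ) (G : SimpleGraph (Fin n)) : Prop :=
  ¬ ∃ (u v : Fin n) (c₁ : G.Walk u u) (c₂ : G.Walk v v),
    c₁.IsCycle ∧ c₂.IsCycle ∧ c₁.toSubgraph ≠ c₂.toSubgraph ∧
    ∃ x ∈ c₁.support, ∃ y ∈ c₂.support, ∃ w : G.Walk x y,
      w.IsPath ∧ c₁.length + c₂.length + w.length ≤ k

/-- There is no path of length at most `k` from a vertex of degree less than `R` to a vertex of a
cycle of length at most `k`. Length `0` is allowed: no such cycle contains such a vertex. -/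
def NoCycleNearSmallDegree {n : ℕ} (R k : ℕ) (G : SimpleGraph (Fin n)) : Prop :=
  ¬ ∃ (v u : Fin n) (c : G.Walk u u),
    deg G v < R ∧ c.IsCycle ∧ c.length ≤ k ∧
    ∃ x ∈ c.support, ∃ w : G.Walk v x, w.IsPath ∧ w.length ≤ k

/-- There is a path of length at most `k` between `v` and `w`. -/
def Close {n : ℕ} (G : SimpleGraph (Fin n)) (k : ℕ) (v w : Fin n) : Prop :=
  ∃ p : G.Walk v w, p.IsPath ∧ p.length ≤ k

/-- No three distinct vertices of degree at most `R - 1` are pairwise joined by paths of length at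
most `k`. -/
def NoThreeClose {n : ℕ} (R k : ℕ) (G : SimpleGraph (Fin n)) : Prop :=
  ¬ ∃ v₁ v₂ v₃ : Fin n, v₁ ≠ v₂ ∧ v₁ ≠ v₃ ∧ v₂ ≠ v₃ ∧
    deg G v₁ ≤ R - 1 ∧ deg G v₂ ≤ R - 1 ∧ deg G v₃ ≤ R - 1 ∧
    Close G k v₁ v₂ ∧ Close G k v₁ v₃ ∧ Close G k v₂ v₃

/-- No vertex of degree at most `R - 2` is joined to another vertex of degree at most `R - 1` by a
path of length at most `k`. -/
def NoCloseToVerySmallDegree {n : ℕ} (R k : ℕ) (G : SimpleGraph (Fin n)) : Prop :=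
  ¬ ∃ v w : Fin n, v ≠ w ∧ deg G v ≤ R - 1 ∧ deg G w ≤ R - 2 ∧ Close G k v w

/-- For `3 ≤ p ≤ k` there are exactly `r p` `p`-cycles, and for `1 ≤ p ≤ k` there are exactly `s p`
`p`-paths with both endpoints of degree `R - 1`. -/
def HasCounts {n : ℕ} (R k : ℕ) (r s : ℕ → ℕ) (G : SimpleGraph (Fin n)) : Prop :=
  (∀ p ∈ Finset.Icc 3 k, numCycles G p = r p) ∧
  (∀ p ∈ Finset.Icc 1 k, numPaths G (R - 1) p = s p)

/-- `G` has a connected component with at most `k` vertices. -/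
def HasSmallComponent {n : ℕ} (k : ℕ) (G : SimpleGraph (Fin n)) : Prop :=
  ∃ C : G.ConnectedComponent, C.supp.ncard ≤ k

/-- The mass that the Poisson distribution with mean `μ` gives to `j`. -/
def poissonMass (μ : ℝ) (j : ℕ) : ℝ :=
  μ ^ j * Real.exp (-μ) / (j.factorial : ℝ)

/-- The limiting mean of the number of `p`-cycles. -/
def cycleMean (R p : ℕ) : ℝ :=
  ((R : ℝ) - 1) ^ p / (2 * (p : ℝ))

/-- The limiting mean of the number of `p`-paths with both endpoints of degree `R - 1`. -/
def pathMean (R p : ℕ) : ℝ :=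
  ((R : ℝ) - 1) ^ (p + 1) / 2

/-- The joint mass of independent Poisson variables with the above means, for `3 ≤ p ≤ k` and
`1 ≤ p ≤ k` respectively. -/
def jointMass (R k : ℕ) (r s : ℕ → ℕ) : ℝ :=
  (∏ p ∈ Finset.Icc 3 k, poissonMass (cycleMean R p) (r p)) *
  (∏ p ∈ Finset.Icc 1 k, poissonMass (pathMean R p) (s p))

end BoundedDegree

end

/-! Write d(v) = R - deg v for the deficiency of v and L = sqrt(Rn). Deleting the edges of a fixed
graph F is a bijection from the members of `graphs n R` that contain F onto those that are
edge-disjoint from F and satisfy d ≥ deg F at every vertex (`avg_switch`). All estimates are double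
counts over this switching.

Take F to be a single edge. A graph of total deficiency D has Rn - D ordered adjacent pairs and at
most D² ordered pairs of deficient vertices. Balancing the two makes values of D well below L
superpolynomially unlikely (`tendsto_prob_sumD_lt`); from above only the mean number of deficient
vertices is needed (`avg_defOut_le`). Switching the edges from a fixed u to the vertices outside a
bounded set then shows that raising d(u) from j to j + 1 multiplies a probability by about (R -
j)/L. Hence boundedly many deficiencies are asymptotically independent, and d(v) = j has probability
about R(R-1)...(R-j+1)/L^j (`eventually_prob_eq`).

The same switching shows that a given t-set V in which d(v) plus the number of neighbours of v in V
has sum above 2t occurs with probability O(L^(-2t-1)). There are at most n^t ≤ L^(2t) such sets, so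
almost surely no bounded set is dense (`tendsto_prob_bad`). This absence is a rigidity statement: if
d(v) plus the internal degree of v is at least 2 throughout a small set, it equals 2 throughout
(`eq_two_of_not_bad`). Cycles, and paths whose two distinct ends are deficient, satisfy the
inequality; two different such configurations that are close together would violate the equality.
This yields (i). A small component has R in place of 2 at each vertex, which yields (iii).

For (ii), let H have t vertices and maximum degree at most 2. Deleting a copy of H turns its
presence, up to a dense event, into the event that d = 2 at t given vertices. Its probability is
about (R(R-1)/L²)^t, and there are about n^t embeddings, so the expected number of copies tends to
(R-1)^t. In the absence of small dense sets two copies of connected patterns have equal or disjoint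
vertex sets. Therefore applying this to disjoint unions of cycles, paths and single vertices, and
dividing by automorphisms, gives exactly the joint factorial moments of independent Poisson
variables. Graphs with dense sets contribute negligibly to these moments (`numPresent_le`), and
truncated inclusion-exclusion turns moments into probabilities. -/

noncomputable section

namespace BoundedDegree

open scoped Classical

/-! ### Averages over the bounded-degree graphs and the switching bijection -/

section

variable {n : ℕ}

/-- The deficiency of a vertex. -/
def dfc (R : ℕ) (G : SimpleGraph (Fin n)) (v : Fin n) : ℕ :=
  R - deg G v

/-- The expectation of `φ` over a uniformly random member of `graphs n R`. -/
def avg (n R : ℕ) (φ : SimpleGraph (Fin n) → ℝ) : ℝ :=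
  (∑ G with G ∈ graphs n R, φ G) / ((graphs n R).ncard : ℝ)

/-- The probability of `Q` for a uniformly random member of `graphs n R`. -/
def prob (n R : ℕ) (Q : SimpleGraph (Fin n) → Prop) : ℝ :=
  avg n R (fun G => if Q G then 1 else 0)

theorem bot_mem_graphs (n R : ℕ) : (⊥ : SimpleGraph (Fin n)) ∈ graphs n R := by
  intro v
  simp [deg]

theorem ncard_graphs_pos (n R : ℕ) : (0 : ℝ) < ((graphs n R).ncard : ℝ) := by
  have : 0 < (graphs n R).ncard := (Set.ncard_pos (Set.toFinite _)).2 ⟨⊥, bot_mem_graphs n R⟩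
  exact_mod_cast this

theorem proportion_eq_prob (n R : ℕ) (Q : SimpleGraph (Fin n) → Prop) :
    proportion (graphs n R) Q = prob n R Q := by
  unfold proportion prob avg
  congr 1
  rw [Finset.sum_boole, Finset.filter_filter, Set.ncard_eq_toFinset_card']
  congr 2
  ext G
  simp

section avg

variable {R : ℕ}

theorem avg_mono {φ ψ : SimpleGraph (Fin n) → ℝ} (h : ∀ G ∈ graphs n R, φ G ≤ ψ G) :
    avg n R φ ≤ avg n R ψ := by
  unfold avg
  apply div_le_div_of_nonneg_right _ (ncard_graphs_pos n R).le
  apply Finset.sum_le_sum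
  intro G hG
  exact h G (Finset.mem_filter.1 hG).2

theorem avg_congr {φ ψ : SimpleGraph (Fin n) → ℝ} (h : ∀ G ∈ graphs n R, φ G = ψ G) :
    avg n R φ = avg n R ψ :=
  le_antisymm (avg_mono fun G hG => (h G hG).le) (avg_mono fun G hG => (h G hG).ge)

theorem avg_const (c : ℝ) : avg n R (fun _ => c) = c := by
  unfold avg
  have h := ncard_graphs_pos n R
  have : (Finset.univ.filter (fun G => G ∈ graphs n R)).card = (graphs n R).ncard := by
    rw [Set.ncard_eq_toFinset_card']
    congr 1
    ext G
    simp
  rw [Finset.sum_const, this, nsmul_eq_mul]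
  field_simp

theorem avg_add (φ ψ : SimpleGraph (Fin n) → ℝ) :
    avg n R (fun G => φ G + ψ G) = avg n R φ + avg n R ψ := by
  unfold avg
  rw [Finset.sum_add_distrib, add_div]

theorem avg_sub (φ ψ : SimpleGraph (Fin n) → ℝ) :
    avg n R (fun G => φ G - ψ G) = avg n R φ - avg n R ψ := by
  unfold avg
  rw [Finset.sum_sub_distrib, sub_div]

theorem avg_mul_left (c : ℝ) (φ : SimpleGraph (Fin n) → ℝ) :
    avg n R (fun G => c * φ G) = c * avg n R φ := by
  unfold avg
  rw [← Finset.mul_sum, mul_div_assoc]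

theorem avg_sum {ι : Type*} (s : Finset ι) (φ : ι → SimpleGraph (Fin n) → ℝ) :
    avg n R (fun G => ∑ i ∈ s, φ i G) = ∑ i ∈ s, avg n R (φ i) := by
  unfold avg
  rw [Finset.sum_comm, Finset.sum_div]

theorem avg_nonneg {φ : SimpleGraph (Fin n) → ℝ} (h : ∀ G ∈ graphs n R, 0 ≤ φ G) :
    0 ≤ avg n R φ := by
  rw [← avg_const (n := n) (R := R) 0]
  exact avg_mono h

theorem prob_nonneg (Q : SimpleGraph (Fin n) → Prop) : 0 ≤ prob n R Q := by
  apply avg_nonneg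
  intro G _
  split_ifs <;> norm_num

theorem prob_mono {Q Q' : SimpleGraph (Fin n) → Prop} (h : ∀ G ∈ graphs n R, Q G → Q' G) :
    prob n R Q ≤ prob n R Q' := by
  apply avg_mono
  intro G hG
  by_cases h1 : Q G
  · simp [h1, h G hG h1]
  · simp only [h1, if_false]
    split_ifs <;> norm_num

theorem prob_congr {Q Q' : SimpleGraph (Fin n) → Prop} (h : ∀ G ∈ graphs n R, (Q G ↔ Q' G)) :
    prob n R Q = prob n R Q' :=
  le_antisymm (prob_mono fun G hG => (h G hG).1) (prob_mono fun G hG => (h G hG).2)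

theorem prob_le_one (Q : SimpleGraph (Fin n) → Prop) : prob n R Q ≤ 1 := by
  rw [← avg_const (n := n) (R := R) 1]
  apply avg_mono
  intro G _
  split_ifs <;> norm_num

theorem prob_true : prob n R (fun _ => True) = 1 := by
  unfold prob
  simp [avg_const]

theorem prob_le_sum {ι : Type*} (s : Finset ι) {Q : SimpleGraph (Fin n) → Prop}
    {P : ι → SimpleGraph (Fin n) → Prop} (h : ∀ G ∈ graphs n R, Q G → ∃ i ∈ s, P i G) :
    prob n R Q ≤ ∑ i ∈ s, prob n R (P i) := by
  unfold prob
  rw [← avg_sum]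
  apply avg_mono
  intro G hG
  by_cases hQ : Q G
  · obtain ⟨i, hi, hP⟩ := h G hG hQ
    rw [if_pos hQ]
    calc (1 : ℝ) = if P i G then 1 else 0 := by rw [if_pos hP]
      _ ≤ _ := Finset.single_le_sum (f := fun i => if P i G then (1 : ℝ) else 0)
          (fun j _ => by split_ifs <;> norm_num) hi
  · rw [if_neg hQ]
    exact Finset.sum_nonneg fun j _ => by split_ifs <;> norm_num

theorem prob_le_add {Q P₁ P₂ : SimpleGraph (Fin n) → Prop}
    (h : ∀ G ∈ graphs n R, Q G → P₁ G ∨ P₂ G) :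
    prob n R Q ≤ prob n R P₁ + prob n R P₂ := by
  unfold prob
  rw [← avg_add]
  apply avg_mono
  intro G hG
  have := h G hG
  by_cases h0 : Q G <;> by_cases h1 : P₁ G <;> by_cases h2 : P₂ G <;> simp_all

theorem prob_not (Q : SimpleGraph (Fin n) → Prop) :
    prob n R (fun G => ¬ Q G) = 1 - prob n R Q := by
  rw [eq_sub_iff_add_eq, ← prob_true (n := n) (R := R)]
  unfold prob
  rw [← avg_add]
  apply avg_congr
  intro G _
  by_cases h : Q G <;> simp [h]

end avg

theorem deg_eq_card (G : SimpleGraph (Fin n)) (v : Fin n) :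
    deg G v = (Finset.univ.filter (fun w => G.Adj v w)).card := by
  unfold deg
  rw [← SimpleGraph.card_neighborFinset_eq_degree]
  congr 1
  ext w
  simp

theorem deg_sdiff {G F : SimpleGraph (Fin n)} (h : F ≤ G) (v : Fin n) :
    deg (G \ F) v + deg F v = deg G v := by
  simp only [deg_eq_card]
  rw [← Finset.card_union_of_disjoint]
  · congr 1
    ext w
    simp only [SimpleGraph.sdiff_adj, Finset.mem_union, Finset.mem_filter, Finset.mem_univ,
      true_and]
    have : F.Adj v w → G.Adj v w := fun h' => h h'
    tauto
  · rw [Finset.disjoint_left]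
    intro w
    simp

theorem disjoint_iff_not_adj {G F : SimpleGraph (Fin n)} :
    Disjoint G F ↔ ∀ u v, F.Adj u v → ¬ G.Adj u v := by
  rw [disjoint_iff]
  constructor
  · intro h u v hF hG
    have : (G ⊓ F).Adj u v := ⟨hG, hF⟩
    rw [h] at this
    exact this
  · intro h
    ext u v
    simp only [SimpleGraph.inf_adj, SimpleGraph.bot_adj, iff_false, not_and]
    exact fun hG hF => h u v hF hG

theorem deg_sup {G F : SimpleGraph (Fin n)} (h : Disjoint G F) (v : Fin n) :
    deg (G ⊔ F) v = deg G v + deg F v := by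
  have := deg_sdiff (G := G ⊔ F) (F := F) le_sup_right v
  rw [← this, sup_sdiff_right_self, h.sdiff_eq_left]

/-- Deleting F and adding F are mutually inverse. The condition on deficiencies says that adding F
keeps all degrees at most R. -/
theorem avg_switch {R : ℕ} (F : SimpleGraph (Fin n)) (ψ : SimpleGraph (Fin n) → ℝ) :
    avg n R (fun G => if F ≤ G then ψ (G \ F) else 0) =
      avg n R (fun G => if Disjoint G F ∧ ∀ v, deg F v ≤ dfc R G v then ψ G else 0) := by
  unfold avg
  congr 1
  rw [← Finset.sum_filter, ← Finset.sum_filter]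
  refine Finset.sum_nbij' (fun G => G \ F) (fun G => G ⊔ F) ?_ ?_ ?_ ?_ ?_
  · intro G hG
    simp only [Finset.mem_filter, Finset.mem_univ, true_and] at hG ⊢
    obtain ⟨hG, hF⟩ := hG
    refine ⟨fun v => ?_, disjoint_sdiff_self_left, fun v => ?_⟩
    · have := deg_sdiff hF v
      have := hG v
      omega
    · have := deg_sdiff hF v
      have := hG v
      unfold dfc
      omega
  · intro G hG
    simp only [Finset.mem_filter, Finset.mem_univ, true_and] at hG ⊢
    obtain ⟨hG, hF, hd⟩ := hG
    refine ⟨fun v => ?_, le_sup_right⟩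
    have := deg_sup hF v
    have := hG v
    have := hd v
    unfold dfc at this
    omega
  · intro G hG
    simp only [Finset.mem_filter, Finset.mem_univ, true_and] at hG
    exact sdiff_sup_cancel hG.2
  · intro G hG
    simp only [Finset.mem_filter, Finset.mem_univ, true_and] at hG
    show (G ⊔ F) \ F = G
    rw [sup_sdiff_right_self, hG.2.1.sdiff_eq_left]
  · intro G _
    rfl

theorem dfc_sdiff {R : ℕ} {G F : SimpleGraph (Fin n)} (hG : G ∈ graphs n R) (h : F ≤ G)
    (v : Fin n) : dfc R (G \ F) v = dfc R G v + deg F v := by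
  have := deg_sdiff h v
  have := hG v
  unfold dfc
  omega

theorem prob_switch {R : ℕ} (F : SimpleGraph (Fin n)) {Q Q' : SimpleGraph (Fin n) → Prop}
    (h : ∀ G ∈ graphs n R, F ≤ G → (Q G ↔ Q' (G \ F))) :
    prob n R (fun G => F ≤ G ∧ Q G) =
      prob n R (fun G => Disjoint G F ∧ (∀ v, deg F v ≤ dfc R G v) ∧ Q' G) := by
  have := avg_switch (R := R) F (fun G => if Q' G then (1 : ℝ) else 0)
  unfold prob
  convert this using 1
  · apply avg_congr
    intro G hG
    by_cases hF : F ≤ G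
    · simp [hF, h G hG hF]
    · simp [hF]
  · apply avg_congr
    intro G _
    simp only [← and_assoc, ite_and]

theorem deg_edge {u v : Fin n} (h : u ≠ v) (w : Fin n) :
    deg (SimpleGraph.edge u v) w = if w = u ∨ w = v then 1 else 0 := by
  rw [deg_eq_card]
  split_ifs with hw
  · rw [Finset.card_eq_one]
    rcases hw with rfl | rfl
    · refine ⟨v, ?_⟩
      ext x
      simp [SimpleGraph.edge_adj]
      grind
    · refine ⟨u, ?_⟩
      ext x
      simp [SimpleGraph.edge_adj]
      grind
  · rw [Finset.card_eq_zero]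
    ext x
    simp [SimpleGraph.edge_adj]
    grind

theorem edge_le_iff_adj {G : SimpleGraph (Fin n)} {u v : Fin n} (h : u ≠ v) :
    SimpleGraph.edge u v ≤ G ↔ G.Adj u v := by
  rw [SimpleGraph.edge_le_iff]
  simp [h]

theorem disjoint_edge_iff {G : SimpleGraph (Fin n)} {u v : Fin n} (h : u ≠ v) :
    Disjoint G (SimpleGraph.edge u v) ↔ ¬ G.Adj u v := by
  rw [disjoint_iff_not_adj]
  constructor
  · intro h'
    exact h' u v (by simp [SimpleGraph.edge_adj, h])
  · intro h' a b hab hG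
    rw [SimpleGraph.edge_adj] at hab
    rcases hab.1 with ⟨rfl, rfl⟩ | ⟨rfl, rfl⟩
    · exact h' hG
    · exact h' hG.symm

theorem prob_adj_of_switch {R : ℕ} {u v : Fin n} (huv : u ≠ v)
    (Q Q' : SimpleGraph (Fin n) → Prop)
    (h : ∀ G ∈ graphs n R, G.Adj u v → (Q G ↔ Q' (G \ SimpleGraph.edge u v))) :
    prob n R (fun G => G.Adj u v ∧ Q G) =
      prob n R (fun G => ¬ G.Adj u v ∧ 1 ≤ dfc R G u ∧ 1 ≤ dfc R G v ∧ Q' G) := by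
  have key := prob_switch (R := R) (SimpleGraph.edge u v) (Q := Q) (Q' := Q')
    (fun G hG hF => h G hG ((edge_le_iff_adj huv).1 hF))
  simp only [edge_le_iff_adj huv, disjoint_edge_iff huv] at key
  rw [key]
  apply prob_congr
  intro G _
  have : (∀ w, deg (SimpleGraph.edge u v) w ≤ dfc R G w) ↔ 1 ≤ dfc R G u ∧ 1 ≤ dfc R G v := by
    constructor
    · intro h
      have h1 := h u
      have h2 := h v
      rw [deg_edge huv] at h1 h2
      rw [if_pos (Or.inl rfl)] at h1
      rw [if_pos (Or.inr rfl)] at h2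
      exact ⟨h1, h2⟩
    · rintro ⟨h1, h2⟩ w
      rw [deg_edge huv]
      split_ifs with hw
      · rcases hw with rfl | rfl <;> assumption
      · omega
  rw [this]
  tauto

theorem dfc_sdiff_edge {R : ℕ} {G : SimpleGraph (Fin n)} (hG : G ∈ graphs n R) {u v : Fin n}
    (h : G.Adj u v) :
    dfc R (G \ SimpleGraph.edge u v) =
      fun w => dfc R G w + if w = u ∨ w = v then 1 else 0 := by
  ext w
  rw [dfc_sdiff hG ((edge_le_iff_adj h.ne).2 h), deg_edge h.ne]

/-- Deleting the edge `uv` raises the deficiencies of its ends by one. -/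
theorem prob_adj {R : ℕ} {u v : Fin n} (huv : u ≠ v) (Q Q' : (Fin n → ℕ) → Prop)
    (h : ∀ G ∈ graphs n R, G.Adj u v →
      (Q (dfc R G) ↔ Q' (fun w => dfc R G w + if w = u ∨ w = v then 1 else 0))) :
    prob n R (fun G => G.Adj u v ∧ Q (dfc R G)) =
      prob n R (fun G => ¬ G.Adj u v ∧ 1 ≤ dfc R G u ∧ 1 ≤ dfc R G v ∧ Q' (dfc R G)) := by
  refine prob_adj_of_switch huv (fun G => Q (dfc R G)) (fun G => Q' (dfc R G)) ?_
  intro G hG ha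
  rw [h G hG ha, dfc_sdiff_edge hG ha]

end

/-! ### The total deficiency is rarely below its typical size -/

section

variable {n : ℕ}

/-- The total deficiency of a graph. -/
def sumD (R : ℕ) (G : SimpleGraph (Fin n)) : ℕ :=
  ∑ v, dfc R G v

/-- The order of magnitude of the total deficiency. -/
def scale (R n : ℕ) : ℝ :=
  Real.sqrt ((R : ℝ) * n)

theorem scale_nonneg (R n : ℕ) : 0 ≤ scale R n := Real.sqrt_nonneg _

theorem scale_sq (R n : ℕ) : scale R n ^ 2 = R * n := by
  unfold scale
  rw [Real.sq_sqrt (by positivity)]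

theorem tendsto_scale {R : ℕ} (hR : 0 < R) : Tendsto (scale R) atTop atTop := by
  unfold scale
  apply Real.tendsto_sqrt_atTop.comp
  apply Tendsto.const_mul_atTop (by exact_mod_cast hR)
  exact tendsto_natCast_atTop_atTop

theorem deg_add_dfc {R : ℕ} {G : SimpleGraph (Fin n)} (hG : G ∈ graphs n R) (v : Fin n) :
    deg G v + dfc R G v = R := by
  have := hG v
  unfold dfc
  omega

theorem sum_deg_add_sumD {R : ℕ} {G : SimpleGraph (Fin n)} (hG : G ∈ graphs n R) :
    ∑ v, deg G v + sumD R G = n * R := by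
  unfold sumD
  rw [← Finset.sum_add_distrib]
  simp [deg_add_dfc hG]

theorem sum_adj_eq_sum_deg (G : SimpleGraph (Fin n)) :
    ∑ u, ∑ v, (if G.Adj u v then (1 : ℝ) else 0) = ((∑ v, deg G v : ℕ) : ℝ) := by
  push_cast
  apply Finset.sum_congr rfl
  intro u _
  rw [deg_eq_card, Finset.sum_boole]

theorem sum_adj_eq {R : ℕ} {G : SimpleGraph (Fin n)} (hG : G ∈ graphs n R) :
    ∑ u, ∑ v, (if G.Adj u v then (1 : ℝ) else 0) = (R : ℝ) * n - sumD R G := by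
  rw [sum_adj_eq_sum_deg]
  have : ((∑ v, deg G v : ℕ) : ℝ) + sumD R G = n * R := by exact_mod_cast sum_deg_add_sumD hG
  linarith

theorem card_deficient_le_sumD (R : ℕ) (G : SimpleGraph (Fin n)) :
    (Finset.univ.filter (fun v => 1 ≤ dfc R G v)).card ≤ sumD R G := by
  unfold sumD
  rw [Finset.card_filter]
  apply Finset.sum_le_sum
  intro v _
  split_ifs <;> omega

/-- Switching one edge raises the total deficiency from s to s + 2. Before it there are exactly Rn -
s ordered adjacent pairs; after it the pair consists of deficient vertices, of which there are at
most s + 2. -/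
theorem prob_sumD_step (n R s : ℕ) :
    ((R : ℝ) * n - s) * prob n R (fun G => sumD R G = s) ≤
      ((s : ℝ) + 2) ^ 2 * prob n R (fun G => sumD R G = s + 2) := by
  have h1 : ((R : ℝ) * n - s) * prob n R (fun G => sumD R G = s) =
      ∑ u, ∑ v, prob n R (fun G => G.Adj u v ∧ sumD R G = s) := by
    unfold prob
    simp_rw [← avg_sum]
    rw [← avg_mul_left]
    apply avg_congr
    intro G hG
    by_cases hs : sumD R G = s
    · simp only [hs, and_true, if_true]
      rw [sum_adj_eq hG, hs, mul_one]
    · simp [hs]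
  have h2 : ∑ u, ∑ v, prob n R (fun G => 1 ≤ dfc R G u ∧ 1 ≤ dfc R G v ∧ sumD R G = s + 2) ≤
      ((s : ℝ) + 2) ^ 2 * prob n R (fun G => sumD R G = s + 2) := by
    unfold prob
    simp_rw [← avg_sum]
    rw [← avg_mul_left]
    apply avg_mono
    intro G hG
    by_cases hs : sumD R G = s + 2
    · simp only [hs, and_true, if_true]
      have hc := card_deficient_le_sumD R G
      have : ∑ u, ∑ v, (if 1 ≤ dfc R G u ∧ 1 ≤ dfc R G v then (1 : ℝ) else 0) =
          ((Finset.univ.filter (fun v => 1 ≤ dfc R G v)).card : ℝ) ^ 2 := by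
        rw [sq, ← Finset.sum_boole, Finset.sum_mul_sum]
        apply Finset.sum_congr rfl
        intro u _
        apply Finset.sum_congr rfl
        intro v _
        by_cases h1 : 1 ≤ dfc R G u <;> by_cases h2 : 1 ≤ dfc R G v <;> simp [h1, h2]
      rw [this, mul_one]
      have hc' : ((Finset.univ.filter (fun v => 1 ≤ dfc R G v)).card : ℝ) ≤ (s : ℝ) + 2 := by
        rw [hs] at hc
        exact_mod_cast hc
      gcongr
    · simp [hs]
  rw [h1]
  refine le_trans ?_ h2
  apply Finset.sum_le_sum
  intro u _
  apply Finset.sum_le_sum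
  intro v _
  by_cases huv : u = v
  · subst huv
    refine le_trans (prob_mono (Q' := fun _ => False) ?_) ?_
    · intro G _ h
      exact absurd h.1 (SimpleGraph.irrefl G)
    · have : prob n R (fun _ => False) = 0 := by
        unfold prob
        simp [avg_const]
      rw [this]
      exact prob_nonneg _
  · have := prob_adj (R := R) huv (fun d => ∑ w, d w = s) (fun d => ∑ w, d w = s + 2) (by
      intro G _ _
      have : ∑ w : Fin n, (if w = u ∨ w = v then 1 else 0) = 2 := by
        rw [← Finset.card_filter]
        have : (Finset.univ.filter (fun w => w = u ∨ w = v)) = {u, v} := by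
          ext w
          simp
        rw [this, Finset.card_pair huv]
      rw [Finset.sum_add_distrib, this]
      omega)
    unfold sumD
    rw [this]
    apply prob_mono
    intro G _ h
    exact h.2

/-- As long as s + 2 ≤ (1 - ε)L, the ratio (s + 2)²/(Rn - s) of the one-step bound is at most (1 -
ε)²L²/((1 - ε)L²) = 1 - ε. The hypothesis on j leaves room for j such steps, and L ≥ 2/ε makes s
negligible against Rn = L². -/
theorem prob_sumD_geometric {n R : ℕ} {ε : ℝ} (hε : 0 < ε) (hε1 : ε < 1)
    (hL : 2 / ε ≤ scale R n) (j s : ℕ) (hs : (s : ℝ) + 2 * j ≤ (1 - ε) * scale R n) :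
    prob n R (fun G => sumD R G = s) ≤ (1 - ε) ^ j := by
  induction j generalizing s with
  | zero => simpa using prob_le_one _
  | succ j ih =>
    have h1 := prob_sumD_step n R s
    have h2 := ih (s + 2) (by push_cast at hs ⊢; linarith)
    push_cast at hs
    set L := scale R n with hLdef
    have hL2 : 2 ≤ ε * L := by
      rw [div_le_iff₀ hε] at hL
      linarith
    have hj : (0 : ℝ) ≤ j := by positivity
    have hs0 : (0 : ℝ) ≤ s := by positivity
    have hLpos : 0 < L := by
      by_contra h
      push Not at h
      nlinarith
    have h3 : ((s : ℝ) + 2) ^ 2 ≤ (1 - ε) ^ 2 * L ^ 2 := by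
      rw [← mul_pow]
      apply pow_le_pow_left₀ (by positivity)
      linarith
    have h4 : (1 - ε) * L ^ 2 ≤ (R : ℝ) * n - s := by
      rw [← scale_sq, ← hLdef]
      nlinarith
    have h5 : (1 - ε) * L ^ 2 * prob n R (fun G => sumD R G = s) ≤
        (1 - ε) ^ 2 * L ^ 2 * (1 - ε) ^ j := by
      calc _ ≤ ((R : ℝ) * n - s) * prob n R (fun G => sumD R G = s) :=
            mul_le_mul_of_nonneg_right h4 (prob_nonneg _)
        _ ≤ _ := h1
        _ ≤ _ := mul_le_mul h3 h2 (prob_nonneg _) (by positivity)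
    have h6 : 0 < (1 - ε) * L ^ 2 := by
      have : 0 < 1 - ε := by linarith
      positivity
    rw [pow_succ]
    refine le_of_mul_le_mul_left ?_ h6
    calc _ ≤ _ := h5
      _ = _ := by ring

/-- The total deficiency is superpolynomially unlikely to lie below `(1 - ε) * scale R n`. -/
theorem tendsto_prob_sumD_lt {R : ℕ} (hR : 0 < R) {ε : ℝ} (hε : 0 < ε) (hε1 : ε < 1) (K : ℕ) :
    Tendsto (fun n => prob n R (fun G => (sumD R G : ℝ) < (1 - ε) * scale R n) *
      scale R n ^ K) atTop (𝓝 0) := by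
  set δ := ε / 2 with hδ
  have hδ0 : 0 < δ := by positivity
  have hδ1 : δ < 1 := by linarith
  -- From s < (1 - ε)L there is room for j steps of size 2 below (1 - ε/2)L, because 2j ≤ (ε/2)L.
  -- The resulting factor (1 - δ)^j is exponentially small in L and beats every power of L.
  set j : ℕ → ℕ := fun n => ⌊ε / 4 * scale R n⌋₊ with hj
  have hjt : Tendsto j atTop atTop := by
    apply tendsto_nat_floor_atTop.comp
    exact (tendsto_scale hR).const_mul_atTop (by positivity)
  have hbound : Tendsto (fun m : ℕ => ((4 / ε + 1) * ((m : ℝ) + 1)) ^ (K + 1) * (1 - δ) ^ m)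
      atTop (𝓝 0) := by
    have h1 := tendsto_pow_const_mul_const_pow_of_abs_lt_one (K + 1) (r := 1 - δ)
      (by rw [abs_lt]; constructor <;> linarith)
    have h2 := (h1.comp (tendsto_add_atTop_nat 1)).const_mul ((4 / ε + 1) ^ (K + 1) / (1 - δ))
    rw [mul_zero] at h2
    refine h2.congr fun m => ?_
    have : (1 - δ) ≠ 0 := by linarith
    simp only [Function.comp, mul_pow, pow_succ]
    push_cast
    field_simp
  refine squeeze_zero' (Eventually.of_forall fun n => ?_) ?_ (hbound.comp hjt)
  · exact mul_nonneg (prob_nonneg _) (pow_nonneg (scale_nonneg _ _) _)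
  filter_upwards [(tendsto_scale hR).eventually_ge_atTop (2 / δ),
    (tendsto_scale hR).eventually_ge_atTop 1] with n hn hn1
  set L := scale R n with hLdef
  have hLj : L ≤ 4 / ε * ((j n : ℝ) + 1) := by
    have := (Nat.lt_floor_add_one (ε / 4 * L)).le
    rw [div_mul_eq_mul_div, le_div_iff₀ hε]
    simp only [hj]
    linarith
  have hjL : (j n : ℝ) ≤ ε / 4 * L := Nat.floor_le (by positivity)
  have h1 : prob n R (fun G => (sumD R G : ℝ) < (1 - ε) * L) ≤
      ∑ s ∈ (Finset.range (⌊L⌋₊ + 1)).filter (fun s : ℕ => (s : ℝ) < (1 - ε) * L),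
        prob n R (fun G => sumD R G = s) := by
    apply prob_le_sum
    intro G _ h
    refine ⟨sumD R G, ?_, rfl⟩
    rw [Finset.mem_filter, Finset.mem_range, Nat.lt_succ_iff]
    refine ⟨Nat.le_floor ?_, h⟩
    nlinarith
  have h2 : prob n R (fun G => (sumD R G : ℝ) < (1 - ε) * L) ≤ (L + 1) * (1 - δ) ^ (j n) := by
    refine h1.trans ?_
    refine (Finset.sum_le_card_nsmul _ _ ((1 - δ) ^ (j n)) ?_).trans ?_
    · intro s hs
      apply prob_sumD_geometric hδ0 hδ1 hn
      have := (Finset.mem_filter.1 hs).2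
      rw [← hLdef, hδ]
      linarith
    · rw [nsmul_eq_mul]
      apply mul_le_mul_of_nonneg_right _ (pow_nonneg (by linarith) _)
      have h3 : ((Finset.range (⌊L⌋₊ + 1)).filter (fun s : ℕ => (s : ℝ) < (1 - ε) * L)).card ≤
          ⌊L⌋₊ + 1 := (Finset.card_filter_le _ _).trans (by simp)
      have h4 : (⌊L⌋₊ : ℝ) ≤ L := Nat.floor_le (by linarith)
      have h5 : (((Finset.range (⌊L⌋₊ + 1)).filter
          (fun s : ℕ => (s : ℝ) < (1 - ε) * L)).card : ℝ) ≤ ⌊L⌋₊ + 1 := by exact_mod_cast h3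
      linarith
  have hj0 : (0 : ℝ) ≤ j n := by positivity
  have hq : (0 : ℝ) ≤ (1 - δ) ^ (j n) := pow_nonneg (by linarith) _
  calc _ ≤ (L + 1) * (1 - δ) ^ (j n) * L ^ K :=
        mul_le_mul_of_nonneg_right h2 (by positivity)
    _ ≤ (L + 1) * (1 - δ) ^ (j n) * (L + 1) ^ K := by
        gcongr
        linarith
    _ = (L + 1) ^ (K + 1) * (1 - δ) ^ (j n) := by ring
    _ ≤ _ := by
        simp only [Function.comp]
        gcongr
        nlinarith

end

/-! ### Moment bounds for deficiencies, and rarity of dense sets -/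

section

variable {n : ℕ}

/-- The neighbours of `v` in `V`. -/
def inNbr (V : Finset (Fin n)) (G : SimpleGraph (Fin n)) (v : Fin n) : ℕ :=
  (V.filter (fun w => G.Adj v w)).card

/-- The number of deficient non-neighbours of `u` outside `V`. -/
def freeOut (R : ℕ) (V : Finset (Fin n)) (G : SimpleGraph (Fin n)) (u : Fin n) : ℕ :=
  (Vᶜ.filter (fun v => ¬ G.Adj u v ∧ 1 ≤ dfc R G v)).card

/-- The single-edge switching summed over all edges from u to vertices outside V. The event concerns
only deficiencies in V, so of the two changes made by a switch it sees only the one at u. -/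
theorem avg_star {R : ℕ} {V : Finset (Fin n)} {u : Fin n} (hu : u ∈ V) (Q : (Fin n → ℕ) → Prop)
    (hQ : ∀ d d', (∀ w ∈ V, d w = d' w) → (Q d ↔ Q d')) :
    avg n R (fun G => if Q (fun w => dfc R G w + if w = u then 1 else 0)
        then (inNbr Vᶜ G u : ℝ) else 0) =
      avg n R (fun G => if 1 ≤ dfc R G u ∧ Q (dfc R G) then (freeOut R V G u : ℝ) else 0) := by
  have h : ∀ v ∈ Vᶜ, prob n R (fun G => G.Adj u v ∧
      Q (fun w => dfc R G w + if w = u then 1 else 0)) =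
      prob n R (fun G => ¬ G.Adj u v ∧ 1 ≤ dfc R G u ∧ 1 ≤ dfc R G v ∧ Q (dfc R G)) := by
    intro v hv
    rw [Finset.mem_compl] at hv
    have huv : u ≠ v := fun h => hv (h ▸ hu)
    refine prob_adj huv (fun d => Q (fun w => d w + if w = u then 1 else 0)) Q ?_
    intro G _ _
    apply hQ
    intro w hw
    have : w ≠ v := fun h => hv (h ▸ hw)
    simp [this]
  have h' := Finset.sum_congr (rfl : Vᶜ = Vᶜ) h
  unfold prob at h'
  rw [← avg_sum, ← avg_sum] at h'
  convert h' using 1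
  · apply avg_congr
    intro G _
    by_cases h1 : Q (fun w => dfc R G w + if w = u then 1 else 0)
    · simp only [h1, if_true, and_true]
      rw [Finset.sum_boole, inNbr]
    · simp [h1]
  · apply avg_congr
    intro G _
    by_cases h1 : 1 ≤ dfc R G u ∧ Q (dfc R G)
    · rw [if_pos h1]
      simp only [h1.1, h1.2, true_and, and_true]
      rw [Finset.sum_boole, freeOut]
    · rw [if_neg h1]
      symm
      apply Finset.sum_eq_zero
      intro v _
      rw [if_neg]
      tauto

theorem inNbr_le_deg (V : Finset (Fin n)) (G : SimpleGraph (Fin n)) (v : Fin n) :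
    inNbr V G v ≤ deg G v := by
  rw [deg_eq_card, inNbr]
  exact Finset.card_le_card (Finset.filter_subset_filter _ (Finset.subset_univ _))

theorem dfc_le (R : ℕ) (G : SimpleGraph (Fin n)) (v : Fin n) : dfc R G v ≤ R := by
  unfold dfc
  omega

theorem sumD_le_mul_card (R : ℕ) (G : SimpleGraph (Fin n)) :
    sumD R G ≤ R * (Finset.univ.filter (fun v => 1 ≤ dfc R G v)).card := by
  unfold sumD
  rw [Finset.card_filter, Finset.mul_sum]
  apply Finset.sum_le_sum
  intro v _
  have := dfc_le R G v
  split_ifs <;> omega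

theorem card_deficient_le_freeOut {R : ℕ} {G : SimpleGraph (Fin n)} (hG : G ∈ graphs n R)
    (V : Finset (Fin n)) (u : Fin n) :
    (Finset.univ.filter (fun v => 1 ≤ dfc R G v)).card ≤ freeOut R V G u + V.card + R := by
  have h1 : Finset.univ.filter (fun v => 1 ≤ dfc R G v) ⊆
      Vᶜ.filter (fun v => ¬ G.Adj u v ∧ 1 ≤ dfc R G v) ∪ V ∪
        Finset.univ.filter (fun w => G.Adj u w) := by
    intro v
    simp only [Finset.mem_filter, Finset.mem_union, Finset.mem_univ, true_and, Finset.mem_compl]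
    tauto
  have h2 := hG u
  rw [deg_eq_card] at h2
  have h3 := (Finset.card_le_card h1).trans (Finset.card_union_le _ _)
  have h4 := Finset.card_union_le (Vᶜ.filter (fun v => ¬ G.Adj u v ∧ 1 ≤ dfc R G v)) V
  unfold freeOut
  omega

/-- Each unit of prescribed deficiency costs a factor of order 1/L. Lowering f by one at u, the star
identity compares at most R neighbours of u with the deficient non-neighbours of u outside V. Of the
latter there are at least L/(4R) once the total deficiency is at least L/2, since V and the
neighbourhood of u exclude only boundedly many. -/
theorem eventually_prob_ge_le {R : ℕ} (hR : 0 < R) (t m : ℕ) :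
    ∃ C : ℝ, 0 ≤ C ∧ ∀ᶠ n in atTop, ∀ (V : Finset (Fin n)) (f : Fin n → ℕ), V.card ≤ t →
      ∑ v ∈ V, f v = m →
      prob n R (fun G => ∀ v ∈ V, f v ≤ dfc R G v) * scale R n ^ m ≤ C := by
  induction m with
  | zero =>
    refine ⟨1, zero_le_one, Eventually.of_forall fun n V f _ _ => ?_⟩
    simpa using prob_le_one _
  | succ m ih =>
    obtain ⟨C, hC, ih⟩ := ih
    have hR' : (0 : ℝ) < R := by exact_mod_cast hR
    -- The factor 4R² is R divided by 1/(4R); the summand 1 pays for the rare event that the total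
    -- deficiency is below L/2.
    refine ⟨4 * R ^ 2 * C + 1, by positivity, ?_⟩
    have ht := (tendsto_prob_sumD_lt hR (ε := 1 / 2) (by norm_num) (by norm_num)
      (m + 1)).eventually_lt_const (show (0 : ℝ) < 1 / (4 * R) by positivity)
    filter_upwards [ih, ht, (tendsto_scale hR).eventually_ge_atTop (4 * R * (t + R)),
      (tendsto_scale hR).eventually_ge_atTop 1] with n ih ht hL hL1 V f hV hf
    set L := scale R n
    have hf0 : ∃ u ∈ V, f u ≠ 0 := by
      by_contra h
      push Not at h
      rw [Finset.sum_eq_zero h] at hf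
      omega
    obtain ⟨u, hu, hfu⟩ := hf0
    set g : Fin n → ℕ := fun w => f w - if w = u then 1 else 0 with hg
    have hgm : ∑ v ∈ V, g v = m := by
      have h1 : ∑ v ∈ V, f v = ∑ v ∈ V, g v + ∑ v ∈ V, if v = u then 1 else 0 := by
        rw [← Finset.sum_add_distrib]
        apply Finset.sum_congr rfl
        intro v _
        simp only [hg]
        split_ifs with h
        · subst h
          omega
        · omega
      rw [Finset.sum_ite_eq' V u, if_pos hu, hf] at h1
      omega
    have h1 := avg_star (R := R) hu (fun d => ∀ w ∈ V, f w ≤ d w) (by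
      intro d d' h
      exact forall₂_congr fun w hw => by rw [h w hw])
    have h2 : avg n R (fun G => if ∀ w ∈ V, f w ≤ dfc R G w + (if w = u then 1 else 0)
        then (inNbr Vᶜ G u : ℝ) else 0) ≤ R * prob n R (fun G => ∀ v ∈ V, g v ≤ dfc R G v) := by
      unfold prob
      rw [← avg_mul_left]
      apply avg_mono
      intro G hG
      have : (∀ w ∈ V, f w ≤ dfc R G w + (if w = u then 1 else 0)) ↔
          ∀ v ∈ V, g v ≤ dfc R G v :=
        forall₂_congr fun w _ => by simp only [hg]; omega
      simp only [this]
      have h3 : (inNbr Vᶜ G u : ℝ) ≤ R := by exact_mod_cast (inNbr_le_deg _ G u).trans (hG u)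
      split_ifs <;> simp [h3]
    have h3 : (L / (4 * R)) * (prob n R (fun G => ∀ v ∈ V, f v ≤ dfc R G v) -
        prob n R (fun G => (sumD R G : ℝ) < (1 - 1 / 2) * L)) ≤
        avg n R (fun G => if 1 ≤ dfc R G u ∧ ∀ w ∈ V, f w ≤ dfc R G w
          then (freeOut R V G u : ℝ) else 0) := by
      unfold prob
      rw [← avg_sub, ← avg_mul_left]
      apply avg_mono
      intro G hG
      have hc : (0 : ℝ) ≤ L / (4 * R) := by positivity
      by_cases hE : ∀ v ∈ V, f v ≤ dfc R G v
      · have hu1 : 1 ≤ dfc R G u := by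
          have := hE u hu
          omega
        rw [if_pos hE,
          if_pos (⟨hu1, hE⟩ : 1 ≤ dfc R G u ∧ ∀ w ∈ V, f w ≤ dfc R G w)]
        split_ifs with hS
        · simp
        · push Not at hS
          have h4 := sumD_le_mul_card R G
          have h5 := card_deficient_le_freeOut hG V u
          have h6 : sumD R G ≤ R * (freeOut R V G u + t + R) :=
            h4.trans (Nat.mul_le_mul_left _ (by omega))
          have h7 : (sumD R G : ℝ) ≤ R * (freeOut R V G u + t + R) := by exact_mod_cast h6
          rw [sub_zero, mul_one, div_le_iff₀ (by positivity)]
          nlinarith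
      · rw [if_neg hE,
          if_neg (fun h : 1 ≤ dfc R G u ∧ ∀ w ∈ V, f w ≤ dfc R G w => hE h.2)]
        split_ifs
        · simp only [zero_sub, mul_neg, mul_one]
          linarith
        · simp
    have h4 := ih V g hV hgm
    have h5 := h3.trans (le_trans (le_of_eq (by convert h1.symm)) h2)
    set p' := prob n R (fun G => ∀ v ∈ V, f v ≤ dfc R G v)
    set p := prob n R (fun G => ∀ v ∈ V, g v ≤ dfc R G v)
    set τ := prob n R (fun G => (sumD R G : ℝ) < (1 - 1 / 2) * L)
    have h6 : L * (p' - τ) ≤ 4 * R ^ 2 * p := by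
      rw [div_mul_eq_mul_div, div_le_iff₀ (by positivity)] at h5
      linarith
    have hLm : 0 ≤ L ^ m := by positivity
    have h7 : τ * L ^ (m + 1) ≤ 1 := by
      refine ht.le.trans ?_
      rw [div_le_one (by positivity)]
      have : (1 : ℝ) ≤ R := by exact_mod_cast hR
      linarith
    calc p' * L ^ (m + 1) = L * (p' - τ) * L ^ m + τ * L ^ (m + 1) := by ring
      _ ≤ 4 * R ^ 2 * p * L ^ m + 1 := by gcongr
      _ = 4 * R ^ 2 * (p * L ^ m) + 1 := by ring
      _ ≤ _ := by gcongr

theorem inNbr_sdiff {G F : SimpleGraph (Fin n)} (h : F ≤ G) (V : Finset (Fin n)) (v : Fin n) :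
    inNbr V (G \ F) v + inNbr V F v = inNbr V G v := by
  unfold inNbr
  rw [← Finset.card_union_of_disjoint]
  · congr 1
    ext w
    simp only [SimpleGraph.sdiff_adj, Finset.mem_union, Finset.mem_filter]
    have : F.Adj v w → G.Adj v w := fun h' => h h'
    tauto
  · rw [Finset.disjoint_left]
    intro w
    simp
    tauto

theorem inNbr_edge {V : Finset (Fin n)} {u v : Fin n} (huv : u ≠ v) (hu : u ∈ V) (hv : v ∈ V)
    (w : Fin n) : inNbr V (SimpleGraph.edge u v) w = if w = u ∨ w = v then 1 else 0 := by
  rw [← deg_edge huv, deg_eq_card, inNbr]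
  congr 1
  ext x
  simp only [Finset.mem_filter, Finset.mem_univ, true_and, SimpleGraph.edge_adj]
  constructor
  · tauto
  · rintro ⟨h, h'⟩
    refine ⟨?_, h, h'⟩
    rcases h with ⟨rfl, rfl⟩ | ⟨rfl, rfl⟩ <;> assumption

/-- Here m is the deficiency already secured and j the excess still to be paid for. If j > 0, either
some deficiency in V exceeds f, which raises m by one, or V spans an edge. Deleting that edge leaves
the sum of deficiency and internal degree unchanged at every vertex and raises m by two. At j = 0
only the bound on deficiencies remains. -/
theorem eventually_prob_dense_aux {R : ℕ} (hR : 0 < R) (t j : ℕ) : ∀ m : ℕ,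
    ∃ C : ℝ, 0 ≤ C ∧ ∀ᶠ n in atTop, ∀ (V : Finset (Fin n)) (f : Fin n → ℕ), V.card ≤ t →
      ∑ v ∈ V, f v = m →
      prob n R (fun G => (∀ v ∈ V, f v ≤ dfc R G v) ∧
        m + j ≤ ∑ v ∈ V, (dfc R G v + inNbr V G v)) * scale R n ^ (m + j) ≤ C := by
  induction j using Nat.strong_induction_on with
  | _ j ih =>
  intro m
  rcases Nat.eq_zero_or_pos j with rfl | hj
  · obtain ⟨C, hC, h⟩ := eventually_prob_ge_le hR t m
    refine ⟨C, hC, h.mono fun n h V f hV hf => le_trans ?_ (h V f hV hf)⟩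
    apply mul_le_mul_of_nonneg_right _ (pow_nonneg (scale_nonneg _ _) _)
    exact prob_mono fun G _ h => h.1
  obtain ⟨C₁, hC₁, h₁⟩ := ih (j - 1) (by omega) (m + 1)
  -- For j = 1 the subtraction truncates to 0 and the exponent (m + 2) + 0 exceeds m + j; since L ≥
  -- 1 the bound is only stronger.
  obtain ⟨C₂, hC₂, h₂⟩ := ih (j - 2) (by omega) (m + 2)
  refine ⟨t * C₁ + t * (t * C₂), by positivity, ?_⟩
  filter_upwards [h₁, h₂, (tendsto_scale hR).eventually_ge_atTop 1] with n h₁ h₂ hL V f hV hf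
  have hVt : (V.card : ℝ) ≤ t := by exact_mod_cast hV
  set L := scale R n
  set E : SimpleGraph (Fin n) → Prop := fun G => (∀ v ∈ V, f v ≤ dfc R G v) ∧
        m + j ≤ ∑ v ∈ V, (dfc R G v + inNbr V G v) with hE
  have hsplit : prob n R E ≤ ∑ u ∈ V, prob n R (fun G =>
        (∀ w ∈ V, f w + (if w = u then 1 else 0) ≤ dfc R G w) ∧
          m + 1 + (j - 1) ≤ ∑ v ∈ V, (dfc R G v + inNbr V G v)) +
      ∑ p ∈ V ×ˢ V, prob n R (fun G => G.Adj p.1 p.2 ∧ E G) := by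
    refine (prob_le_add (P₁ := fun G => ∃ u ∈ V,
        (∀ w ∈ V, f w + (if w = u then 1 else 0) ≤ dfc R G w) ∧
          m + 1 + (j - 1) ≤ ∑ v ∈ V, (dfc R G v + inNbr V G v))
      (P₂ := fun G => ∃ p ∈ V ×ˢ V, G.Adj p.1 p.2 ∧ E G) ?_).trans
      (add_le_add (prob_le_sum _ fun G _ h => h) (prob_le_sum _ fun G _ h => h))
    intro G _ hG
    by_contra hcon
    push Not at hcon
    obtain ⟨hc1, hc2⟩ := hcon
    have hd : ∀ v ∈ V, dfc R G v + inNbr V G v = f v := by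
      intro v hv
      have hin : inNbr V G v = 0 := by
        rw [inNbr, Finset.card_eq_zero, Finset.filter_eq_empty_iff]
        intro w hw ha
        exact hc2 (v, w) (Finset.mem_product.2 ⟨hv, hw⟩) ha hG
      have hle := hG.1 v hv
      by_contra hne
      have := hc1 v hv (fun w hw => by
        split_ifs with h
        · subst h
          omega
        · simpa using hG.1 w hw)
      have := hG.2
      omega
    have := hG.2
    rw [Finset.sum_congr rfl hd, hf] at this
    omega
  have hfirst : ∀ u ∈ V, prob n R (fun G =>
        (∀ w ∈ V, f w + (if w = u then 1 else 0) ≤ dfc R G w) ∧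
          m + 1 + (j - 1) ≤ ∑ v ∈ V, (dfc R G v + inNbr V G v)) * L ^ (m + j) ≤ C₁ := by
    intro u hu
    have := h₁ V (fun w => f w + if w = u then 1 else 0) hV (by
      rw [Finset.sum_add_distrib, hf, Finset.sum_ite_eq' V u, if_pos hu])
    rwa [show m + 1 + (j - 1) = m + j by omega] at this ⊢
  have hsecond : ∀ p ∈ V ×ˢ V, prob n R (fun G => G.Adj p.1 p.2 ∧ E G) * L ^ (m + j) ≤ C₂ := by
    rintro ⟨u, v⟩ huv
    obtain ⟨hu, hv⟩ := Finset.mem_product.1 huv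
    simp only at hu hv ⊢
    by_cases hne : u = v
    · subst hne
      have : prob n R (fun G => G.Adj u u ∧ E G) = 0 := by
        unfold prob
        simp [avg_const]
      rw [this, zero_mul]
      exact hC₂
    set f' : Fin n → ℕ := fun w => f w + if w = u ∨ w = v then 1 else 0 with hf'
    have hsum : ∑ w ∈ V, (if w = u ∨ w = v then 1 else 0) = 2 := by
      rw [← Finset.card_filter]
      have : V.filter (fun w => w = u ∨ w = v) = {u, v} := by
        ext w
        simp only [Finset.mem_filter, Finset.mem_insert, Finset.mem_singleton]
        constructor
        · exact fun h => h.2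
        · rintro (rfl | rfl) <;> simp [*]
      rw [this, Finset.card_pair hne]
    have hf'm : ∑ w ∈ V, f' w = m + 2 := by
      rw [Finset.sum_add_distrib, hf, hsum]
    have h5 := h₂ V f' hV hf'm
    have h6 : prob n R (fun G => G.Adj u v ∧ E G) ≤ prob n R (fun G => (∀ v ∈ V, f' v ≤ dfc R G v) ∧
        m + 2 + (j - 2) ≤ ∑ v ∈ V, (dfc R G v + inNbr V G v)) := by
      rw [prob_adj_of_switch hne E (fun G => (∀ v ∈ V, f' v ≤ dfc R G v) ∧
        m + j ≤ ∑ v ∈ V, (dfc R G v + inNbr V G v))]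
      · apply prob_mono
        intro G _ hG
        refine ⟨hG.2.2.2.1, ?_⟩
        have h7 : m + 2 ≤ ∑ v ∈ V, (dfc R G v + inNbr V G v) := by
          rw [← hf'm]
          exact Finset.sum_le_sum fun w hw => (hG.2.2.2.1 w hw).trans (Nat.le_add_right _ _)
        have := hG.2.2.2.2
        omega
      · intro G hG ha
        rw [dfc_sdiff_edge hG ha]
        simp only [hE, hf', add_le_add_iff_right]
        have hF := (edge_le_iff_adj hne).2 ha
        have : ∀ w ∈ V, dfc R G w + (if w = u ∨ w = v then 1 else 0) +
            inNbr V (G \ SimpleGraph.edge u v) w = dfc R G w + inNbr V G w := by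
          intro w _
          rw [← inNbr_sdiff hF V w, inNbr_edge hne hu hv]
          ring
        rw [Finset.sum_congr rfl this]
    refine le_trans ?_ h5
    apply mul_le_mul h6 _ (by positivity) (prob_nonneg _)
    exact pow_le_pow_right₀ hL (by omega)
  calc prob n R E * L ^ (m + j) ≤ _ := mul_le_mul_of_nonneg_right hsplit (by positivity)
    _ = _ := by rw [add_mul, Finset.sum_mul, Finset.sum_mul]
    _ ≤ ∑ u ∈ V, C₁ + ∑ p ∈ V ×ˢ V, C₂ :=
        add_le_add (Finset.sum_le_sum hfirst) (Finset.sum_le_sum hsecond)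
    _ ≤ _ := by
        rw [Finset.sum_const, Finset.sum_const, Finset.card_product, nsmul_eq_mul, nsmul_eq_mul]
        push_cast
        rw [mul_assoc (V.card : ℝ)]
        gcongr

/-- A set of vertices that sends out fewer edges than `(R - 2)` times its size. -/
def Dense (R : ℕ) (V : Finset (Fin n)) (G : SimpleGraph (Fin n)) : Prop :=
  2 * V.card < ∑ v ∈ V, (dfc R G v + inNbr V G v)

theorem eventually_prob_dense {R : ℕ} (hR : 0 < R) (t : ℕ) :
    ∃ C : ℝ, 0 ≤ C ∧ ∀ᶠ n in atTop, ∀ V : Finset (Fin n), V.card = t →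
      prob n R (Dense R V) * scale R n ^ (2 * t + 1) ≤ C := by
  obtain ⟨C, hC, h⟩ := eventually_prob_dense_aux hR t (2 * t + 1) 0
  refine ⟨C, hC, h.mono fun n h V hV => ?_⟩
  have := h V (fun _ => 0) hV.le (by simp)
  rw [zero_add] at this
  refine le_trans ?_ this
  apply mul_le_mul_of_nonneg_right _ (pow_nonneg (scale_nonneg _ _) _)
  apply prob_mono
  intro G _ hG
  unfold Dense at hG
  refine ⟨fun v _ => Nat.zero_le _, ?_⟩
  omega

/-- The number of dense sets of at most `K` vertices. -/
def numDense (R K : ℕ) (G : SimpleGraph (Fin n)) : ℝ :=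
  ∑ V with V.card ≤ K, if Dense R V G then (1 : ℝ) else 0

/-- There are at most n^t ≤ L^(2t) sets of size t, each dense with probability O(L^(-2t-1)), so each
size contributes O(1/L). -/
theorem tendsto_avg_numDense {R : ℕ} (hR : 0 < R) (K : ℕ) :
    Tendsto (fun n => avg n R (numDense R K)) atTop (𝓝 0) := by
  choose C hC h using eventually_prob_dense hR
  have hlim : Tendsto (fun n => (∑ t ∈ Finset.range (K + 1), C t) / scale R n) atTop (𝓝 0) :=
    (tendsto_scale hR).const_div_atTop _
  refine squeeze_zero' (Eventually.of_forall fun n => ?_) ?_ hlim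
  · apply avg_nonneg
    intro G _
    apply Finset.sum_nonneg
    intro V _
    split_ifs <;> norm_num
  have h' : ∀ᶠ n in atTop, ∀ t ∈ Finset.range (K + 1), ∀ V : Finset (Fin n), V.card = t →
      prob n R (Dense R V) * scale R n ^ (2 * t + 1) ≤ C t :=
    (Finset.eventually_all _).2 fun t _ => h t
  filter_upwards [h', (tendsto_scale hR).eventually_ge_atTop 1] with n hn hL
  have hn' : (n : ℝ) ≤ scale R n ^ 2 := by
    rw [scale_sq]
    have : (1 : ℝ) ≤ R := by exact_mod_cast hR
    have : (0 : ℝ) ≤ n := by positivity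
    nlinarith
  set L := scale R n
  have h1 : avg n R (numDense R K) =
      ∑ t ∈ Finset.range (K + 1), ∑ V ∈ Finset.univ.powersetCard t, prob n R (Dense R V) := by
    have : avg n R (numDense R K) =
        ∑ V : Finset (Fin n) with V.card ≤ K, prob n R (Dense R V) := by
      unfold numDense
      rw [avg_sum]
      rfl
    rw [this, ← Finset.sum_fiberwise_of_maps_to (t := Finset.range (K + 1)) (g := Finset.card)]
    · apply Finset.sum_congr rfl
      intro t ht
      apply Finset.sum_congr _ fun _ _ => rfl
      ext V
      simp only [Finset.mem_filter, Finset.mem_univ, true_and, Finset.mem_powersetCard,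
        Finset.subset_univ]
      rw [Finset.mem_range] at ht
      omega
    · intro V hV
      rw [Finset.mem_filter] at hV
      rw [Finset.mem_range]
      omega
  rw [h1, Finset.sum_div]
  apply Finset.sum_le_sum
  intro t ht
  have h2 : ∀ V ∈ (Finset.univ : Finset (Fin n)).powersetCard t,
      prob n R (Dense R V) ≤ C t / L ^ (2 * t + 1) := by
    intro V hV
    rw [le_div_iff₀ (by positivity)]
    exact hn t ht V (Finset.mem_powersetCard.1 hV).2
  refine (Finset.sum_le_card_nsmul _ _ _ h2).trans ?_
  rw [Finset.card_powersetCard, Finset.card_univ, Fintype.card_fin, nsmul_eq_mul]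
  have h3 : ((n.choose t : ℕ) : ℝ) ≤ L ^ (2 * t) := by
    calc ((n.choose t : ℕ) : ℝ) ≤ (n : ℝ) ^ t := by exact_mod_cast Nat.choose_le_pow n t
      _ ≤ (L ^ 2) ^ t := by gcongr
      _ = _ := by rw [pow_mul]
  have hCt := hC t
  calc _ ≤ L ^ (2 * t) * (C t / L ^ (2 * t + 1)) := by gcongr
    _ = _ := by
      rw [pow_succ]
      field_simp

end

/-! ### Asymptotic independence of the deficiencies of boundedly many vertices -/

section

variable {n : ℕ}

/-- The number of deficient vertices outside `V`. -/
def defOut (R : ℕ) (V : Finset (Fin n)) (G : SimpleGraph (Fin n)) : ℕ :=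
  (Vᶜ.filter (fun v => 1 ≤ dfc R G v)).card

theorem freeOut_le_defOut (R : ℕ) (V : Finset (Fin n)) (G : SimpleGraph (Fin n)) (u : Fin n) :
    freeOut R V G u ≤ defOut R V G := by
  unfold freeOut defOut
  apply Finset.card_le_card
  intro v
  simp only [Finset.mem_filter]
  tauto

theorem sum_adj_compl_le {R : ℕ} {G : SimpleGraph (Fin n)} (hG : G ∈ graphs n R)
    (V : Finset (Fin n)) :
    ∑ a ∈ Vᶜ, ∑ b ∈ Vᶜ, (if G.Adj a b then (1 : ℝ) else 0) ≤ scale R n ^ 2 := by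
  have h : ∀ a ∈ Vᶜ, ∑ b ∈ Vᶜ, (if G.Adj a b then (1 : ℝ) else 0) ≤ R := by
    intro a _
    rw [Finset.sum_boole]
    exact_mod_cast (inNbr_le_deg Vᶜ G a).trans (hG a)
  refine (Finset.sum_le_card_nsmul _ _ _ h).trans ?_
  rw [nsmul_eq_mul, scale_sq, mul_comm]
  have : (Vᶜ.card : ℝ) ≤ n := by
    have := Finset.card_le_univ Vᶜ
    rw [Fintype.card_fin] at this
    exact_mod_cast this
  gcongr

theorem le_sum_nonadj {R : ℕ} {G : SimpleGraph (Fin n)} (hG : G ∈ graphs n R)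
    (V : Finset (Fin n)) :
    (defOut R V G : ℝ) ^ 2 - (R + 1) * defOut R V G ≤
      ∑ a ∈ Vᶜ, ∑ b ∈ Vᶜ, (if a ≠ b ∧ ¬ G.Adj a b ∧ 1 ≤ dfc R G a ∧ 1 ≤ dfc R G b
        then (1 : ℝ) else 0) := by
  set A := Vᶜ.filter (fun v => 1 ≤ dfc R G v) with hA
  have h : ∀ a ∈ A, (defOut R V G : ℝ) - (R + 1) ≤
      ∑ b ∈ Vᶜ, (if a ≠ b ∧ ¬ G.Adj a b ∧ 1 ≤ dfc R G a ∧ 1 ≤ dfc R G b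
        then (1 : ℝ) else 0) := by
    intro a ha
    rw [Finset.sum_boole]
    have h1 : A ⊆ Vᶜ.filter (fun b => a ≠ b ∧ ¬ G.Adj a b ∧ 1 ≤ dfc R G a ∧ 1 ≤ dfc R G b) ∪
        Finset.univ.filter (fun w => G.Adj a w) ∪ {a} := by
      intro b hb
      have h1 := (Finset.mem_filter.1 ha).2
      have h2 := Finset.mem_filter.1 hb
      simp only [Finset.mem_union, Finset.mem_filter, Finset.mem_univ, Finset.mem_singleton,
        h1, h2.1, h2.2, true_and, and_true]
      tauto
    have h2 := hG a
    rw [deg_eq_card] at h2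
    have h3 := (Finset.card_le_card h1).trans (Finset.card_union_le _ _)
    have h4 := Finset.card_union_le
      (Vᶜ.filter (fun b => a ≠ b ∧ ¬ G.Adj a b ∧ 1 ≤ dfc R G a ∧ 1 ≤ dfc R G b))
      (Finset.univ.filter (fun w => G.Adj a w))
    rw [Finset.card_singleton] at h3
    have h5 : A.card ≤
        (Vᶜ.filter (fun b => a ≠ b ∧ ¬ G.Adj a b ∧ 1 ≤ dfc R G a ∧ 1 ≤ dfc R G b)).card +
          (R + 1) := by omega
    have h6 : (A.card : ℝ) ≤
        (Vᶜ.filter (fun b => a ≠ b ∧ ¬ G.Adj a b ∧ 1 ≤ dfc R G a ∧ 1 ≤ dfc R G b)).card +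
          (R + 1) := by exact_mod_cast h5
    unfold defOut
    linarith
  calc (defOut R V G : ℝ) ^ 2 - (R + 1) * defOut R V G
      = A.card • ((defOut R V G : ℝ) - (R + 1)) := by
        rw [nsmul_eq_mul, defOut]
        ring
    _ ≤ _ := Finset.card_nsmul_le_sum _ _ _ h
    _ ≤ _ := by
        apply Finset.sum_le_sum_of_subset_of_nonneg (Finset.filter_subset _ _)
        intro a _ _
        exact Finset.sum_nonneg fun b _ => by split_ifs <;> norm_num

/-- The conditional mean of the number D of deficient vertices outside V is at most (1 + o(1))L.
Switching edges disjoint from V does not affect the event; it compares at most Rn = L² adjacent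
pairs with at least D² - (R + 1)D non-adjacent deficient pairs. The inequality D² ≥ 2LD - L² makes
this linear in D, so no control of the upper tail of D is needed. -/
theorem avg_defOut_le {R : ℕ} {V : Finset (Fin n)} (Q : (Fin n → ℕ) → Prop)
    (hQ : ∀ d d', (∀ w ∈ V, d w = d' w) → (Q d ↔ Q d')) :
    (2 * scale R n - (R + 1)) * avg n R (fun G => if Q (dfc R G) then (defOut R V G : ℝ) else 0) ≤
      2 * scale R n ^ 2 * prob n R (fun G => Q (dfc R G)) := by
  set L := scale R n with hL
  have h : ∑ a ∈ Vᶜ, ∑ b ∈ Vᶜ, prob n R (fun G => G.Adj a b ∧ Q (dfc R G)) =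
      ∑ a ∈ Vᶜ, ∑ b ∈ Vᶜ, prob n R (fun G => (a ≠ b ∧ ¬ G.Adj a b ∧ 1 ≤ dfc R G a ∧
        1 ≤ dfc R G b) ∧ Q (dfc R G)) := by
    refine Finset.sum_congr rfl fun a ha => Finset.sum_congr rfl fun b hb => ?_
    rw [Finset.mem_compl] at ha hb
    by_cases hab : a = b
    · subst hab
      simp
    · rw [prob_adj hab Q Q]
      · apply prob_congr
        intro G _
        tauto
      · intro G _ _
        apply hQ
        intro w hw
        have h1 : w ≠ a := fun h => ha (h ▸ hw)
        have h2 : w ≠ b := fun h => hb (h ▸ hw)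
        simp [h1, h2]
  unfold prob at h
  simp_rw [← avg_sum] at h
  have h1 : avg n R (fun G => ∑ a ∈ Vᶜ, ∑ b ∈ Vᶜ,
      if G.Adj a b ∧ Q (dfc R G) then (1 : ℝ) else 0) ≤
      L ^ 2 * prob n R (fun G => Q (dfc R G)) := by
    unfold prob
    rw [← avg_mul_left]
    apply avg_mono
    intro G hG
    by_cases hq : Q (dfc R G)
    · simp only [hq, and_true, if_true, mul_one]
      exact sum_adj_compl_le hG V
    · simp [hq]
  have h2 : avg n R (fun G => if Q (dfc R G) then
        (2 * L - (R + 1)) * (defOut R V G : ℝ) - L ^ 2 else 0) ≤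
      avg n R (fun G => ∑ a ∈ Vᶜ, ∑ b ∈ Vᶜ, if (a ≠ b ∧ ¬ G.Adj a b ∧ 1 ≤ dfc R G a ∧
        1 ≤ dfc R G b) ∧ Q (dfc R G) then (1 : ℝ) else 0) := by
    apply avg_mono
    intro G hG
    by_cases hq : Q (dfc R G)
    · simp only [hq, and_true, if_true]
      refine le_trans ?_ (le_sum_nonadj hG V)
      nlinarith [sq_nonneg ((defOut R V G : ℝ) - L)]
    · simp [hq]
  have h3 : avg n R (fun G => if Q (dfc R G) then
        (2 * L - (R + 1)) * (defOut R V G : ℝ) - L ^ 2 else 0) =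
      (2 * L - (R + 1)) * avg n R (fun G => if Q (dfc R G) then (defOut R V G : ℝ) else 0) -
        L ^ 2 * prob n R (fun G => Q (dfc R G)) := by
    unfold prob
    rw [← avg_mul_left, ← avg_mul_left, ← avg_sub]
    apply avg_congr
    intro G _
    split_ifs <;> ring
  have h4 : avg n R (fun G => ∑ a ∈ Vᶜ, ∑ b ∈ Vᶜ, if (a ≠ b ∧ ¬ G.Adj a b ∧ 1 ≤ dfc R G a ∧
        1 ≤ dfc R G b) ∧ Q (dfc R G) then (1 : ℝ) else 0) =
      avg n R (fun G => ∑ a ∈ Vᶜ, ∑ b ∈ Vᶜ,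
        if G.Adj a b ∧ Q (dfc R G) then (1 : ℝ) else 0) := by
    convert h.symm
  rw [h3, h4] at h2
  linarith

theorem sumD_le_freeOut {R : ℕ} {G : SimpleGraph (Fin n)} (hG : G ∈ graphs n R)
    (V : Finset (Fin n)) (u : Fin n) :
    sumD R G ≤ freeOut R V G u + V.card + R +
      R * (Finset.univ.filter (fun v => 2 ≤ dfc R G v)).card := by
  have h1 := card_deficient_le_freeOut hG V u
  have h2 : sumD R G ≤ (Finset.univ.filter (fun v => 1 ≤ dfc R G v)).card +
      R * (Finset.univ.filter (fun v => 2 ≤ dfc R G v)).card := by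
    unfold sumD
    rw [Finset.card_filter, Finset.card_filter, Finset.mul_sum, ← Finset.sum_add_distrib]
    apply Finset.sum_le_sum
    intro v _
    have := dfc_le R G v
    split_ifs <;> omega
  omega

theorem inNbr_add_inNbr_compl (V : Finset (Fin n)) (G : SimpleGraph (Fin n)) (u : Fin n) :
    inNbr V G u + inNbr Vᶜ G u = deg G u := by
  unfold inNbr
  rw [deg_eq_card, ← Finset.card_union_of_disjoint]
  · congr 1
    rw [← Finset.filter_union, Finset.union_compl]
  · exact Finset.disjoint_filter_filter disjoint_compl_right

theorem two_le_sum_inNbr {V : Finset (Fin n)} {G : SimpleGraph (Fin n)} {u : Fin n} (hu : u ∈ V)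
    (h : inNbr V G u ≠ 0) : 2 ≤ ∑ v ∈ V, inNbr V G v := by
  unfold inNbr at h
  obtain ⟨w, hw⟩ := Finset.card_ne_zero.1 h
  rw [Finset.mem_filter] at hw
  have h1 : 1 ≤ inNbr V G u := Nat.one_le_iff_ne_zero.2 h
  have h2 : 1 ≤ inNbr V G w :=
    Finset.card_pos.2 ⟨u, Finset.mem_filter.2 ⟨hu, hw.2.symm⟩⟩
  have hne : u ≠ w := hw.2.ne
  calc 2 ≤ inNbr V G u + inNbr V G w := by omega
    _ = ∑ v ∈ {u, w}, inNbr V G v := (Finset.sum_pair hne).symm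
    _ ≤ _ := Finset.sum_le_sum_of_subset (by
        intro x hx
        rw [Finset.mem_insert, Finset.mem_singleton] at hx
        rcases hx with rfl | rfl
        exacts [hu, hw.1])

/-- Vertices of deficiency at least 2 separate the total deficiency from the number of deficient
vertices, so their mean number must be small compared with L. Those in V number at most t; each
other one costs a further factor L^(-2), and n ≤ L² keeps the total bounded after rescaling. -/
theorem eventually_prob_two_le {R : ℕ} (hR : 0 < R) (t m : ℕ) :
    ∃ C : ℝ, 0 ≤ C ∧ ∀ᶠ n in atTop, ∀ (V : Finset (Fin n)) (f : Fin n → ℕ), V.card ≤ t →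
      ∑ v ∈ V, f v = m →
      (∑ v, prob n R (fun G => (∀ w ∈ V, dfc R G w = f w) ∧ 2 ≤ dfc R G v)) * scale R n ^ m ≤
        t * prob n R (fun G => ∀ w ∈ V, dfc R G w = f w) * scale R n ^ m + C := by
  obtain ⟨C, hC, h⟩ := eventually_prob_ge_le hR (t + 1) (m + 2)
  refine ⟨C, hC, ?_⟩
  filter_upwards [h, (tendsto_scale hR).eventually_ge_atTop 1] with n h hL V f hV hf
  have hn' : (n : ℝ) ≤ scale R n ^ 2 := by
    rw [scale_sq]
    have : (1 : ℝ) ≤ R := by exact_mod_cast hR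
    have : (0 : ℝ) ≤ n := by positivity
    nlinarith
  set L := scale R n
  set p := prob n R (fun G => ∀ w ∈ V, dfc R G w = f w)
  have hp : 0 ≤ p := prob_nonneg _
  have hsplit : ∀ v, prob n R (fun G => (∀ w ∈ V, dfc R G w = f w) ∧ 2 ≤ dfc R G v) ≤
      (if v ∈ V then p else 0) + C / L ^ (m + 2) := by
    intro v
    by_cases hv : v ∈ V
    · rw [if_pos hv]
      have : prob n R (fun G => (∀ w ∈ V, dfc R G w = f w) ∧ 2 ≤ dfc R G v) ≤ p :=
        prob_mono fun G _ hG => hG.1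
      have h2 : 0 ≤ C / L ^ (m + 2) := by positivity
      linarith
    · rw [if_neg hv, zero_add, le_div_iff₀ (by positivity)]
      have := h (insert v V) (fun w => if w = v then 2 else f w)
        ((Finset.card_insert_le _ _).trans (by omega)) (by
          rw [Finset.sum_insert hv, if_pos rfl]
          have : ∑ w ∈ V, (if w = v then 2 else f w) = ∑ w ∈ V, f w := by
            apply Finset.sum_congr rfl
            intro w hw
            rw [if_neg]
            rintro rfl
            exact hv hw
          rw [this, hf]
          ring)
      refine le_trans ?_ this
      apply mul_le_mul_of_nonneg_right _ (by positivity)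
      apply prob_mono
      rintro G _ ⟨h1, h2⟩ w hw
      split_ifs with hwv
      · subst hwv
        exact h2
      · rcases Finset.mem_insert.1 hw with h3 | h3
        · exact absurd h3 hwv
        · exact (h1 w h3).ge
  have hVt : (V.card : ℝ) ≤ t := by exact_mod_cast hV
  calc _ ≤ (∑ v, ((if v ∈ V then p else 0) + C / L ^ (m + 2))) * L ^ m := by
        gcongr with v
        exact hsplit v
    _ = (V.card * p) * L ^ m + n * C / L ^ 2 := by
        rw [Finset.sum_add_distrib, Finset.sum_const, Finset.card_univ, Fintype.card_fin,
          nsmul_eq_mul, ← Finset.sum_filter, Finset.sum_const, nsmul_eq_mul, pow_add]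
        have : (Finset.univ.filter (fun v => v ∈ V)) = V := by
          ext
          simp
        rw [this]
        field_simp
    _ ≤ _ := by
        gcongr
        rw [div_le_iff₀ (by positivity), mul_comm C]
        gcongr

theorem sum_prob_two_le (R : ℕ) (E : SimpleGraph (Fin n) → Prop) :
    ∑ v, prob n R (fun G => E G ∧ 2 ≤ dfc R G v) = avg n R (fun G => if E G then
      ((Finset.univ.filter (fun v => 2 ≤ dfc R G v)).card : ℝ) else 0) := by
  unfold prob
  rw [← avg_sum]
  apply avg_congr
  intro G _
  by_cases hE : E G
  · simp only [hE, true_and, if_true]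
    rw [Finset.sum_boole]
  · simp [hE]

theorem step_lower_bound {r y x' L c d : ℝ} (hr : 0 ≤ r) (hc : 0 ≤ c) (hL : 0 < L)
    (hd : 0 ≤ d) (hy : y ≤ d) (h : (y * L - r * c) * (2 * L - (r + 1)) ≤ 2 * L ^ 2 * x') :
    (y - x') * L ≤ r * c + (r + 1) * d := by
  have h1 : y * (r + 1) ≤ (r + 1) * d := by nlinarith
  have h2 : 0 ≤ r * c * (r + 1) := by positivity
  have h3 : 2 * L * ((y - x') * L) ≤ 2 * L * (r * c) + y * (r + 1) * L := by nlinarith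
  have h4 : y * (r + 1) * L ≤ (r + 1) * d * L := mul_le_mul_of_nonneg_right h1 hL.le
  have h5 : 0 ≤ ((r + 1) * d - y * (r + 1)) * L := by nlinarith
  have h6 : 0 ≤ (r + 1) * d * L := by positivity
  refine le_of_mul_le_mul_left ?_ (show 0 < 2 * L by positivity)
  nlinarith

theorem step_upper_bound {y x' L T ε t r c η : ℝ} (hL : 0 < L)
    (h : (1 - ε) * L * (x' - T) - (t + r) * x' - r * (t * x' + c) ≤ y * L)
    (h₁ : ε * x' ≤ η / 4) (h₂ : (1 - ε) * T ≤ η / 4)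
    (h₃ : (t + r + r * t) * x' + r * c ≤ η / 2 * L) : x' - y ≤ η := by
  refine le_of_mul_le_mul_right ?_ hL
  have e1 : ε * x' * L ≤ η / 4 * L := mul_le_mul_of_nonneg_right h₁ hL.le
  have e2 : (1 - ε) * T * L ≤ η / 4 * L := mul_le_mul_of_nonneg_right h₂ hL.le
  linarith

/-- The number `lam` is the common value of the two sides of `avg_star`. Read as a count of
neighbours of u outside V it is (R - f u) times the first probability, up to graphs where u has a
neighbour in V, which have excess deficiency and internal degree. Read as a count of deficient
vertices it is about L times the second probability: from above by `avg_defOut_le`, from below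
because the total deficiency is rarely below (1 - ε)L and is mostly made of deficiencies equal to 1.
-/
theorem exists_star_bounds {R m : ℕ} {V : Finset (Fin n)} {u : Fin n} (hu : u ∈ V)
    (f : Fin n → ℕ) (hf : ∑ v ∈ V, f v = m) (hL : (R : ℝ) + 1 ≤ scale R n) {ε : ℝ}
    (hε : ε < 1) :
    ∃ lam : ℝ,
      lam ≤ ((R - f u : ℕ) : ℝ) * prob n R (fun G => ∀ v ∈ V, dfc R G v = f v) ∧
      ((R - f u : ℕ) : ℝ) * prob n R (fun G => ∀ v ∈ V, dfc R G v = f v) -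
        R * prob n R (fun G => (∀ v ∈ V, f v ≤ dfc R G v) ∧
          m + 1 ≤ ∑ v ∈ V, (dfc R G v + inNbr V G v)) ≤ lam ∧
      lam * (2 * scale R n - (R + 1)) ≤ 2 * scale R n ^ 2 *
        prob n R (fun G => ∀ v ∈ V, dfc R G v = f v + if v = u then 1 else 0) ∧
      (1 - ε) * scale R n * (prob n R (fun G => ∀ v ∈ V, dfc R G v = f v + if v = u then 1 else 0) -
          prob n R (fun G => (sumD R G : ℝ) < (1 - ε) * scale R n)) -
        (V.card + R) * prob n R (fun G => ∀ v ∈ V, dfc R G v = f v + if v = u then 1 else 0) -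
        R * ∑ v, prob n R (fun G => (∀ w ∈ V, dfc R G w = f w + if w = u then 1 else 0) ∧
          2 ≤ dfc R G v) ≤ lam := by
  set L := scale R n
  have hL0 : 0 < L := by
    have : (0 : ℝ) ≤ R := by positivity
    linarith
  set p := prob n R (fun G => ∀ v ∈ V, dfc R G v = f v) with hp
  set f' : Fin n → ℕ := fun v => f v + if v = u then 1 else 0 with hf'
  set p' := prob n R (fun G => ∀ v ∈ V, dfc R G v = f' v) with hp'
  set a : ℝ := ((R - f u : ℕ) : ℝ) with ha
  have hQ : ∀ d d' : Fin n → ℕ, (∀ w ∈ V, d w = d' w) →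
      ((∀ w ∈ V, d w = f' w) ↔ ∀ w ∈ V, d' w = f' w) := by
    intro d d' h
    exact forall₂_congr fun w hw => by rw [h w hw]
  have hstar := avg_star (R := R) hu (fun d => ∀ w ∈ V, d w = f' w) hQ
  set lam := avg n R (fun G => if ∀ w ∈ V, (fun w => dfc R G w + if w = u then 1 else 0) w = f' w
        then (inNbr Vᶜ G u : ℝ) else 0) with hlam
  have hlam' : lam = avg n R (fun G => if 1 ≤ dfc R G u ∧ ∀ w ∈ V, dfc R G w = f' w
        then (freeOut R V G u : ℝ) else 0) := by
    rw [hlam]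
    convert hstar
  have hiff : ∀ G : SimpleGraph (Fin n),
      (∀ w ∈ V, (fun w => dfc R G w + if w = u then 1 else 0) w = f' w) ↔
        ∀ w ∈ V, dfc R G w = f w := by
    intro G
    simp only [hf', add_left_inj]
  have hlam_le : lam ≤ a * p := by
    rw [hlam, hp, prob, ← avg_mul_left]
    apply avg_mono
    intro G hG
    by_cases hE : ∀ w ∈ V, dfc R G w = f w
    · rw [if_pos ((hiff G).2 hE), if_pos hE, mul_one, ha]
      have h1 := inNbr_le_deg Vᶜ G u
      have h2 := deg_add_dfc hG u
      rw [hE u hu] at h2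
      have : inNbr Vᶜ G u ≤ R - f u := by omega
      exact_mod_cast this
    · rw [if_neg (fun h => hE ((hiff G).1 h)), if_neg hE, mul_zero]
  have hlam_ge : a * p - R * prob n R (fun G => (∀ v ∈ V, f v ≤ dfc R G v) ∧
        m + 1 ≤ ∑ v ∈ V, (dfc R G v + inNbr V G v)) ≤ lam := by
    rw [hlam, hp, prob, prob, ← avg_mul_left, ← avg_mul_left, ← avg_sub]
    apply avg_mono
    intro G hG
    by_cases hE : ∀ w ∈ V, dfc R G w = f w
    · rw [if_pos ((hiff G).2 hE), if_pos hE, mul_one, ha]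
      have h2 := deg_add_dfc hG u
      rw [hE u hu] at h2
      have h3 := inNbr_add_inNbr_compl V G u
      have h4 : R - f u = inNbr V G u + inNbr Vᶜ G u := by omega
      rw [h4]
      push_cast
      by_cases hin : inNbr V G u = 0
      · rw [hin, Nat.cast_zero, zero_add]
        apply sub_le_self
        apply mul_nonneg (by positivity)
        split_ifs <;> norm_num
      · rw [if_pos]
        · have : (inNbr V G u : ℝ) ≤ R := by exact_mod_cast (inNbr_le_deg V G u).trans (hG u)
          linarith
        · refine ⟨fun v hv => (hE v hv).ge, ?_⟩
          have h5 := two_le_sum_inNbr hu hin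
          rw [Finset.sum_add_distrib, Finset.sum_congr rfl hE, hf]
          omega
    · rw [if_neg (fun h => hE ((hiff G).1 h)), if_neg hE, mul_zero, zero_sub,
        Left.neg_nonpos_iff]
      apply mul_nonneg (by positivity)
      split_ifs <;> norm_num
  have hlow : lam * (2 * L - (R + 1)) ≤ 2 * L ^ 2 * p' := by
    refine le_trans ?_ (avg_defOut_le (R := R) (V := V) (fun d => ∀ w ∈ V, d w = f' w) hQ)
    rw [mul_comm]
    apply mul_le_mul_of_nonneg_left _ (by linarith)
    rw [hlam']
    apply avg_mono
    intro G hG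
    have h1 : (freeOut R V G u : ℝ) ≤ defOut R V G := by exact_mod_cast freeOut_le_defOut R V G u
    by_cases hE : ∀ w ∈ V, dfc R G w = f' w
    · simp only [if_pos hE]
      split_ifs
      · exact h1
      · positivity
    · rw [if_neg (fun h : 1 ≤ dfc R G u ∧ ∀ w ∈ V, dfc R G w = f' w => hE h.2), if_neg hE]
  have hupp : (1 - ε) * L * (p' - prob n R (fun G => (sumD R G : ℝ) < (1 - ε) * L)) -
      (V.card + R) * p' - R * ∑ v, prob n R (fun G => (∀ w ∈ V, dfc R G w = f' w) ∧ 2 ≤ dfc R G v) ≤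
      lam := by
    rw [hlam', hp', sum_prob_two_le]
    unfold prob
    rw [← avg_sub, ← avg_mul_left, ← avg_mul_left, ← avg_sub, ← avg_mul_left, ← avg_sub]
    apply avg_mono
    intro G hG
    have hc : 0 ≤ (1 - ε) * L := mul_nonneg (by linarith) hL0.le
    by_cases hE : ∀ w ∈ V, dfc R G w = f' w
    · have hu1 : 1 ≤ dfc R G u := by
        rw [hE u hu]
        simp [hf']
      rw [if_pos hE, if_pos hE,
        if_pos (⟨hu1, hE⟩ : 1 ≤ dfc R G u ∧ ∀ w ∈ V, dfc R G w = f' w)]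
      have h6 := sumD_le_freeOut hG V u
      have h7 : (sumD R G : ℝ) ≤ freeOut R V G u + V.card + R +
          R * ((Finset.univ.filter (fun v => 2 ≤ dfc R G v)).card : ℝ) := by
        exact_mod_cast h6
      have h8 : (0 : ℝ) ≤ freeOut R V G u := by positivity
      have h9 : (0 : ℝ) ≤ R * ((Finset.univ.filter (fun v => 2 ≤ dfc R G v)).card : ℝ) := by
        positivity
      by_cases hS : (sumD R G : ℝ) < (1 - ε) * L
      · rw [if_pos hS]
        linarith
      · rw [if_neg hS]
        push Not at hS
        linarith
    · rw [if_neg hE, if_neg hE,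
        if_neg (fun h : 1 ≤ dfc R G u ∧ ∀ w ∈ V, dfc R G w = f' w => hE h.2)]
      split_ifs
      · linarith
      · linarith
  exact ⟨lam, hlam_le, hlam_ge, hlow, hupp⟩

-- Raising the deficiency of u from j to j + 1 multiplies probabilities by (R - j)/L: both readings
-- of `lam` are compared after multiplication by a power of L.
set_option maxHeartbeats 600000 in
theorem eventually_prob_eq_step {R : ℕ} (hR : 0 < R) (t m : ℕ) {η : ℝ} (hη : 0 < η) :
    ∀ᶠ n in atTop, ∀ (V : Finset (Fin n)) (f : Fin n → ℕ) (u : Fin n), V.card ≤ t →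
      ∑ v ∈ V, f v = m → u ∈ V →
      |prob n R (fun G => ∀ v ∈ V, dfc R G v = f v + if v = u then 1 else 0) * scale R n ^ (m + 1)
        - ((R - f u : ℕ) : ℝ) * (prob n R (fun G => ∀ v ∈ V, dfc R G v = f v) * scale R n ^ m)|
        ≤ η := by
  have hR' : (1 : ℝ) ≤ R := by exact_mod_cast hR
  obtain ⟨C₀, hC₀, h₀⟩ := eventually_prob_ge_le hR t m
  obtain ⟨C₁, hC₁, h₁⟩ := eventually_prob_ge_le hR t (m + 1)
  obtain ⟨C₂, hC₂, h₂⟩ := eventually_prob_dense_aux hR t 1 m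
  obtain ⟨C₃, hC₃, h₃⟩ := eventually_prob_two_le hR t (m + 1)
  -- Since the rescaled probability is at most C₁, this makes the relative loss ε cost at most η/4.
  set ε : ℝ := min (1 / 2) (η / (4 * (C₁ + 1))) with hε
  have hε0 : 0 < ε := by
    rw [hε, lt_min_iff]
    constructor
    · norm_num
    · positivity
  have hε1 : ε < 1 := (min_le_left _ _).trans_lt (by norm_num)
  have hεC : ε * C₁ ≤ η / 4 := by
    have h1 : ε ≤ η / (4 * (C₁ + 1)) := min_le_right _ _
    rw [le_div_iff₀ (by positivity)] at h1
    nlinarith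
  have hτ := (tendsto_prob_sumD_lt hR hε0 hε1 (m + 1)).eventually_lt_const
    (show (0 : ℝ) < η / 4 by positivity)
  -- All remaining errors are constants divided by L. Their constants are collected in K, and L ≥
  -- 2K/η makes the total at most η/2.
  set K : ℝ := R * C₂ + (R + 1) * (R * C₀) + (t + R + R * t) * C₁ + R * C₃ with hK
  have hK0 : 0 ≤ K := by positivity
  filter_upwards [h₀, h₁, h₂, h₃, hτ, (tendsto_scale hR).eventually_ge_atTop (2 * K / η + R + 1)]
    with n h₀ h₁ h₂ h₃ hτ hLK V f u hV hf hu
  have hVt : (V.card : ℝ) ≤ t := by exact_mod_cast hV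
  have hn' : (n : ℝ) ≤ scale R n ^ 2 := by
    rw [scale_sq]
    have : (0 : ℝ) ≤ n := by positivity
    nlinarith
  set L := scale R n
  have hL2 : (R : ℝ) + 1 ≤ L := by
    have : 0 ≤ 2 * K / η := by positivity
    linarith
  have hL1 : 1 ≤ L := by linarith
  have hL0 : 0 < L := by linarith
  have hKL : K ≤ η / 2 * L := by
    have : 2 * K / η ≤ L := by linarith
    rw [div_le_iff₀ hη] at this
    linarith
  set p := prob n R (fun G => ∀ v ∈ V, dfc R G v = f v) with hp
  set f' : Fin n → ℕ := fun v => f v + if v = u then 1 else 0 with hf'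
  set p' := prob n R (fun G => ∀ v ∈ V, dfc R G v = f' v) with hp'
  have hf'm : ∑ v ∈ V, f' v = m + 1 := by
    rw [Finset.sum_add_distrib, hf, Finset.sum_ite_eq' V u, if_pos hu]
  have hp0 : 0 ≤ p := prob_nonneg _
  have hp'0 : 0 ≤ p' := prob_nonneg _
  have hpC : p * L ^ m ≤ C₀ := by
    refine le_trans ?_ (h₀ V f hV hf)
    apply mul_le_mul_of_nonneg_right _ (by positivity)
    exact prob_mono fun G _ h v hv => (h v hv).ge
  have hp'C : p' * L ^ (m + 1) ≤ C₁ := by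
    refine le_trans ?_ (h₁ V f' hV hf'm)
    apply mul_le_mul_of_nonneg_right _ (by positivity)
    exact prob_mono fun G _ h v hv => (h v hv).ge
  set a : ℝ := ((R - f u : ℕ) : ℝ) with ha
  have ha0 : 0 ≤ a := by positivity
  have haR : a ≤ R := by
    rw [ha]
    exact_mod_cast Nat.sub_le _ _
  obtain ⟨lam, hlam_le, hlam_ge', hlow, hupp'⟩ := exists_star_bounds (R := R) hu f hf hL2 hε1
  have hlam_ge : a * p - R * (C₂ / L ^ (m + 1)) ≤ lam := by
    refine le_trans (sub_le_sub_left (mul_le_mul_of_nonneg_left ?_ (by positivity)) _) hlam_ge'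
    rw [le_div_iff₀ (by positivity)]
    exact h₂ V f hV hf
  have hupp : (1 - ε) * L * (p' - prob n R (fun G => (sumD R G : ℝ) < (1 - ε) * L)) -
      (t + R) * p' - R * ∑ v, prob n R (fun G => (∀ w ∈ V, dfc R G w = f' w) ∧ 2 ≤ dfc R G v) ≤
      lam := by
    refine le_trans ?_ hupp'
    gcongr
  have h₃' := h₃ V f' hV hf'm
  set τ := prob n R (fun G => (sumD R G : ℝ) < (1 - ε) * L)
  set B := ∑ v, prob n R (fun G => (∀ w ∈ V, dfc R G w = f' w) ∧ 2 ≤ dfc R G v)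
  set x := p * L ^ m with hx
  set x' := p' * L ^ (m + 1) with hx'
  have hx0 : 0 ≤ x := by positivity
  have hx'0 : 0 ≤ x' := by positivity
  have hLm : 0 < L ^ m := by positivity
  have hτ0 : 0 ≤ τ := prob_nonneg _
  rw [abs_le]
  constructor
  -- Lower half: the count of neighbours bounds `lam` from below and the count of deficient vertices
  -- bounds it from above.
  · have h1 : (a * x * L - R * C₂) * (2 * L - (R + 1)) ≤ 2 * L ^ 2 * x' := by
      have h2 := (mul_le_mul_of_nonneg_right hlam_ge
        (show (0 : ℝ) ≤ 2 * L - (R + 1) by linarith)).trans hlow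
      have h3 := mul_le_mul_of_nonneg_right h2 (show 0 ≤ L ^ (m + 1) by positivity)
      calc _ = (a * p - R * (C₂ / L ^ (m + 1))) * (2 * L - (R + 1)) * L ^ (m + 1) := by
            rw [hx, pow_succ]
            field_simp
        _ ≤ _ := h3
        _ = _ := by rw [hx']; ring
    have h2 : a * x ≤ R * C₀ := mul_le_mul haR hpC hx0 (by positivity)
    have h4 := step_lower_bound (by positivity) hC₂ hL0 (by positivity) h2 h1
    have h5 : R * C₂ + (R + 1) * (R * C₀) ≤ K := by
      have : 0 ≤ (t + R + R * t) * C₁ + R * C₃ := by positivity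
      rw [hK]
      linarith
    have h6 : a * x - x' ≤ η / 2 := by
      refine le_of_mul_le_mul_right ?_ hL0
      linarith
    linarith
  -- Upper half: the two counts exchange roles.
  · have h1 := mul_le_mul_of_nonneg_right (hupp.trans hlam_le) (show 0 ≤ L ^ (m + 1) by positivity)
    have h2 : (1 - ε) * L * (x' - τ * L ^ (m + 1)) - (t + R) * x' - R * (t * x' + C₃) ≤
        a * x * L := by
      have h3 : B * L ^ (m + 1) ≤ t * x' + C₃ := by
        rw [hx', ← mul_assoc]
        exact h₃'
      have h4 : R * (B * L ^ (m + 1)) ≤ R * (t * x' + C₃) :=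
        mul_le_mul_of_nonneg_left h3 (by positivity)
      have h5 : ((1 - ε) * L * (p' - τ) - (t + R) * p' - R * B) * L ^ (m + 1) =
          (1 - ε) * L * (x' - τ * L ^ (m + 1)) - (t + R) * x' - R * (B * L ^ (m + 1)) := by
        rw [hx']
        ring
      have h6 : a * p * L ^ (m + 1) = a * x * L := by
        rw [hx]
        ring
      rw [h5, h6] at h1
      linarith
    have h3 : (t + R + R * t) * x' ≤ (t + R + R * t) * C₁ :=
      mul_le_mul_of_nonneg_left hp'C (by positivity)
    have h4 : ε * x' ≤ η / 4 := (mul_le_mul_of_nonneg_left hp'C hε0.le).trans hεC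
    have h5 : (1 - ε) * (τ * L ^ (m + 1)) ≤ η / 4 := by
      have h6 : 0 ≤ τ * L ^ (m + 1) := mul_nonneg hτ0 (by positivity)
      nlinarith
    have h6 : (t + R + R * t) * C₁ + R * C₃ ≤ K := by
      have : 0 ≤ R * C₂ + (R + 1) * (R * C₀) := by positivity
      rw [hK]
      linarith
    refine step_upper_bound hL0 h2 h4 h5 ?_
    linarith

/-- Asymptotically, the deficiencies of a bounded number of vertices are independent, and
the deficiency `k` has probability `R.descFactorial k / scale R n ^ k`. -/
theorem eventually_prob_eq {R : ℕ} (hR : 0 < R) (t m : ℕ) : ∀ {η : ℝ}, 0 < η →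
    ∀ᶠ n in atTop, ∀ (V : Finset (Fin n)) (f : Fin n → ℕ), V.card ≤ t →
      ∑ v ∈ V, f v = m →
      |prob n R (fun G => ∀ v ∈ V, dfc R G v = f v) * scale R n ^ m
        - ∏ v ∈ V, (R.descFactorial (f v) : ℝ)| ≤ η := by
  induction m with
  | zero =>
    intro η hη
    obtain ⟨C, hC, h⟩ := eventually_prob_ge_le hR 1 1
    filter_upwards [h, (tendsto_scale hR).eventually_ge_atTop (t * C / η + 1)] with n h hL V f hV hf
    have hVt : (V.card : ℝ) ≤ t := by exact_mod_cast hV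
    set L := scale R n
    have h0 : 0 ≤ t * C / η := by positivity
    have hL0 : 0 < L := by linarith
    have hf0 : ∀ v ∈ V, f v = 0 := by simpa using hf
    have h1 : ∏ v ∈ V, (R.descFactorial (f v) : ℝ) = 1 :=
      Finset.prod_eq_one fun v hv => by rw [hf0 v hv]; simp
    rw [h1, pow_zero, mul_one, abs_sub_comm, abs_of_nonneg (sub_nonneg.2 (prob_le_one _)),
      ← prob_not]
    calc _ ≤ ∑ v ∈ V, prob n R (fun G => ∀ w ∈ ({v} : Finset (Fin n)), 1 ≤ dfc R G w) := by
          apply prob_le_sum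
          intro G _ hG
          push Not at hG
          obtain ⟨v, hv, h⟩ := hG
          refine ⟨v, hv, ?_⟩
          intro w hw
          rw [Finset.mem_singleton] at hw
          subst hw
          rw [hf0 w hv] at h
          omega
      _ ≤ ∑ v ∈ V, C / L := by
          apply Finset.sum_le_sum
          intro v _
          rw [le_div_iff₀ hL0]
          simpa using h {v} (fun _ => 1) (by simp) (by simp)
      _ = V.card * C / L := by
          rw [Finset.sum_const, nsmul_eq_mul]
          ring
      _ ≤ t * C / L := by gcongr
      _ ≤ η := by
          rw [div_le_iff₀ hL0]
          have : t * C / η ≤ L := by linarith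
          rw [div_le_iff₀ hη] at this
          linarith
  | succ m ih =>
    intro η hη
    have hR' : (0 : ℝ) < R := by exact_mod_cast hR
    filter_upwards [eventually_prob_eq_step hR t m (half_pos hη),
      ih (show 0 < η / (2 * R) by positivity)] with n hs ih V f hV hf
    have hf0 : ∃ u ∈ V, f u ≠ 0 := by
      by_contra h
      push Not at h
      rw [Finset.sum_eq_zero h] at hf
      omega
    obtain ⟨u, hu, hfu⟩ := hf0
    set g : Fin n → ℕ := fun w => f w - if w = u then 1 else 0 with hg
    have hfg : ∀ v, f v = g v + if v = u then 1 else 0 := by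
      intro v
      simp only [hg]
      split_ifs with h
      · subst h
        omega
      · omega
    have hgm : ∑ v ∈ V, g v = m := by
      rw [Finset.sum_congr rfl (fun v _ => hfg v), Finset.sum_add_distrib,
        Finset.sum_ite_eq' V u, if_pos hu] at hf
      omega
    have h1 := hs V g u hV hgm hu
    have h2 := ih V g hV hgm
    simp only [← hfg] at h1
    -- The step factor R - j is the factor by which the falling factorial of R grows from length j
    -- to j + 1.
    have h3 : ∏ v ∈ V, (R.descFactorial (f v) : ℝ) =
        ((R - g u : ℕ) : ℝ) * ∏ v ∈ V, (R.descFactorial (g v) : ℝ) := by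
      rw [← Finset.mul_prod_erase V _ hu, ← Finset.mul_prod_erase V (fun v =>
        (R.descFactorial (g v) : ℝ)) hu, ← mul_assoc]
      congr 1
      · rw [hfg u, if_pos rfl, Nat.descFactorial_succ]
        push_cast
        ring
      · apply Finset.prod_congr rfl
        intro v hv
        rw [hfg v, if_neg (Finset.ne_of_mem_erase hv), add_zero]
    rw [h3]
    set a : ℝ := ((R - g u : ℕ) : ℝ) with ha
    have ha0 : 0 ≤ a := by positivity
    have haR : a ≤ R := by
      rw [ha]
      exact_mod_cast Nat.sub_le _ _
    set x := prob n R (fun G => ∀ v ∈ V, dfc R G v = g v) * scale R n ^ m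
    set P := ∏ v ∈ V, (R.descFactorial (g v) : ℝ)
    have h4 : |a * x - a * P| ≤ η / 2 := by
      rw [← mul_sub, abs_mul, abs_of_nonneg ha0]
      calc a * |x - P| ≤ R * (η / (2 * R)) := by gcongr
        _ = η / 2 := by field_simp
    calc _ ≤ _ := abs_sub_le _ (a * x) _
      _ ≤ η := by linarith

end

/-! ### Occurrences of a pattern and their expected number -/

section

variable {n : ℕ}

theorem deg_eq_zero_of_forall {G : SimpleGraph (Fin n)} {v : Fin n} (h : ∀ w, ¬ G.Adj v w) :
    deg G v = 0 := by
  rw [deg_eq_card, Finset.card_eq_zero, Finset.filter_eq_empty_iff]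
  exact fun w _ => h w

theorem deg_map_of_notMem {T : Type*} (H : SimpleGraph T) (φ : T ↪ Fin n) {v : Fin n}
    (hv : ∀ x, φ x ≠ v) : deg (H.map φ) v = 0 := by
  refine deg_eq_zero_of_forall fun w h => ?_
  obtain ⟨a, b, -, ha, -⟩ := (SimpleGraph.map_adj ..).1 h
  exact hv a ha

theorem map_le_iff_adj {T : Type*} {H : SimpleGraph T} {φ : T ↪ Fin n}
    {G : SimpleGraph (Fin n)} : H.map φ ≤ G ↔ ∀ x y, H.Adj x y → G.Adj (φ x) (φ y) := by
  rw [SimpleGraph.map_le_iff_le_comap]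
  rfl

theorem Dense.of_two_le {R : ℕ} {V : Finset (Fin n)} {G : SimpleGraph (Fin n)}
    (h : ∀ v ∈ V, 2 ≤ dfc R G v + inNbr V G v) {u : Fin n} (hu : u ∈ V)
    (hu' : 2 < dfc R G u + inNbr V G u) : Dense R V G := by
  unfold Dense
  rw [mul_comm, ← smul_eq_mul, ← Finset.sum_const]
  exact Finset.sum_lt_sum h ⟨u, hu, hu'⟩

section Pattern

variable {T : Type*} [Fintype T]

/-- The degree of a vertex of a finite graph. -/
def pdeg (H : SimpleGraph T) (x : T) : ℕ :=
  (Finset.univ.filter (fun y => H.Adj x y)).card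

/-- The image of `H` under `φ` lies in `G`, and each vertex of `H` whose degree `d` is less
than `2` is mapped to a vertex of deficiency `2 - d`. -/
def Present (R : ℕ) (H : SimpleGraph T) (φ : T ↪ Fin n) (G : SimpleGraph (Fin n)) : Prop :=
  (∀ x y, H.Adj x y → G.Adj (φ x) (φ y)) ∧ ∀ x, pdeg H x < 2 → dfc R G (φ x) = 2 - pdeg H x

theorem deg_map (H : SimpleGraph T) (φ : T ↪ Fin n) (x : T) :
    deg (H.map φ) (φ x) = pdeg H x := by
  rw [deg_eq_card, pdeg, ← Finset.card_map φ]
  congr 1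
  ext v
  simp only [Finset.mem_filter, Finset.mem_univ, true_and, Finset.mem_map, SimpleGraph.map_adj]
  constructor
  · rintro ⟨a, b, hab, ha, rfl⟩
    rw [φ.injective ha] at hab
    exact ⟨b, hab, rfl⟩
  · rintro ⟨b, hb, rfl⟩
    exact ⟨x, b, hb, rfl, rfl⟩

/-- Deleting the copy of H leaves deficiency exactly 2 at vertices of pattern degree below 2 and at
least 2 at the others. The two events can differ only if some deficiency exceeds 2, or if all equal
2 and an edge of the copy is already occupied. In both cases the image is dense. -/
theorem abs_prob_present_sub_le {R : ℕ} {H : SimpleGraph T} (hH : ∀ x, pdeg H x ≤ 2)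
    (φ : T ↪ Fin n) :
    |prob n R (Present R H φ) - prob n R (fun G => ∀ v ∈ Finset.univ.map φ, dfc R G v = 2)| ≤
      prob n R (Dense R (Finset.univ.map φ)) := by
  have key : prob n R (Present R H φ) = prob n R (fun G => Disjoint G (H.map φ) ∧
      (∀ v, deg (H.map φ) v ≤ dfc R G v) ∧ ∀ x, pdeg H x < 2 → dfc R G (φ x) = 2) := by
    rw [← prob_switch (H.map φ) (Q := fun G => ∀ x, pdeg H x < 2 → dfc R G (φ x) = 2 - pdeg H x)]
    · apply prob_congr
      intro G _
      rw [map_le_iff_adj]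
      rfl
    · intro G hG hF
      apply forall_congr'
      intro x
      rw [dfc_sdiff hG hF, deg_map]
      omega
  rw [key, abs_le]
  constructor
  · rw [neg_le_sub_iff_le_add]
    apply prob_le_add
    intro G _ h
    by_cases hd : Dense R (Finset.univ.map φ) G
    · exact Or.inr hd
    left
    have h2 : ∀ x, dfc R G (φ x) = 2 := fun x => h _ (Finset.mem_map_of_mem _ (Finset.mem_univ x))
    refine ⟨?_, ?_, fun x _ => h2 x⟩
    · rw [disjoint_iff_not_adj]
      intro u v huv ha
      rw [SimpleGraph.map_adj] at huv
      obtain ⟨x, y, hxy, rfl, rfl⟩ := huv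
      apply hd
      refine Dense.of_two_le (u := φ x) (fun v hv => ?_)
        (Finset.mem_map_of_mem _ (Finset.mem_univ x)) ?_
      · rw [h v hv]
        omega
      · rw [h2 x]
        have : 0 < inNbr (Finset.univ.map φ) G (φ x) :=
          Finset.card_pos.2 ⟨φ y, Finset.mem_filter.2
            ⟨Finset.mem_map_of_mem _ (Finset.mem_univ y), ha⟩⟩
        omega
    · intro v
      by_cases hv : ∃ x, φ x = v
      · obtain ⟨x, rfl⟩ := hv
        rw [deg_map, h2]
        exact hH x
      · push Not at hv
        rw [deg_map_of_notMem H φ hv]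
        exact Nat.zero_le _
  · rw [sub_le_iff_le_add, add_comm]
    apply prob_le_add
    rintro G _ ⟨_, h1, h2⟩
    have h3 : ∀ x, 2 ≤ dfc R G (φ x) := by
      intro x
      by_cases hx : pdeg H x < 2
      · exact (h2 x hx).ge
      · have := h1 (φ x)
        rw [deg_map] at this
        omega
    by_contra hcon
    push Not at hcon
    obtain ⟨⟨v, hv, hne⟩, hd⟩ := hcon
    apply hd
    rw [Finset.mem_map] at hv
    obtain ⟨x, -, rfl⟩ := hv
    refine Dense.of_two_le (u := φ x) (fun v hv => ?_)
      (Finset.mem_map_of_mem _ (Finset.mem_univ x)) ?_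
    · rw [Finset.mem_map] at hv
      obtain ⟨y, -, rfl⟩ := hv
      exact (h3 y).trans (Nat.le_add_right _ _)
    · have := h3 x
      omega

/-- The number of embeddings under which `H` is present in `G`. -/
def numPresent (R : ℕ) (H : SimpleGraph T) (G : SimpleGraph (Fin n)) : ℕ :=
  (Finset.univ.filter (fun φ : T ↪ Fin n => Present R H φ G)).card

theorem eventually_prob_present {R : ℕ} (hR : 0 < R) {H : SimpleGraph T}
    (hH : ∀ x, pdeg H x ≤ 2) {η : ℝ} (hη : 0 < η) :
    ∀ᶠ n in atTop, ∀ φ : T ↪ Fin n,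
      |prob n R (Present R H φ) * scale R n ^ (2 * Fintype.card T) -
        ((R : ℝ) * (R - 1)) ^ Fintype.card T| ≤ η := by
  obtain ⟨C, hC, h₁⟩ := eventually_prob_dense hR (Fintype.card T)
  filter_upwards [h₁, eventually_prob_eq hR (Fintype.card T) (2 * Fintype.card T) (half_pos hη),
    (tendsto_scale hR).eventually_ge_atTop (C / (η / 2)),
    (tendsto_scale hR).eventually_ge_atTop 1] with n h₁ h₂ hL hL1 φ
  have hcard : (Finset.univ.map φ).card = Fintype.card T := by
    rw [Finset.card_map, Finset.card_univ]
  have h₃ := h₁ _ hcard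
  have h₄ := h₂ (Finset.univ.map φ) (fun _ => 2) hcard.le (by
    rw [Finset.sum_const, hcard, smul_eq_mul, mul_comm])
  rw [Finset.prod_const, hcard] at h₄
  have h₅ := abs_prob_present_sub_le (R := R) hH φ
  set L := scale R n
  set t := Fintype.card T
  have hdesc : ((R.descFactorial 2 : ℕ) : ℝ) = (R : ℝ) * (R - 1) := by
    rw [Nat.descFactorial_succ, Nat.descFactorial_one]
    push_cast [Nat.cast_sub (show 1 ≤ R from hR)]
    ring
  rw [hdesc] at h₄
  have hL0 : 0 < L := by linarith
  have h₆ : |prob n R (Present R H φ) * L ^ (2 * t) -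
      prob n R (fun G => ∀ v ∈ Finset.univ.map φ, dfc R G v = 2) * L ^ (2 * t)| ≤ η / 2 := by
    rw [← sub_mul, abs_mul, abs_of_nonneg (show 0 ≤ L ^ (2 * t) by positivity)]
    refine (mul_le_mul_of_nonneg_right h₅ (by positivity)).trans ?_
    refine le_of_mul_le_mul_right ?_ hL0
    rw [mul_assoc, ← pow_succ]
    rw [div_le_iff₀ (by positivity)] at hL
    linarith
  have := abs_sub_le (prob n R (Present R H φ) * L ^ (2 * t))
    (prob n R (fun G => ∀ v ∈ Finset.univ.map φ, dfc R G v = 2) * L ^ (2 * t))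
    (((R : ℝ) * (R - 1)) ^ t)
  linarith

theorem tendsto_descFactorial_div_pow (k : ℕ) :
    Tendsto (fun n : ℕ => (n.descFactorial k : ℝ) / (n : ℝ) ^ k) atTop (𝓝 1) := by
  induction k with
  | zero => simp
  | succ k ih =>
    have h1 : Tendsto (fun n : ℕ => 1 - (k : ℝ) / n) atTop (𝓝 1) := by
      simpa using (tendsto_const_div_atTop_nhds_zero_nat (k : ℝ)).const_sub 1
    have h2 := h1.mul ih
    rw [mul_one] at h2
    refine h2.congr' ?_
    filter_upwards [eventually_ge_atTop (k + 1)] with n hn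
    have hn0 : (n : ℝ) ≠ 0 := by
      have : n ≠ 0 := by omega
      exact_mod_cast this
    rw [Nat.descFactorial_succ]
    push_cast [Nat.cast_sub (show k ≤ n by omega)]
    rw [pow_succ]
    field_simp

theorem avg_numPresent {R : ℕ} (H : SimpleGraph T) :
    avg n R (fun G => (numPresent R H G : ℝ)) = ∑ φ : T ↪ Fin n, prob n R (Present R H φ) := by
  unfold prob numPresent
  rw [← avg_sum]
  apply avg_congr
  intro G _
  rw [Finset.sum_boole]

/-- Each of the n(n-1)...(n-t+1) embeddings contributes about (R(R-1)/L²)^t, and L² = Rn cancels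
both n^t and R^t. -/
theorem tendsto_avg_numPresent {R : ℕ} (hR : 0 < R) {H : SimpleGraph T}
    (hH : ∀ x, pdeg H x ≤ 2) :
    Tendsto (fun n => avg n R (fun G => (numPresent R H G : ℝ))) atTop
      (𝓝 (((R : ℝ) - 1) ^ Fintype.card T)) := by
  have hR' : (0 : ℝ) < R := by exact_mod_cast hR
  set t := Fintype.card T
  set c : ℕ → ℝ := fun n => (n.descFactorial t : ℝ) / scale R n ^ (2 * t) with hc
  have hc_lim : Tendsto c atTop (𝓝 (1 / (R : ℝ) ^ t)) := by
    refine ((tendsto_descFactorial_div_pow t).mul_const (1 / (R : ℝ) ^ t)).congr' ?_ |>.trans ?_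
    · filter_upwards [eventually_gt_atTop 0] with n hn
      simp only [hc]
      rw [pow_mul, scale_sq, mul_pow]
      have : (n : ℝ) ≠ 0 := by
        have : n ≠ 0 := by omega
        exact_mod_cast this
      field_simp
    · rw [one_mul]
  have hmain : Tendsto (fun n => avg n R (fun G => (numPresent R H G : ℝ)) -
      c n * ((R : ℝ) * (R - 1)) ^ t) atTop (𝓝 0) := by
    have hcb : ∀ᶠ n in atTop, c n ≤ 1 / (R : ℝ) ^ t + 1 :=
      hc_lim.eventually_le_const (by linarith)
    rw [Metric.tendsto_atTop']
    intro ε hε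
    have hη : 0 < ε / 2 / (1 / (R : ℝ) ^ t + 1) := by positivity
    obtain ⟨N, hN⟩ := eventually_atTop.1 ((eventually_prob_present hR hH hη).and
      (hcb.and ((tendsto_scale hR).eventually_ge_atTop 1)))
    refine ⟨N, fun n hn => ?_⟩
    obtain ⟨h1, h2, h3⟩ := hN n hn.le
    have hL : 0 < scale R n ^ (2 * t) := pow_pos (by linarith) _
    rw [Real.dist_eq, sub_zero, avg_numPresent]
    have hcard : (Finset.univ : Finset (T ↪ Fin n)).card = n.descFactorial t := by
      rw [Finset.card_univ, Fintype.card_embedding_eq, Fintype.card_fin]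
    have hcs : c n * ((R : ℝ) * (R - 1)) ^ t =
        ∑ _φ : T ↪ Fin n, ((R : ℝ) * (R - 1)) ^ t / scale R n ^ (2 * t) := by
      rw [Finset.sum_const, hcard, nsmul_eq_mul]
      simp only [hc]
      ring
    rw [hcs, ← Finset.sum_sub_distrib]
    calc _ ≤ ∑ φ : T ↪ Fin n, |prob n R (Present R H φ) -
            ((R : ℝ) * (R - 1)) ^ t / scale R n ^ (2 * t)| := Finset.abs_sum_le_sum_abs _ _
      _ ≤ ∑ φ : T ↪ Fin n, ε / 2 / (1 / (R : ℝ) ^ t + 1) / scale R n ^ (2 * t) := by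
          apply Finset.sum_le_sum
          intro φ _
          rw [le_div_iff₀ hL]
          have := h1 φ
          rw [← abs_of_pos hL, ← abs_mul, abs_of_pos hL, sub_mul, div_mul_cancel₀ _ hL.ne']
          exact this
      _ = c n * (ε / 2 / (1 / (R : ℝ) ^ t + 1)) := by
          rw [Finset.sum_const, hcard, nsmul_eq_mul]
          simp only [hc]
          ring
      _ ≤ (1 / (R : ℝ) ^ t + 1) * (ε / 2 / (1 / (R : ℝ) ^ t + 1)) := by gcongr
      _ = ε / 2 := by field_simp
      _ < ε := by linarith
  have := hmain.add (hc_lim.mul_const (((R : ℝ) * (R - 1)) ^ t))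
  have hlim : 0 + 1 / (R : ℝ) ^ t * ((R : ℝ) * (R - 1)) ^ t = ((R : ℝ) - 1) ^ t := by
    rw [mul_pow]
    field_simp
    ring
  rw [hlim] at this
  refine this.congr fun n => ?_
  ring

/-- Some set of at most `K` vertices is dense. -/
def Bad (R K : ℕ) (G : SimpleGraph (Fin n)) : Prop :=
  ∃ V : Finset (Fin n), V.card ≤ K ∧ Dense R V G

theorem tendsto_prob_bad {R : ℕ} (hR : 0 < R) (K : ℕ) :
    Tendsto (fun n => prob n R (Bad R K)) atTop (𝓝 0) := by
  refine squeeze_zero (fun n => prob_nonneg _) (fun n => ?_) (tendsto_avg_numDense hR K)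
  apply avg_mono
  intro G _
  unfold numDense
  split_ifs with h
  · obtain ⟨V, hV, hd⟩ := h
    calc (1 : ℝ) = if Dense R V G then 1 else 0 := by rw [if_pos hd]
      _ ≤ _ := Finset.single_le_sum (f := fun V => if Dense R V G then (1 : ℝ) else 0)
          (fun _ _ => by split_ifs <;> norm_num) (by simpa using hV)
  · exact Finset.sum_nonneg fun _ _ => by split_ifs <;> norm_num

theorem inNbr_mono {V W : Finset (Fin n)} (h : V ⊆ W) (G : SimpleGraph (Fin n)) (v : Fin n) :
    inNbr V G v ≤ inNbr W G v :=
  Finset.card_le_card (Finset.filter_subset_filter _ h)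

/-- Vertices added from U bring at least 2 each, so the excess over twice the size survives. -/
theorem Dense.union {R : ℕ} {V U : Finset (Fin n)} {G : SimpleGraph (Fin n)} (hV : Dense R V G)
    (hU : ∀ v ∈ U, 2 ≤ dfc R G v + inNbr U G v) : Dense R (V ∪ U) G := by
  unfold Dense at *
  have h1 : V ∪ U = V ∪ (U \ V) := (Finset.union_sdiff_self_eq_union).symm
  have h2 : ∑ v ∈ V ∪ U, (dfc R G v + inNbr (V ∪ U) G v) =
      ∑ v ∈ V, (dfc R G v + inNbr (V ∪ U) G v) +
        ∑ v ∈ U \ V, (dfc R G v + inNbr (V ∪ U) G v) := by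
    rw [← Finset.sum_union Finset.disjoint_sdiff, ← h1]
  have h3 : (V ∪ U).card = V.card + (U \ V).card := by
    rw [h1, Finset.card_union_of_disjoint Finset.disjoint_sdiff]
  have h4 : ∑ v ∈ V, (dfc R G v + inNbr V G v) ≤ ∑ v ∈ V, (dfc R G v + inNbr (V ∪ U) G v) :=
    Finset.sum_le_sum fun v _ => Nat.add_le_add_left (inNbr_mono Finset.subset_union_left G v) _
  have h5 : (U \ V).card • 2 ≤ ∑ v ∈ U \ V, (dfc R G v + inNbr (V ∪ U) G v) := by
    apply Finset.card_nsmul_le_sum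
    intro v hv
    exact (hU v (Finset.mem_sdiff.1 hv).1).trans
      (Nat.add_le_add_left (inNbr_mono Finset.subset_union_right G v) _)
  rw [smul_eq_mul] at h5
  omega

theorem Present.pdeg_le_inNbr {R : ℕ} {H : SimpleGraph T} {φ : T ↪ Fin n}
    {G : SimpleGraph (Fin n)} (h : Present R H φ G) (x : T) :
    pdeg H x ≤ inNbr (Finset.univ.map φ) G (φ x) := by
  unfold pdeg inNbr
  rw [← Finset.card_map φ]
  apply Finset.card_le_card
  intro v
  simp only [Finset.mem_map, Finset.mem_filter, Finset.mem_univ, true_and]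
  rintro ⟨y, hy, rfl⟩
  exact ⟨⟨y, rfl⟩, h.1 x y hy⟩

theorem Present.two_le {R : ℕ} {H : SimpleGraph T} {φ : T ↪ Fin n}
    {G : SimpleGraph (Fin n)} (h : Present R H φ G) :
    ∀ v ∈ Finset.univ.map φ, 2 ≤ dfc R G v + inNbr (Finset.univ.map φ) G v := by
  intro v hv
  rw [Finset.mem_map] at hv
  obtain ⟨x, -, rfl⟩ := hv
  have h1 := h.pdeg_le_inNbr x
  have h2 := h.2 x
  omega

/-- A small probability of `Bad` does not by itself make its contribution to a moment small.
However, the union of a dense set with the image of an occurrence is again dense and of bounded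
size, so occurrences are charged to dense sets, whose expected number tends to 0. Each such set
contains boundedly many embeddings. -/
theorem numPresent_le {R K : ℕ} {H : SimpleGraph T} {G : SimpleGraph (Fin n)}
    (hG : Bad R K G) : (numPresent R H G : ℝ) ≤
      ((K : ℝ) + Fintype.card T) ^ Fintype.card T * numDense R (K + Fintype.card T) G := by
  obtain ⟨V, hV, hd⟩ := hG
  set t := Fintype.card T
  have h1 : (Finset.univ.filter (fun φ : T ↪ Fin n => Present R H φ G)) ⊆
      (Finset.univ.filter (fun W : Finset (Fin n) => W.card ≤ K + t ∧ Dense R W G)).biUnion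
        (fun W => Finset.univ.filter (fun φ : T ↪ Fin n => ∀ x, φ x ∈ W)) := by
    intro φ hφ
    rw [Finset.mem_filter] at hφ
    rw [Finset.mem_biUnion]
    refine ⟨V ∪ Finset.univ.map φ, ?_, ?_⟩
    · rw [Finset.mem_filter]
      refine ⟨Finset.mem_univ _, ?_, hd.union hφ.2.two_le⟩
      refine (Finset.card_union_le _ _).trans ?_
      rw [Finset.card_map, Finset.card_univ]
      omega
    · rw [Finset.mem_filter]
      refine ⟨Finset.mem_univ _, fun x => ?_⟩
      exact Finset.mem_union_right _ (Finset.mem_map_of_mem _ (Finset.mem_univ x))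
  have h2 : ∀ W ∈ Finset.univ.filter (fun W : Finset (Fin n) => W.card ≤ K + t ∧ Dense R W G),
      (Finset.univ.filter (fun φ : T ↪ Fin n => ∀ x, φ x ∈ W)).card ≤ (K + t) ^ t := by
    intro W hW
    rw [Finset.mem_filter] at hW
    have h3 : (Finset.univ.filter (fun φ : T ↪ Fin n => ∀ x, φ x ∈ W)).card ≤
        (Finset.univ : Finset (T → W)).card := by
      rw [← Finset.card_attach]
      refine Finset.card_le_card_of_injOn
        (fun φ x => ⟨φ.1 x, (Finset.mem_filter.1 φ.2).2 x⟩) (fun _ _ => Finset.mem_univ _) ?_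
      intro φ _ ψ _ h
      apply Subtype.ext
      ext x
      have := congrFun h x
      rw [Subtype.mk.injEq] at this
      rw [this]
    refine h3.trans ?_
    rw [Finset.card_univ, Fintype.card_fun, Fintype.card_coe]
    exact Nat.pow_le_pow_left hW.2.1 _
  have h3 := (Finset.card_le_card h1).trans (Finset.card_biUnion_le_card_mul _ _ _ h2)
  have h4 : numDense R (K + t) G =
      ((Finset.univ.filter (fun W : Finset (Fin n) => W.card ≤ K + t ∧ Dense R W G)).card : ℝ) := by
    unfold numDense
    rw [Finset.sum_boole, Finset.filter_filter]
  rw [h4, mul_comm]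
  unfold numPresent
  exact_mod_cast h3

theorem tendsto_avg_numPresent_good {R : ℕ} (hR : 0 < R) {H : SimpleGraph T}
    (hH : ∀ x, pdeg H x ≤ 2) (K : ℕ) :
    Tendsto (fun n => avg n R (fun G => if ¬ Bad R K G then (numPresent R H G : ℝ) else 0)) atTop
      (𝓝 (((R : ℝ) - 1) ^ Fintype.card T)) := by
  have h1 : Tendsto (fun n => avg n R (fun G => if Bad R K G then (numPresent R H G : ℝ) else 0))
      atTop (𝓝 0) := by
    have h2 := (tendsto_avg_numDense hR (K + Fintype.card T)).const_mul
      (((K : ℝ) + Fintype.card T) ^ Fintype.card T)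
    rw [mul_zero] at h2
    refine squeeze_zero (fun n => avg_nonneg fun G _ => by split_ifs <;> positivity)
      (fun n => ?_) h2
    rw [← avg_mul_left]
    apply avg_mono
    intro G _
    split_ifs with h
    · exact numPresent_le h
    · apply mul_nonneg (by positivity)
      exact Finset.sum_nonneg fun _ _ => by split_ifs <;> norm_num
  have h3 := (tendsto_avg_numPresent hR hH).sub h1
  rw [sub_zero] at h3
  refine h3.congr fun n => ?_
  rw [← avg_sub]
  apply avg_congr
  intro G _
  by_cases h : Bad R K G <;> simp [h]

end Pattern

end

/-! ### The method of factorial moments -/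

section

theorem descFactorial_add_eq (N a b : ℕ) :
    N.descFactorial (a + b) = N.descFactorial a * (N - a).descFactorial b := by
  induction b with
  | zero => simp
  | succ b ih =>
    rw [← add_assoc, Nat.descFactorial_succ, ih, Nat.descFactorial_succ, Nat.sub_sub]
    ring

/-- The truncated alternating sum telescopes by Pascal's rule to a single binomial coefficient of N
- 1, which is at most the first omitted term. -/
theorem abs_alternating_choose_le {N : ℕ} (hN : N ≠ 0) (J : ℕ) :
    |∑ j ∈ Finset.range (J + 1), (-1 : ℝ) ^ j * (N.choose j : ℝ)| ≤ (N.choose (J + 1) : ℝ) := by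
  obtain ⟨M, rfl⟩ := Nat.exists_eq_succ_of_ne_zero hN
  have h := Int.alternating_sum_range_choose_eq_choose (n := M) (m := J)
  have h' : ∑ j ∈ Finset.range (J + 1), (-1 : ℝ) ^ j * ((M + 1).choose j : ℝ) =
      (-1) ^ J * (M.choose J : ℝ) := by exact_mod_cast h
  rw [Nat.succ_eq_add_one, h', abs_mul, abs_pow, abs_neg, abs_one, one_pow, one_mul,
    abs_of_nonneg (Nat.cast_nonneg _), Nat.choose_succ_succ]
  push_cast
  linarith [Nat.cast_nonneg (α := ℝ) (M.choose (J + 1))]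

/-- The truncated inclusion-exclusion formula for the indicator of `N = x`. -/
theorem abs_indicator_sub_le (N x J : ℕ) :
    |(if N = x then (1 : ℝ) else 0) - ∑ j ∈ Finset.range (J + 1),
      (-1 : ℝ) ^ j / (x.factorial * j.factorial) * N.descFactorial (x + j)| ≤
      1 / (x.factorial * (J + 1).factorial) * N.descFactorial (x + (J + 1)) := by
  have hx : (x.factorial : ℝ) ≠ 0 := by exact_mod_cast x.factorial_ne_zero
  have hterm : ∀ j, (N.descFactorial (x + j) : ℝ) =
      x.factorial * N.choose x * (j.factorial * (N - x).choose j) := by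
    intro j
    rw [descFactorial_add_eq, Nat.descFactorial_eq_factorial_mul_choose N x,
      Nat.descFactorial_eq_factorial_mul_choose (N - x) j]
    push_cast
    ring
  have hsum : ∑ j ∈ Finset.range (J + 1),
      (-1 : ℝ) ^ j / (x.factorial * j.factorial) * N.descFactorial (x + j) =
      N.choose x * ∑ j ∈ Finset.range (J + 1), (-1 : ℝ) ^ j * ((N - x).choose j : ℝ) := by
    rw [Finset.mul_sum]
    apply Finset.sum_congr rfl
    intro j _
    have hj : (j.factorial : ℝ) ≠ 0 := by exact_mod_cast j.factorial_ne_zero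
    rw [hterm]
    field_simp
  have hright : 1 / ((x.factorial : ℝ) * (J + 1).factorial) * N.descFactorial (x + (J + 1)) =
      N.choose x * (N - x).choose (J + 1) := by
    have hj : ((J + 1).factorial : ℝ) ≠ 0 := by exact_mod_cast (J + 1).factorial_ne_zero
    rw [hterm]
    field_simp
  rw [hsum, hright]
  rcases lt_trichotomy N x with h | h | h
  · rw [if_neg h.ne, Nat.choose_eq_zero_of_lt h]
    simp
  · subst h
    rw [if_pos rfl, Finset.sum_range_succ']
    simp
  · rw [if_neg h.ne', zero_sub, abs_neg, abs_mul, abs_of_nonneg (Nat.cast_nonneg _)]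
    gcongr
    exact abs_alternating_choose_le (by omega) J

/-- The truncation level J is fixed first, making limiting value and limiting error good; then n
goes to infinity. This order avoids any uniformity in J. -/
theorem tendsto_of_approx {a : ℕ → ℝ} {A B : ℕ → ℕ → ℝ} {S E : ℕ → ℝ} {s : ℝ}
    (h : ∀ J n, |a n - A J n| ≤ B J n) (hA : ∀ J, Tendsto (A J) atTop (𝓝 (S J)))
    (hB : ∀ J, Tendsto (B J) atTop (𝓝 (E J))) (hS : Tendsto S atTop (𝓝 s))
    (hE : Tendsto E atTop (𝓝 0)) : Tendsto a atTop (𝓝 s) := by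
  rw [Metric.tendsto_atTop']
  intro ε hε
  have h1 := (Metric.tendsto_nhds.1 hS (ε / 4) (by positivity)).and
    (hE.eventually_lt_const (show (0 : ℝ) < ε / 4 by positivity))
  obtain ⟨J, hJS, hJE⟩ := h1.exists
  have h2 := (Metric.tendsto_nhds.1 (hA J) (ε / 4) (by positivity)).and
    ((hB J).eventually_lt_const hJE)
  obtain ⟨N, hN⟩ := eventually_atTop.1 h2
  refine ⟨N, fun n hn => ?_⟩
  obtain ⟨h3, h4⟩ := hN n hn.le
  have h5 := h J n
  rw [Real.dist_eq] at *
  have := abs_sub_le (a n) (A J n) s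
  have := abs_sub_le (A J n) (S J) s
  linarith

section Moments

variable {Ω : ℕ → Type*} [∀ n, Fintype (Ω n)]

/-- The method of factorial moments for a single Poisson limit, with weights. -/
theorem tendsto_sum_indicator {w : ∀ n, Ω n → ℝ} (hw : ∀ n ω, 0 ≤ w n ω) {X : ∀ n, Ω n → ℕ}
    {c μ : ℝ} (h : ∀ a : ℕ, Tendsto (fun n => ∑ ω, w n ω * ((X n ω).descFactorial a : ℝ)) atTop
      (𝓝 (c * μ ^ a))) (x : ℕ) :
    Tendsto (fun n => ∑ ω, w n ω * if X n ω = x then (1 : ℝ) else 0) atTop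
      (𝓝 (c * poissonMass μ x)) := by
  refine tendsto_of_approx
    (A := fun J n => ∑ j ∈ Finset.range (J + 1), (-1 : ℝ) ^ j / (x.factorial * j.factorial) *
      ∑ ω, w n ω * ((X n ω).descFactorial (x + j) : ℝ))
    (B := fun J n => 1 / (x.factorial * (J + 1).factorial) *
      ∑ ω, w n ω * ((X n ω).descFactorial (x + (J + 1)) : ℝ))
    (S := fun J => ∑ j ∈ Finset.range (J + 1), (-1 : ℝ) ^ j / (x.factorial * j.factorial) *
      (c * μ ^ (x + j)))
    (E := fun J => 1 / (x.factorial * (J + 1).factorial) * (c * μ ^ (x + (J + 1))))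
    ?_ ?_ ?_ ?_ ?_
  · intro J n
    simp_rw [Finset.mul_sum]
    rw [Finset.sum_comm, ← Finset.sum_sub_distrib]
    refine (Finset.abs_sum_le_sum_abs _ _).trans (Finset.sum_le_sum fun ω _ => ?_)
    have h1 := mul_le_mul_of_nonneg_left (abs_indicator_sub_le (X n ω) x J) (hw n ω)
    calc _ = w n ω * |(if X n ω = x then (1 : ℝ) else 0) - ∑ j ∈ Finset.range (J + 1),
          (-1 : ℝ) ^ j / (x.factorial * j.factorial) * (X n ω).descFactorial (x + j)| := by
          rw [← abs_of_nonneg (hw n ω), ← abs_mul, abs_of_nonneg (hw n ω), mul_sub,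
            Finset.mul_sum]
          congr 2
          apply Finset.sum_congr rfl
          intro j _
          ring
      _ ≤ _ := h1
      _ = _ := by ring
  · intro J
    exact tendsto_finsetSum _ fun j _ => (h (x + j)).const_mul _
  · intro J
    exact (h _).const_mul _
  -- The limiting truncated sums are c μ^x / x! times partial sums of the exponential series at -μ.
  · have hexp := (NormedSpace.expSeries_div_hasSum_exp (-μ)).tendsto_sum_nat.comp (tendsto_add_atTop_nat 1)
    rw [← Real.exp_eq_exp_ℝ] at hexp
    have h1 := hexp.const_mul (c * μ ^ x / x.factorial)
    have h2 : c * μ ^ x / x.factorial * Real.exp (-μ) = c * poissonMass μ x := by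
      unfold poissonMass
      ring
    rw [h2] at h1
    refine h1.congr fun J => ?_
    simp only [Function.comp]
    rw [Finset.mul_sum]
    apply Finset.sum_congr rfl
    intro j _
    have hx : (x.factorial : ℝ) ≠ 0 := by exact_mod_cast x.factorial_ne_zero
    have hj : (j.factorial : ℝ) ≠ 0 := by exact_mod_cast j.factorial_ne_zero
    rw [neg_pow, pow_add]
    field_simp
  · have h1 := ((FloorSemiring.tendsto_pow_div_factorial_atTop μ).comp
      (tendsto_add_atTop_nat 1)).const_mul (c * μ ^ x / x.factorial)
    rw [mul_zero] at h1
    refine h1.congr fun J => ?_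
    simp only [Function.comp]
    have hx : (x.factorial : ℝ) ≠ 0 := by exact_mod_cast x.factorial_ne_zero
    have hj : ((J + 1).factorial : ℝ) ≠ 0 := by exact_mod_cast (J + 1).factorial_ne_zero
    rw [pow_add]
    field_simp
    ring

/-- The method of factorial moments for several independent Poisson limits, with weights. -/
theorem tendsto_sum_prod_indicator {ι : Type*} (s : Finset ι) (μ : ι → ℝ) (x : ι → ℕ)
    {X : ∀ n, Ω n → ι → ℕ} :
    ∀ {w : ∀ n, Ω n → ℝ} (_ : ∀ n ω, 0 ≤ w n ω) {c : ℝ}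
      (_ : ∀ a : ι → ℕ, Tendsto
        (fun n => ∑ ω, w n ω * ∏ i ∈ s, ((X n ω i).descFactorial (a i) : ℝ)) atTop
        (𝓝 (c * ∏ i ∈ s, μ i ^ a i))),
      Tendsto (fun n => ∑ ω, w n ω * ∏ i ∈ s, if X n ω i = x i then (1 : ℝ) else 0) atTop
        (𝓝 (c * ∏ i ∈ s, poissonMass (μ i) (x i))) := by
  induction s using Finset.induction_on with
  | empty =>
    intro w _ c h
    simpa using h (fun _ => 0)
  | insert i s hi ih =>
    intro w hw c h
    have h1 : ∀ a : ι → ℕ, Tendsto (fun n => ∑ ω, (w n ω * if X n ω i = x i then (1 : ℝ) else 0) *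
        ∏ i ∈ s, ((X n ω i).descFactorial (a i) : ℝ)) atTop
        (𝓝 ((c * poissonMass (μ i) (x i)) * ∏ i ∈ s, μ i ^ a i)) := by
      intro a
      -- For coordinate i alone, the falling factorials of the other coordinates are part of the
      -- weight; afterwards the indicator of coordinate i joins the weight for the induction. This
      -- is why weights are allowed.
      have h2 := tendsto_sum_indicator
        (w := fun n ω => w n ω * ∏ i ∈ s, ((X n ω i).descFactorial (a i) : ℝ))
        (fun n ω => mul_nonneg (hw n ω) (Finset.prod_nonneg fun _ _ => Nat.cast_nonneg _))
        (X := fun n ω => X n ω i) (c := c * ∏ i ∈ s, μ i ^ a i) (μ := μ i) (fun b => by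
          have h3 := h (Function.update a i b)
          simp_rw [Finset.prod_insert hi, Function.update_self] at h3
          have h4 : ∀ f : ι → ℕ → ℝ, ∏ j ∈ s, f j (Function.update a i b j) =
              ∏ j ∈ s, f j (a j) := by
            intro f
            apply Finset.prod_congr rfl
            intro j hj
            rw [Function.update_of_ne (by rintro rfl; exact hi hj)]
          rw [h4 (fun j k => μ j ^ k)] at h3
          have h5 : c * (μ i ^ b * ∏ j ∈ s, μ j ^ a j) = (c * ∏ j ∈ s, μ j ^ a j) * μ i ^ b := by
            ring
          rw [h5] at h3
          refine h3.congr fun n => Finset.sum_congr rfl fun ω _ => ?_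
          rw [h4 (fun j k => ((X n ω j).descFactorial k : ℝ))]
          ring) (x i)
      have h6 : (c * ∏ i ∈ s, μ i ^ a i) * poissonMass (μ i) (x i) =
          (c * poissonMass (μ i) (x i)) * ∏ i ∈ s, μ i ^ a i := by ring
      rw [h6] at h2
      refine h2.congr fun n => Finset.sum_congr rfl fun ω _ => ?_
      ring
    have h7 := ih (w := fun n ω => w n ω * if X n ω i = x i then (1 : ℝ) else 0)
      (fun n ω => mul_nonneg (hw n ω) (by split_ifs <;> norm_num)) h1
    rw [Finset.prod_insert hi, ← mul_assoc]
    refine h7.congr fun n => Finset.sum_congr rfl fun ω _ => ?_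
    rw [Finset.prod_insert hi, mul_assoc]

end Moments

end

/-! ### Local structure of graphs without small dense sets -/

section

variable {n : ℕ}

section Structure

variable {R K k : ℕ} {G : SimpleGraph (Fin n)}

/-- A single strict inequality would make V dense. -/
theorem eq_two_of_not_bad (hG : ¬ Bad R K G) {V : Finset (Fin n)} (hV : V.card ≤ K)
    (h : ∀ v ∈ V, 2 ≤ dfc R G v + inNbr V G v) {v : Fin n} (hv : v ∈ V) :
    dfc R G v + inNbr V G v = 2 := by
  by_contra hne
  refine hG ⟨V, hV, Dense.of_two_le h hv ?_⟩
  have := h v hv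
  omega

theorem ncard_le_inNbr {S : G.Subgraph} {V : Finset (Fin n)} (hS : ∀ v ∈ S.verts, v ∈ V)
    (v : Fin n) : (S.neighborSet v).ncard ≤ inNbr V G v := by
  unfold inNbr
  rw [← Set.ncard_coe_finset]
  apply Set.ncard_le_ncard _ (Finset.finite_toSet _)
  intro w hw
  simp only [Finset.coe_filter, Set.mem_ofPred_eq]
  exact ⟨hS w (S.edge_vert hw.symm), S.adj_sub hw⟩

/-- The edges of S and the deficiency already account for the whole value 2 at each vertex of S,
leaving no room for a further neighbour in V. So a walk inside V that meets S never leaves it. -/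
theorem adj_of_closed {S : G.Subgraph} {V : Finset (Fin n)} (hS : ∀ v ∈ S.verts, v ∈ V)
    (hV : ∀ v ∈ V, dfc R G v + inNbr V G v = 2)
    (h : ∀ v ∈ S.verts, 2 ≤ dfc R G v + (S.neighborSet v).ncard) {a b : Fin n}
    (ha : a ∈ S.verts) (hb : b ∈ V) (hab : G.Adj a b) : S.Adj a b := by
  have h1 := hV a (hS a ha)
  have h2 := h a ha
  have h3 : (S.neighborSet a) ⊆ (V.filter (fun w => G.Adj a w) : Finset (Fin n)) := by
    intro w hw
    simp only [Finset.coe_filter, Set.mem_ofPred_eq]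
    exact ⟨hS w (S.edge_vert hw.symm), S.adj_sub hw⟩
  have h4 : S.neighborSet a = (V.filter (fun w => G.Adj a w) : Finset (Fin n)) := by
    apply Set.eq_of_subset_of_ncard_le h3 _ (Finset.finite_toSet _)
    rw [Set.ncard_coe_finset]
    unfold inNbr at h1
    omega
  have h5 : b ∈ S.neighborSet a := by
    rw [h4]
    simp only [Finset.coe_filter, Set.mem_ofPred_eq]
    exact ⟨hb, hab⟩
  exact h5

theorem support_subset_of_start {S : G.Subgraph} {V : Finset (Fin n)}
    (h : ∀ a ∈ S.verts, ∀ b ∈ V, G.Adj a b → S.Adj a b) {x y : Fin n} (w : G.Walk x y)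
    (hw : ∀ v ∈ w.support, v ∈ V) (hx : x ∈ S.verts) : ∀ v ∈ w.support, v ∈ S.verts := by
  induction w with
  | nil => simpa using hx
  | cons ha p ih =>
    intro v hv
    rw [SimpleGraph.Walk.support_cons, List.mem_cons] at hv
    rcases hv with rfl | hv
    · exact hx
    · refine ih (fun v hv => hw v ?_) ?_ v hv
      · rw [SimpleGraph.Walk.support_cons]
        exact List.mem_cons_of_mem _ hv
      · refine S.edge_vert (h _ hx _ (hw _ ?_) ha).symm
        rw [SimpleGraph.Walk.support_cons]
        exact List.mem_cons_of_mem _ p.start_mem_support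

theorem support_subset_of_mem {S : G.Subgraph} {V : Finset (Fin n)}
    (h : ∀ a ∈ S.verts, ∀ b ∈ V, G.Adj a b → S.Adj a b) {x y z : Fin n} (w : G.Walk x y)
    (hw : ∀ v ∈ w.support, v ∈ V) (hz : z ∈ w.support) (hzS : z ∈ S.verts) :
    ∀ v ∈ w.support, v ∈ S.verts := by
  apply support_subset_of_start h w hw
  apply support_subset_of_start h (w.takeUntil z hz).reverse _ hzS
  · simp
  · intro v hv
    apply hw
    apply SimpleGraph.Walk.support_takeUntil_subset_support w hz
    simpa using hv

theorem one_le_ncard_of_adj {S : G.Subgraph} {a b : Fin n} (h : S.Adj a b) :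
    1 ≤ (S.neighborSet a).ncard :=
  (Set.ncard_pos (Set.toFinite _)).2 ⟨b, h⟩

theorem one_le_ncard_start {x y : Fin n} (w : G.Walk x y) (h : x ≠ y) :
    1 ≤ (w.toSubgraph.neighborSet x).ncard :=
  one_le_ncard_of_adj (w.toSubgraph_adj_snd (fun hn => h hn.eq))

theorem one_le_ncard_end {x y : Fin n} (w : G.Walk x y) (h : x ≠ y) :
    1 ≤ (w.toSubgraph.neighborSet y).ncard :=
  one_le_ncard_of_adj (w.toSubgraph_adj_penultimate (fun hn => h hn.eq)).symm

theorem ncard_internal {x y v : Fin n} {w : G.Walk x y} (hw : w.IsPath) (hv : v ∈ w.support)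
    (hx : v ≠ x) (hy : v ≠ y) : (w.toSubgraph.neighborSet v).ncard = 2 := by
  obtain ⟨i, rfl, hi⟩ := SimpleGraph.Walk.mem_support_iff_exists_getVert.1 hv
  apply hw.ncard_neighborSet_toSubgraph_internal_eq_two
  · rintro rfl
    exact hx w.getVert_zero
  · refine lt_of_le_of_ne hi ?_
    rintro rfl
    exact hy w.getVert_length

theorem card_support_toFinset_le {x y : Fin n} (w : G.Walk x y) :
    w.support.toFinset.card ≤ w.length + 1 := by
  rw [← SimpleGraph.Walk.length_support]
  exact List.toFinset_card_le _

theorem two_le_of_ncard {S : G.Subgraph} {V : Finset (Fin n)} (hS : ∀ v ∈ S.verts, v ∈ V)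
    {v : Fin n} (h : 2 ≤ dfc R G v + (S.neighborSet v).ncard) :
    2 ≤ dfc R G v + inNbr V G v := by
  have := ncard_le_inNbr hS v
  omega

/-- Let V be the union of the two cycles and the path. Cycle vertices have two neighbours on their
cycle and inner path vertices two on the path, so rigidity applies and both cycles are closed in V.
Connectedness then puts each cycle inside the other. -/
theorem noCloseCycles_of_not_bad (hG : ¬ Bad R K G) (hK : k + 3 ≤ K) : NoCloseCycles k G := by
  rintro ⟨u, v, c₁, c₂, hc₁, hc₂, hne, x, hx, y, hy, w, hw, hlen⟩
  set V := c₁.support.toFinset ∪ c₂.support.toFinset ∪ w.support.toFinset with hVdef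
  have hV : V.card ≤ K := by
    rw [hVdef]
    have h1 := Finset.card_union_le (c₁.support.toFinset ∪ c₂.support.toFinset) w.support.toFinset
    have h2 := Finset.card_union_le c₁.support.toFinset c₂.support.toFinset
    have h3 := card_support_toFinset_le c₁
    have h4 := card_support_toFinset_le c₂
    have h5 := card_support_toFinset_le w
    omega
  have m₁ : ∀ z ∈ c₁.support, z ∈ V := fun z hz => by simp [hVdef, hz]
  have m₂ : ∀ z ∈ c₂.support, z ∈ V := fun z hz => by simp [hVdef, hz]
  have m₃ : ∀ z ∈ w.support, z ∈ V := fun z hz => by simp [hVdef, hz]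
  have s₁ : ∀ z ∈ c₁.toSubgraph.verts, z ∈ V := fun z hz => m₁ z (c₁.mem_verts_toSubgraph.1 hz)
  have s₂ : ∀ z ∈ c₂.toSubgraph.verts, z ∈ V := fun z hz => m₂ z (c₂.mem_verts_toSubgraph.1 hz)
  have s₃ : ∀ z ∈ w.toSubgraph.verts, z ∈ V := fun z hz => m₃ z (w.mem_verts_toSubgraph.1 hz)
  have n₁ : ∀ z ∈ c₁.support, 2 ≤ dfc R G z + (c₁.toSubgraph.neighborSet z).ncard := by
    intro z hz
    rw [hc₁.ncard_neighborSet_toSubgraph_eq_two hz]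
    omega
  have n₂ : ∀ z ∈ c₂.support, 2 ≤ dfc R G z + (c₂.toSubgraph.neighborSet z).ncard := by
    intro z hz
    rw [hc₂.ncard_neighborSet_toSubgraph_eq_two hz]
    omega
  have htwo : ∀ z ∈ V, 2 ≤ dfc R G z + inNbr V G z := by
    intro z hz
    by_cases h1 : z ∈ c₁.support
    · exact two_le_of_ncard s₁ (n₁ z h1)
    by_cases h2 : z ∈ c₂.support
    · exact two_le_of_ncard s₂ (n₂ z h2)
    have h3 : z ∈ w.support := by simpa [hVdef, h1, h2] using hz
    apply two_le_of_ncard s₃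
    rw [ncard_internal hw h3 (by rintro rfl; exact h1 hx) (by rintro rfl; exact h2 hy)]
    omega
  have heq : ∀ z ∈ V, dfc R G z + inNbr V G z = 2 := fun z hz => eq_two_of_not_bad hG hV htwo hz
  have cl₁ : ∀ a ∈ c₁.toSubgraph.verts, ∀ b ∈ V, G.Adj a b → c₁.toSubgraph.Adj a b :=
    fun a ha b hb hab => adj_of_closed s₁ heq
      (fun z hz => n₁ z (c₁.mem_verts_toSubgraph.1 hz)) ha hb hab
  have cl₂ : ∀ a ∈ c₂.toSubgraph.verts, ∀ b ∈ V, G.Adj a b → c₂.toSubgraph.Adj a b :=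
    fun a ha b hb hab => adj_of_closed s₂ heq
      (fun z hz => n₂ z (c₂.mem_verts_toSubgraph.1 hz)) ha hb hab
  have hx₁ : x ∈ c₁.toSubgraph.verts := c₁.mem_verts_toSubgraph.2 hx
  have hy₁ : y ∈ c₁.toSubgraph.verts :=
    support_subset_of_start cl₁ w m₃ hx₁ y w.end_mem_support
  have h₂₁ := support_subset_of_mem cl₁ c₂ m₂ hy hy₁
  have h₁₂ := support_subset_of_mem cl₂ c₁ m₁ (c₁.mem_verts_toSubgraph.1 hy₁)
    (c₂.mem_verts_toSubgraph.2 hy)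
  apply hne
  ext a b
  · constructor
    · exact fun ha => h₁₂ a (c₁.mem_verts_toSubgraph.1 ha)
    · exact fun ha => h₂₁ a (c₂.mem_verts_toSubgraph.1 ha)
  · constructor
    · intro hab
      have ha := c₁.mem_verts_toSubgraph.1 (c₁.toSubgraph.edge_vert hab)
      have hb := s₁ b (c₁.toSubgraph.edge_vert hab.symm)
      exact cl₂ a (h₁₂ a ha) b hb (c₁.toSubgraph.adj_sub hab)
    · intro hab
      have ha := c₂.mem_verts_toSubgraph.1 (c₂.toSubgraph.edge_vert hab)
      have hb := s₂ b (c₂.toSubgraph.edge_vert hab.symm)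
      exact cl₁ a (h₂₁ a ha) b hb (c₂.toSubgraph.adj_sub hab)

/-- On the union of cycle and path, the start of the path has a deficiency and, if it is off the
cycle, a neighbour. Rigidity makes the cycle closed, so v lies on it; but two neighbours and a
deficiency add up to more than 2. -/
theorem noCycleNearSmallDegree_of_not_bad (hG : ¬ Bad R K G) (hK : 2 * k + 2 ≤ K) :
    NoCycleNearSmallDegree R k G := by
  rintro ⟨v, u, c, hdeg, hc, hck, x, hx, w, hw, hwk⟩
  have hdv : 1 ≤ dfc R G v := by
    unfold dfc
    omega
  set V := c.support.toFinset ∪ w.support.toFinset with hVdef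
  have hV : V.card ≤ K := by
    rw [hVdef]
    have h2 := Finset.card_union_le c.support.toFinset w.support.toFinset
    have h3 := card_support_toFinset_le c
    have h5 := card_support_toFinset_le w
    omega
  have m₁ : ∀ z ∈ c.support, z ∈ V := fun z hz => by simp [hVdef, hz]
  have m₃ : ∀ z ∈ w.support, z ∈ V := fun z hz => by simp [hVdef, hz]
  have s₁ : ∀ z ∈ c.toSubgraph.verts, z ∈ V := fun z hz => m₁ z (c.mem_verts_toSubgraph.1 hz)
  have s₃ : ∀ z ∈ w.toSubgraph.verts, z ∈ V := fun z hz => m₃ z (w.mem_verts_toSubgraph.1 hz)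
  have n₁ : ∀ z ∈ c.support, 2 ≤ dfc R G z + (c.toSubgraph.neighborSet z).ncard := by
    intro z hz
    rw [hc.ncard_neighborSet_toSubgraph_eq_two hz]
    omega
  have htwo : ∀ z ∈ V, 2 ≤ dfc R G z + inNbr V G z := by
    intro z hz
    by_cases h1 : z ∈ c.support
    · exact two_le_of_ncard s₁ (n₁ z h1)
    have h3 : z ∈ w.support := by simpa [hVdef, h1] using hz
    have hzx : z ≠ x := by
      rintro rfl
      exact h1 hx
    apply two_le_of_ncard s₃
    by_cases hzv : z = v
    · subst hzv
      have := one_le_ncard_start w hzx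
      omega
    · rw [ncard_internal hw h3 hzv hzx]
      omega
  have heq : ∀ z ∈ V, dfc R G z + inNbr V G z = 2 := fun z hz => eq_two_of_not_bad hG hV htwo hz
  have cl₁ : ∀ a ∈ c.toSubgraph.verts, ∀ b ∈ V, G.Adj a b → c.toSubgraph.Adj a b :=
    fun a ha b hb hab => adj_of_closed s₁ heq
      (fun z hz => n₁ z (c.mem_verts_toSubgraph.1 hz)) ha hb hab
  have hv := support_subset_of_mem cl₁ w m₃ w.end_mem_support (c.mem_verts_toSubgraph.2 hx)
    v w.start_mem_support
  have h1 := ncard_le_inNbr s₁ v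
  rw [hc.ncard_neighborSet_toSubgraph_eq_two (c.mem_verts_toSubgraph.1 hv)] at h1
  have h2 := heq v (s₁ v hv)
  omega

/-- On the union of the paths from v₁ to v₂ and to v₃, each path is saturated, its ends by
deficiency and one neighbour. Closedness of the first path forces v₃ to be one of its inner
vertices, where two neighbours and a deficiency exceed 2. -/
theorem noThreeClose_of_not_bad (hR : 1 ≤ R) (hG : ¬ Bad R K G) (hK : 2 * k + 2 ≤ K) :
    NoThreeClose R k G := by
  rintro ⟨v₁, v₂, v₃, h12, h13, h23, hd₁, hd₂, hd₃, ⟨p, hp, hpk⟩, ⟨q, hq, hqk⟩, -⟩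
  have hd₁ : 1 ≤ dfc R G v₁ := by
    unfold dfc
    omega
  have hd₂ : 1 ≤ dfc R G v₂ := by
    unfold dfc
    omega
  have hd₃ : 1 ≤ dfc R G v₃ := by
    unfold dfc
    omega
  set V := p.support.toFinset ∪ q.support.toFinset with hVdef
  have hV : V.card ≤ K := by
    rw [hVdef]
    have h2 := Finset.card_union_le p.support.toFinset q.support.toFinset
    have h3 := card_support_toFinset_le p
    have h5 := card_support_toFinset_le q
    omega
  have m₁ : ∀ z ∈ p.support, z ∈ V := fun z hz => by simp [hVdef, hz]
  have m₃ : ∀ z ∈ q.support, z ∈ V := fun z hz => by simp [hVdef, hz]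
  have s₁ : ∀ z ∈ p.toSubgraph.verts, z ∈ V := fun z hz => m₁ z (p.mem_verts_toSubgraph.1 hz)
  have s₃ : ∀ z ∈ q.toSubgraph.verts, z ∈ V := fun z hz => m₃ z (q.mem_verts_toSubgraph.1 hz)
  have n₁ : ∀ z ∈ p.support, 2 ≤ dfc R G z + (p.toSubgraph.neighborSet z).ncard := by
    intro z hz
    by_cases h1 : z = v₁
    · subst h1
      have := one_le_ncard_start p h12
      omega
    by_cases h2 : z = v₂
    · subst h2
      have := one_le_ncard_end p h12
      omega
    rw [ncard_internal hp hz h1 h2]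
    omega
  have n₃ : ∀ z ∈ q.support, 2 ≤ dfc R G z + (q.toSubgraph.neighborSet z).ncard := by
    intro z hz
    by_cases h1 : z = v₁
    · subst h1
      have := one_le_ncard_start q h13
      omega
    by_cases h2 : z = v₃
    · subst h2
      have := one_le_ncard_end q h13
      omega
    rw [ncard_internal hq hz h1 h2]
    omega
  have htwo : ∀ z ∈ V, 2 ≤ dfc R G z + inNbr V G z := by
    intro z hz
    by_cases h1 : z ∈ p.support
    · exact two_le_of_ncard s₁ (n₁ z h1)
    · exact two_le_of_ncard s₃ (n₃ z (by simpa [hVdef, h1] using hz))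
  have heq : ∀ z ∈ V, dfc R G z + inNbr V G z = 2 := fun z hz => eq_two_of_not_bad hG hV htwo hz
  have cl₁ : ∀ a ∈ p.toSubgraph.verts, ∀ b ∈ V, G.Adj a b → p.toSubgraph.Adj a b :=
    fun a ha b hb hab => adj_of_closed s₁ heq
      (fun z hz => n₁ z (p.mem_verts_toSubgraph.1 hz)) ha hb hab
  have hv := support_subset_of_start cl₁ q m₃ p.start_mem_verts_toSubgraph v₃ q.end_mem_support
  have h1 := ncard_le_inNbr s₁ v₃
  rw [ncard_internal hp (p.mem_verts_toSubgraph.1 hv) h13.symm h23.symm] at h1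
  have h2 := heq v₃ (s₁ v₃ hv)
  omega

/-- On the path from v to w rigidity applies, but w has deficiency at least 2 and a neighbour. -/
theorem noCloseToVerySmallDegree_of_not_bad (hR : 2 ≤ R) (hG : ¬ Bad R K G) (hK : k + 1 ≤ K) :
    NoCloseToVerySmallDegree R k G := by
  rintro ⟨v, w, hne, hv, hw, p, hp, hpk⟩
  have hd₁ : 1 ≤ dfc R G v := by
    unfold dfc
    omega
  have hd₂ : 2 ≤ dfc R G w := by
    unfold dfc
    omega
  have hV := card_support_toFinset_le p
  have s : ∀ z ∈ p.toSubgraph.verts, z ∈ p.support.toFinset :=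
    fun z hz => List.mem_toFinset.2 (p.mem_verts_toSubgraph.1 hz)
  have h1 := one_le_ncard_end p hne
  have h2 := ncard_le_inNbr s w
  have h3 := eq_two_of_not_bad (v := w) hG (hV.trans (by omega)) (fun z hz => by
    rw [List.mem_toFinset] at hz
    apply two_le_of_ncard s
    by_cases h1 : z = v
    · subst h1
      have := one_le_ncard_start p hne
      omega
    by_cases h2 : z = w
    · subst h2
      omega
    rw [ncard_internal hp hz h1 h2]
    omega) (List.mem_toFinset.2 p.end_mem_support)
  omega

/-- The degrees of a subgraph with more edges than vertices already sum to more than twice the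
number of vertices. -/
theorem noDenseSubgraph_of_not_bad (hG : ¬ Bad R K G) (hK : k ≤ K) : NoDenseSubgraph k G := by
  rintro p hp ⟨H, hv, he⟩
  apply hG
  refine ⟨H.verts.toFinset, ?_, ?_⟩
  · rw [← Set.ncard_eq_toFinset_card']
    omega
  unfold Dense
  rw [← Set.ncard_eq_toFinset_card', hv]
  have h1 : ∑ v ∈ H.verts.toFinset, (H.neighborSet v).ncard = 2 * H.edgeSet.ncard := by
    have h2 := H.spanningCoe.sum_degrees_eq_twice_card_edges
    have h3 : H.spanningCoe.edgeFinset.card = H.edgeSet.ncard := by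
      rw [Set.ncard_eq_toFinset_card']
      congr 1
      ext e
      simp
    rw [h3] at h2
    rw [← h2, ← Finset.sum_subset (Finset.subset_univ H.verts.toFinset)]
    · apply Finset.sum_congr rfl
      intro v _
      rw [Set.ncard_eq_toFinset_card', ← SimpleGraph.card_neighborFinset_eq_degree]
      congr 1
      ext w
      simp
    · intro v _ hv
      rw [Set.mem_toFinset] at hv
      rw [← SimpleGraph.card_neighborFinset_eq_degree, Finset.card_eq_zero]
      ext w
      simp only [SimpleGraph.mem_neighborFinset, SimpleGraph.Subgraph.spanningCoe_adj,
        Finset.notMem_empty, iff_false]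
      exact fun h => hv (H.edge_vert h)
  calc 2 * p < 2 * H.edgeSet.ncard := by omega
    _ = ∑ v ∈ H.verts.toFinset, (H.neighborSet v).ncard := h1.symm
    _ ≤ _ := by
      apply Finset.sum_le_sum
      intro v _
      exact (ncard_le_inNbr (fun z hz => Set.mem_toFinset.2 hz) v).trans (Nat.le_add_left _ _)

/-- All neighbours of a vertex lie in its component, so deficiency and internal degree add up to R ≥
3 everywhere. -/
theorem not_hasSmallComponent_of_not_bad (hR : 3 ≤ R) (hmem : G ∈ graphs n R)
    (hG : ¬ Bad R K G) (hK : k ≤ K) : ¬ HasSmallComponent k G := by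
  rintro ⟨C, hC⟩
  have hdeg : ∀ v ∈ C.supp.toFinset, dfc R G v + inNbr C.supp.toFinset G v = R := by
    intro v hv
    have h1 : inNbr C.supp.toFinset G v = deg G v := by
      rw [deg_eq_card, inNbr]
      congr 1
      ext w
      simp only [Finset.mem_filter, Finset.mem_univ, true_and, and_iff_right_iff_imp]
      intro hvw
      rw [Set.mem_toFinset, SimpleGraph.ConnectedComponent.mem_supp_iff] at hv ⊢
      rw [← hv]
      exact SimpleGraph.ConnectedComponent.sound hvw.symm.reachable
    rw [h1, add_comm]
    exact deg_add_dfc hmem v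
  obtain ⟨v, hv⟩ := C.nonempty_supp
  have hv' := Set.mem_toFinset.2 hv
  refine hG ⟨C.supp.toFinset, ?_, Dense.of_two_le (fun v hv => ?_) hv' ?_⟩
  · rw [← Set.ncard_eq_toFinset_card']
    omega
  · rw [hdeg v hv]
    omega
  · rw [hdeg v hv']
    omega

end Structure

end

/-! ### Overlaps of occurrences, automorphisms and disjoint unions -/

section

variable {n : ℕ}

section PresentStructure

variable {T T' : Type*} [Fintype T] [Fintype T'] {R K : ℕ} {G : SimpleGraph (Fin n)}
  {H : SimpleGraph T} {H' : SimpleGraph T'} {φ : T ↪ Fin n} {ψ : T' ↪ Fin n}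

/-- The set of vertices onto which an embedding maps. -/
def cls (φ : T ↪ Fin n) : Finset (Fin n) :=
  Finset.univ.map φ

theorem mem_cls {v : Fin n} : v ∈ cls φ ↔ ∃ x, φ x = v := by
  simp [cls]

theorem apply_mem_cls (x : T) : φ x ∈ cls φ :=
  mem_cls.2 ⟨x, rfl⟩

theorem card_cls : (cls φ).card = Fintype.card T := by
  rw [cls, Finset.card_map, Finset.card_univ]

theorem Present.eq_two (hG : ¬ Bad R K G) (hφ : Present R H φ G) (hψ : Present R H' ψ G)
    (hK : Fintype.card T + Fintype.card T' ≤ K) {v : Fin n} (hv : v ∈ cls φ ∪ cls ψ) :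
    dfc R G v + inNbr (cls φ ∪ cls ψ) G v = 2 := by
  refine eq_two_of_not_bad hG ?_ ?_ hv
  · refine (Finset.card_union_le _ _).trans ?_
    rwa [card_cls, card_cls]
  · intro v hv
    rcases Finset.mem_union.1 hv with h | h
    · exact (hφ.two_le v h).trans
        (Nat.add_le_add_left (inNbr_mono Finset.subset_union_left G v) _)
    · exact (hψ.two_le v h).trans
        (Nat.add_le_add_left (inNbr_mono Finset.subset_union_right G v) _)

/-- Rigidity on the union of two occurrences turns all inequalities into equalities, so a vertex of
the copy has no neighbours in the union beyond its pattern neighbours. A vertex of pattern degree 2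
is thereby seen to have deficiency 0. -/
theorem Present.inNbr_eq (hG : ¬ Bad R K G) (hφ : Present R H φ G) (hψ : Present R H' ψ G)
    (hK : Fintype.card T + Fintype.card T' ≤ K) (x : T) :
    inNbr (cls φ ∪ cls ψ) G (φ x) = pdeg H x ∧ dfc R G (φ x) + pdeg H x = 2 := by
  have h1 := hφ.eq_two hG hψ hK (Finset.mem_union_left _ (apply_mem_cls x))
  have h2 := hφ.pdeg_le_inNbr x
  have h3 := inNbr_mono (Finset.subset_union_left (s₁ := cls φ) (s₂ := cls ψ)) G (φ x)
  have h4 := hφ.2 x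
  have h5 : inNbr (cls φ) G (φ x) = inNbr (Finset.univ.map φ) G (φ x) := rfl
  omega

theorem Present.exists_of_adj (hG : ¬ Bad R K G) (hφ : Present R H φ G) (hψ : Present R H' ψ G)
    (hK : Fintype.card T + Fintype.card T' ≤ K) {x : T} {b : Fin n} (hb : b ∈ cls φ ∪ cls ψ)
    (hab : G.Adj (φ x) b) : ∃ y, H.Adj x y ∧ φ y = b := by
  have h1 := (hφ.inNbr_eq hG hψ hK x).1
  have h2 : (Finset.univ.filter (fun y => H.Adj x y)).map φ ⊆
      (cls φ ∪ cls ψ).filter (fun w => G.Adj (φ x) w) := by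
    intro w hw
    rw [Finset.mem_map] at hw
    obtain ⟨y, hy, rfl⟩ := hw
    rw [Finset.mem_filter] at hy ⊢
    exact ⟨Finset.mem_union_left _ (apply_mem_cls y), hφ.1 x y hy.2⟩
  have h3 := Finset.eq_of_subset_of_card_le h2 (by
    rw [Finset.card_map]
    exact h1.le)
  have h4 : b ∈ (cls φ ∪ cls ψ).filter (fun w => G.Adj (φ x) w) :=
    Finset.mem_filter.2 ⟨hb, hab⟩
  rw [← h3, Finset.mem_map] at h4
  obtain ⟨y, hy, hyb⟩ := h4
  exact ⟨y, (Finset.mem_filter.1 hy).2, hyb⟩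

theorem Present.cls_subset (hG : ¬ Bad R K G) (hφ : Present R H φ G) (hψ : Present R H' ψ G)
    (hK : Fintype.card T + Fintype.card T' ≤ K) (hH' : H'.Preconnected) {v : Fin n}
    (h₁ : v ∈ cls φ) (h₂ : v ∈ cls ψ) : cls ψ ⊆ cls φ := by
  obtain ⟨y, rfl⟩ := mem_cls.1 h₂
  intro w hw
  obtain ⟨z, rfl⟩ := mem_cls.1 hw
  obtain ⟨p⟩ := hH' y z
  clear hw h₂
  induction p with
  | nil => exact h₁
  | cons ha p ih =>
    apply ih
    obtain ⟨x, hx⟩ := mem_cls.1 h₁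
    have h3 := hψ.1 _ _ ha
    rw [← hx] at h3
    obtain ⟨x', -, hx'⟩ := hφ.exists_of_adj hG hψ hK
      (Finset.mem_union_right _ (apply_mem_cls _)) h3
    exact mem_cls.2 ⟨x', hx'⟩

/-- Each copy is closed in the union, so a connected copy meeting the other lies inside it; this
applies in both directions. -/
theorem Present.cls_eq (hG : ¬ Bad R K G) (hφ : Present R H φ G) (hψ : Present R H' ψ G)
    (hK : Fintype.card T + Fintype.card T' ≤ K) (hH : H.Preconnected) (hH' : H'.Preconnected)
    (h : ¬ Disjoint (cls φ) (cls ψ)) : cls φ = cls ψ := by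
  rw [Finset.not_disjoint_iff] at h
  obtain ⟨v, h₁, h₂⟩ := h
  exact Finset.Subset.antisymm (hψ.cls_subset hG hφ (by omega) hH h₂ h₁)
    (hφ.cls_subset hG hψ hK hH' h₁ h₂)

theorem Present.adj_iff (hG : ¬ Bad R K G) (hφ : Present R H φ G)
    (hK : Fintype.card T + Fintype.card T ≤ K) {x y : T} :
    G.Adj (φ x) (φ y) ↔ H.Adj x y := by
  constructor
  · intro h
    obtain ⟨z, hz, hzy⟩ := hφ.exists_of_adj hG hφ hK
      (Finset.mem_union_left _ (apply_mem_cls y)) h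
    rwa [φ.injective hzy] at hz
  · exact hφ.1 x y

theorem pdeg_iso (σ : H ≃g H) (x : T) : pdeg H (σ x) = pdeg H x := by
  unfold pdeg
  symm
  rw [← Finset.card_map σ.toEquiv.toEmbedding]
  congr 1
  ext y
  simp only [Finset.mem_map, Finset.mem_filter, Finset.mem_univ, true_and]
  constructor
  · rintro ⟨z, hz, rfl⟩
    exact σ.map_rel_iff.2 hz
  · intro h
    refine ⟨σ.symm y, ?_, σ.apply_symm_apply y⟩
    rw [← σ.map_rel_iff]
    rwa [σ.apply_symm_apply]

/-- In a graph without small dense sets, the embeddings of a pattern onto a given set of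
vertices correspond to the automorphisms of the pattern. -/
theorem Present.card_filter_cls_eq (hG : ¬ Bad R K G) (hφ : Present R H φ G)
    (hK : Fintype.card T + Fintype.card T ≤ K) :
    ((Finset.univ.filter (fun ψ : T ↪ Fin n => Present R H ψ G)).filter
      (fun ψ => cls ψ = cls φ)).card = Nat.card (H ≃g H) := by
  set f : (H ≃g H) → (T ↪ Fin n) := fun σ => σ.toEquiv.toEmbedding.trans φ with hf
  have hinj : Function.Injective f := by
    intro σ τ h
    ext x
    apply φ.injective
    exact DFunLike.congr_fun h x
  rw [← Nat.card_range_of_injective hinj, Nat.card_coe_set_eq, ← Set.ncard_coe_finset]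
  congr 1
  ext ψ
  simp only [Finset.coe_filter, Finset.mem_filter, Finset.mem_univ, true_and, Set.mem_ofPred_eq,
    Set.mem_range]
  constructor
  · rintro ⟨hψ, hc⟩
    have h1 : ∀ x, ∃ y, φ y = ψ x := fun x => mem_cls.1 (hc ▸ apply_mem_cls x)
    choose s hs using h1
    have hsinj : Function.Injective s := by
      intro x y h
      apply ψ.injective
      rw [← hs, ← hs, h]
    have hsbij := Finite.injective_iff_bijective.1 hsinj
    refine ⟨⟨Equiv.ofBijective s hsbij, ?_⟩, ?_⟩
    · intro x y
      show H.Adj (s x) (s y) ↔ H.Adj x y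
      rw [← hφ.adj_iff hG hK (x := s x) (y := s y), ← hψ.adj_iff hG hK (x := x) (y := y), hs, hs]
    · ext x
      simp [hf, hs]
  · rintro ⟨σ, rfl⟩
    refine ⟨⟨?_, ?_⟩, ?_⟩
    · intro x y h
      exact hφ.1 _ _ (σ.map_rel_iff.2 h)
    · intro x _
      have h1 := (hφ.inNbr_eq hG hφ hK (σ x)).2
      rw [pdeg_iso] at h1
      show dfc R G (φ (σ x)) = _
      omega
    · ext v
      simp only [mem_cls]
      constructor
      · rintro ⟨x, rfl⟩
        exact ⟨σ x, rfl⟩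
      · rintro ⟨x, rfl⟩
        exact ⟨σ.symm x, by simp [hf]⟩

end PresentStructure

theorem card_filter_eq_natCard {α : Type*} [Fintype α] (P : α → Prop) [DecidablePred P] :
    (Finset.univ.filter P).card = Nat.card {x // P x} := by
  rw [Nat.card_eq_fintype_card, Fintype.card_subtype]

theorem card_injective_functions {C : Type*} (I : Finset C) [Fintype C] (a : ℕ) :
    (Finset.univ.filter (fun k : Fin a → C => (∀ j, k j ∈ I) ∧ Function.Injective k)).card =
      I.card.descFactorial a := by
  have h : I.card.descFactorial a = Fintype.card (Fin a ↪ I) := by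
    rw [Fintype.card_embedding_eq, Fintype.card_coe, Fintype.card_fin]
  rw [h, ← Finset.card_univ]
  symm
  refine Finset.card_bij (fun e _ j => (e j : C)) ?_ ?_ ?_
  · intro e _
    rw [Finset.mem_filter]
    refine ⟨Finset.mem_univ _, fun j => (e j).2, ?_⟩
    intro x y h
    exact e.injective (Subtype.ext h)
  · intro e _ e' _ h
    ext j
    exact congrFun h j
  · intro k hk
    rw [Finset.mem_filter] at hk
    refine ⟨⟨fun j => ⟨k j, hk.2.1 j⟩, ?_⟩, Finset.mem_univ _, rfl⟩
    intro x y h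
    exact hk.2.2 (congrArg Subtype.val h)

/-- One chooses distinct classes in order, then an element of each class independently. With classes
of occurrences having equal vertex sets, this passes from embeddings to falling factorials of the
number of copies. -/
theorem card_functions_injective_comp {E C : Type*} [Fintype E] [Fintype C] (Z : Finset E)
    (f : E → C) {α : ℕ} (hα : ∀ e ∈ Z, (Z.filter (fun e' => f e' = f e)).card = α) (a : ℕ) :
    Nat.card {h : Fin a → E // (∀ j, h j ∈ Z) ∧ Function.Injective (fun j => f (h j))} =
      (Z.image f).card.descFactorial a * α ^ a := by
  rw [← card_filter_eq_natCard, ← card_injective_functions (Z.image f) a, ← smul_eq_mul, ← Finset.sum_const]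
  rw [Finset.card_eq_sum_card_fiberwise (f := fun h j => f (h j))
    (t := Finset.univ.filter (fun k : Fin a → C => (∀ j, k j ∈ Z.image f) ∧ Function.Injective k))]
  · apply Finset.sum_congr rfl
    intro k hk
    rw [Finset.mem_filter] at hk
    have h1 : (Finset.univ.filter
        (fun h : Fin a → E => (∀ j, h j ∈ Z) ∧ Function.Injective (fun j => f (h j)))).filter
        (fun h => (fun j => f (h j)) = k) =
        Fintype.piFinset (fun j => Z.filter (fun e' => f e' = k j)) := by
      ext h
      simp only [Finset.mem_filter, Finset.mem_univ, true_and, Fintype.mem_piFinset]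
      constructor
      · rintro ⟨⟨h1, _⟩, rfl⟩
        exact fun j => ⟨h1 j, rfl⟩
      · intro h1
        have h2 : (fun j => f (h j)) = k := funext fun j => (h1 j).2
        exact ⟨⟨fun j => (h1 j).1, h2 ▸ hk.2.2⟩, h2⟩
    rw [h1, Fintype.card_piFinset]
    rw [Finset.prod_congr rfl (g := fun _ => α), Finset.prod_const, Finset.card_univ,
      Fintype.card_fin]
    intro j _
    obtain ⟨e, he, hej⟩ := Finset.mem_image.1 (hk.2.1 j)
    rw [← hej]
    exact hα e he
  · intro h hh
    simp only [Finset.coe_filter, Finset.mem_univ, true_and, Set.mem_ofPred_eq] at hh ⊢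
    exact ⟨fun j => Finset.mem_image_of_mem _ (hh.1 j), hh.2⟩

section SigmaPattern

variable {C : Type*} {T : C → Type*}

/-- The disjoint union of a family of graphs. -/
def sigmaGraph (H : ∀ c, SimpleGraph (T c)) : SimpleGraph (Σ c, T c) where
  Adj p q := ∃ c x y, p = ⟨c, x⟩ ∧ q = ⟨c, y⟩ ∧ (H c).Adj x y
  symm := ⟨by
    rintro _ _ ⟨c, x, y, rfl, rfl, h⟩
    exact ⟨c, y, x, rfl, rfl, h.symm⟩⟩
  loopless := ⟨by
    rintro _ ⟨c, x, y, rfl, h, h'⟩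
    rw [Sigma.mk.injEq] at h
    exact h'.ne (eq_of_heq h.2)⟩

theorem sigmaGraph_adj {H : ∀ c, SimpleGraph (T c)} {c : C} {x : T c} {q : Σ c, T c} :
    (sigmaGraph H).Adj ⟨c, x⟩ q ↔ ∃ y, q = ⟨c, y⟩ ∧ (H c).Adj x y := by
  constructor
  · rintro ⟨c', x', y, h, rfl, h'⟩
    obtain ⟨rfl, hx⟩ := Sigma.mk.inj h
    rw [eq_of_heq hx]
    exact ⟨y, rfl, h'⟩
  · rintro ⟨y, rfl, h⟩
    exact ⟨c, x, y, rfl, rfl, h⟩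

variable [Fintype C] [∀ c, Fintype (T c)]

theorem pdeg_sigmaGraph (H : ∀ c, SimpleGraph (T c)) (c : C) (x : T c) :
    pdeg (sigmaGraph H) ⟨c, x⟩ = pdeg (H c) x := by
  unfold pdeg
  symm
  rw [← Finset.card_map (Function.Embedding.sigmaMk c)]
  congr 1
  ext q
  simp only [Finset.mem_map, Finset.mem_filter, Finset.mem_univ, true_and, sigmaGraph_adj,
    Function.Embedding.sigmaMk_apply]
  constructor
  · rintro ⟨y, hy, rfl⟩
    exact ⟨y, rfl, hy⟩
  · rintro ⟨y, rfl, hy⟩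
    exact ⟨y, hy, rfl⟩

theorem present_sigmaGraph {R : ℕ} {H : ∀ c, SimpleGraph (T c)} {Φ : (Σ c, T c) ↪ Fin n}
    {G : SimpleGraph (Fin n)} : Present R (sigmaGraph H) Φ G ↔
      ∀ c, Present R (H c) ((Function.Embedding.sigmaMk c).trans Φ) G := by
  constructor
  · rintro ⟨h1, h2⟩ c
    refine ⟨fun x y h => h1 _ _ (sigmaGraph_adj.2 ⟨y, rfl, h⟩), fun x hx => ?_⟩
    have := h2 ⟨c, x⟩
    rw [pdeg_sigmaGraph] at this
    exact this hx
  · intro h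
    refine ⟨?_, ?_⟩
    · rintro ⟨c, x⟩ q hq
      obtain ⟨y, rfl, hxy⟩ := sigmaGraph_adj.1 hq
      exact (h c).1 x y hxy
    · rintro ⟨c, x⟩ hx
      rw [pdeg_sigmaGraph] at hx ⊢
      exact (h c).2 x hx

theorem numPresent_sigmaGraph (R : ℕ) (H : ∀ c, SimpleGraph (T c)) (G : SimpleGraph (Fin n)) :
    numPresent R (sigmaGraph H) G = Nat.card {g : ∀ c, T c ↪ Fin n //
      (∀ c, Present R (H c) (g c) G) ∧ ∀ c c', c ≠ c' → Disjoint (cls (g c)) (cls (g c'))} := by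
  rw [← card_filter_eq_natCard]
  unfold numPresent
  refine Finset.card_bij (fun Φ _ c => (Function.Embedding.sigmaMk c).trans Φ) ?_ ?_ ?_
  · intro Φ hΦ
    rw [Finset.mem_filter] at hΦ ⊢
    refine ⟨Finset.mem_univ _, present_sigmaGraph.1 hΦ.2, ?_⟩
    intro c c' hne
    rw [Finset.disjoint_left]
    intro v hv hv'
    obtain ⟨x, rfl⟩ := mem_cls.1 hv
    obtain ⟨y, hy⟩ := mem_cls.1 hv'
    exact hne (congrArg Sigma.fst (Φ.injective hy)).symm
  · intro Φ _ Ψ _ h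
    ext ⟨c, x⟩
    have := DFunLike.congr_fun (congrFun h c) x
    exact congrArg Fin.val this
  · intro g hg
    rw [Finset.mem_filter] at hg
    obtain ⟨-, h1, h2⟩ := hg
    refine ⟨⟨fun p => g p.1 p.2, ?_⟩, ?_, ?_⟩
    · rintro ⟨c, x⟩ ⟨c', x'⟩ h
      simp only at h
      by_cases hc : c = c'
      · subst hc
        rw [(g c).injective h]
      · exfalso
        refine Finset.disjoint_left.1 (h2 c c' hc) (apply_mem_cls x) ?_
        rw [h]
        exact apply_mem_cls x'
    · rw [Finset.mem_filter]
      exact ⟨Finset.mem_univ _, present_sigmaGraph.2 h1⟩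
    · rfl

end SigmaPattern

end

/-! ### Joint factorial moments and Poisson limits for families of patterns -/

section

variable {n : ℕ}

/-- The number of vertex sets of occurrences of the pattern `H` in `G`. -/
def numCls {T : Type*} [Fintype T] (R : ℕ) (H : SimpleGraph T) (G : SimpleGraph (Fin n)) : ℕ :=
  ((Finset.univ.filter (fun φ : T ↪ Fin n => Present R H φ G)).image cls).card

theorem natCard_sigma {ι : Type*} [Fintype ι] {β : ι → Type*} {E : ι → Type*}
    (P : (∀ c : (Σ i, β i), E c.1) → Prop) (Q : ∀ i, (β i → E i) → Prop)
    (h : ∀ g, P g ↔ ∀ i, Q i (fun j => g ⟨i, j⟩)) :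
    Nat.card {g // P g} = ∏ i, Nat.card {f // Q i f} := by
  rw [← Nat.card_pi]
  refine Nat.card_congr ⟨fun g i => ⟨fun j => g.1 ⟨i, j⟩, (h g.1).1 g.2 i⟩,
    fun f => ⟨fun c => (f c.1).1 c.2, (h _).2 fun i => (f i).2⟩, fun _ => rfl, fun _ => rfl⟩

section Family

variable {ι : Type*} {T : ι → Type*} [∀ i, Fintype (T i)] {H : ∀ i, SimpleGraph (T i)}
  {s : Finset ι} {R K : ℕ}

/-- The patterns `H i`, `i ∈ s`, are connected, and they are told apart by their degrees. -/
structure IsPatternFamily (H : ∀ i, SimpleGraph (T i)) (s : Finset ι) : Prop where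
  nonempty : ∀ i ∈ s, Nonempty (T i)
  preconnected : ∀ i ∈ s, (H i).Preconnected
  pdeg_le : ∀ i ∈ s, ∀ x, pdeg (H i) x ≤ 2
  eq_of_equiv : ∀ i ∈ s, ∀ j ∈ s, ∀ e : T i ≃ T j, (∀ x, pdeg (H j) (e x) = pdeg (H i) x) → i = j

/-- At every vertex of a copy the pattern degree is 2 minus the deficiency, hence determined by the
graph. Two patterns with the same image therefore have a degree-preserving bijection. -/
theorem IsPatternFamily.eq_of_cls_eq (hH : IsPatternFamily H s) {G : SimpleGraph (Fin n)}
    (hG : ¬ Bad R K G) {i j : ι} (hi : i ∈ s) (hj : j ∈ s)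
    (hK : Fintype.card (T i) + Fintype.card (T j) ≤ K) {φ : T i ↪ Fin n} {ψ : T j ↪ Fin n}
    (hφ : Present R (H i) φ G) (hψ : Present R (H j) ψ G) (h : cls φ = cls ψ) : i = j := by
  have h1 : ∀ x, ∃ y, ψ y = φ x := fun x => mem_cls.1 (h ▸ apply_mem_cls x)
  choose f hf using h1
  have hf' : Function.Bijective f := by
    constructor
    · intro x y hxy
      apply φ.injective
      rw [← hf, ← hf, hxy]
    · intro y
      obtain ⟨x, hx⟩ := mem_cls.1 (h.symm ▸ apply_mem_cls y : ψ y ∈ cls φ)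
      refine ⟨x, ψ.injective ?_⟩
      rw [hf, hx]
  refine hH.eq_of_equiv i hi j hj (Equiv.ofBijective f hf') fun x => ?_
  have h2 := (hφ.inNbr_eq hG hψ hK x).2
  have h3 := (hψ.inNbr_eq hG hφ (by omega) (f x)).2
  rw [hf] at h3
  show pdeg (H j) (f x) = _
  omega

/-- An embedding of the disjoint union of a i copies of each H i is a tuple of occurrences with
disjoint images. Distinct images are automatically disjoint, also across different patterns, so the
count factorises. -/
theorem IsPatternFamily.numPresent_eq (hH : IsPatternFamily H s) {G : SimpleGraph (Fin n)}
    (hG : ¬ Bad R K G) (hK : ∀ i ∈ s, ∀ j ∈ s, Fintype.card (T i) + Fintype.card (T j) ≤ K)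
    (a : ι → ℕ) :
    numPresent R (sigmaGraph (fun c : (Σ i : s, Fin (a i)) => H c.1)) G =
      ∏ i ∈ s, (numCls R (H i) G).descFactorial (a i) * Nat.card (H i ≃g H i) ^ a i := by
  rw [numPresent_sigmaGraph]
  refine (natCard_sigma (ι := s) (β := fun i => Fin (a i)) (E := fun i => T i ↪ Fin n)
    (fun g => (∀ c, Present R (H c.1) (g c) G) ∧
      ∀ c c', c ≠ c' → Disjoint (cls (g c)) (cls (g c')))
    (fun i h => (∀ j, h j ∈ Finset.univ.filter (fun φ : T i ↪ Fin n => Present R (H i) φ G)) ∧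
      Function.Injective (fun j => cls (h j))) ?_).trans ?_
  rotate_left
  · rw [← Finset.prod_coe_sort s (fun i => (numCls R (H i) G).descFactorial (a i) *
      Nat.card (H i ≃g H i) ^ a i)]
    refine Finset.prod_congr rfl fun i _ => ?_
    rw [card_functions_injective_comp _ cls (α := Nat.card (H i ≃g H i))]
    · unfold numCls
      congr!
    · intro φ hφ
      convert (Finset.mem_filter.1 hφ).2.card_filter_cls_eq hG (hK i i.2 i i.2)
  · intro g
    constructor
    · rintro ⟨h1, h2⟩ i
      refine ⟨fun j => Finset.mem_filter.2 ⟨Finset.mem_univ _, h1 ⟨i, j⟩⟩, ?_⟩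
      intro j j' hjj
      by_contra hne
      obtain ⟨x⟩ := hH.nonempty i i.2
      have hd := h2 ⟨i, j⟩ ⟨i, j'⟩ fun h => hne (eq_of_heq (Sigma.mk.inj h).2)
      refine Finset.disjoint_left.1 hd (apply_mem_cls x) ?_
      simp only at hjj
      rw [← hjj]
      exact apply_mem_cls x
    · intro h
      have hp : ∀ (i : s) (j : Fin (a i)), Present R (H i) (g ⟨i, j⟩) G := fun i j =>
        (Finset.mem_filter.1 ((h i).1 j)).2
      refine ⟨fun c => hp c.1 c.2, ?_⟩
      rintro ⟨i, j⟩ ⟨i', j'⟩ hne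
      by_contra hd
      have hc := (hp i j).cls_eq hG (hp i' j') (hK i i.2 i' i'.2)
        (hH.preconnected i i.2) (hH.preconnected i' i'.2) hd
      have hi : i = i' := Subtype.ext (hH.eq_of_cls_eq hG i.2 i'.2 (hK i i.2 i' i'.2)
        (hp i j) (hp i' j') hc)
      subst hi
      exact hne (congrArg _ ((h i).2 hc))

/-- The expected number of copies of the disjoint union tends to R - 1 raised to its total number of
vertices; dividing by the automorphisms of the parts gives the factorial moments of independent
Poisson variables. -/
theorem IsPatternFamily.tendsto_avg (hH : IsPatternFamily H s) (hR : 0 < R)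
    (hK : ∀ i ∈ s, ∀ j ∈ s, Fintype.card (T i) + Fintype.card (T j) ≤ K) (a : ι → ℕ) :
    Tendsto (fun n => avg n R (fun G => if ¬ Bad R K G then
      ∏ i ∈ s, ((numCls R (H i) G).descFactorial (a i) : ℝ) else 0)) atTop
      (𝓝 (∏ i ∈ s, (((R : ℝ) - 1) ^ Fintype.card (T i) / Nat.card (H i ≃g H i)) ^ a i)) := by
  have h1 := tendsto_avg_numPresent_good hR (H := sigmaGraph (fun c : (Σ i : s, Fin (a i)) => H c.1))
    (by
      rintro ⟨c, x⟩
      rw [pdeg_sigmaGraph]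
      exact hH.pdeg_le _ c.1.2 x) K
  have h2 : ∀ i ∈ s, (Nat.card (H i ≃g H i) : ℝ) ≠ 0 := by
    intro i _
    have : Finite (H i ≃g H i) := Finite.of_injective (fun σ => (σ : T i → T i))
      DFunLike.coe_injective
    have h3 : 0 < Nat.card (H i ≃g H i) := Nat.card_pos_iff.2 ⟨⟨SimpleGraph.Iso.refl⟩, this⟩
    exact_mod_cast h3.ne'
  have h3 := h1.div_const (∏ i ∈ s, (Nat.card (H i ≃g H i) : ℝ) ^ a i)
  have h4 : ∏ i ∈ s, (Nat.card (H i ≃g H i) : ℝ) ^ a i ≠ 0 :=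
    Finset.prod_ne_zero_iff.2 fun i hi => pow_ne_zero _ (h2 i hi)
  convert h3 using 1
  · funext n
    rw [div_eq_inv_mul, ← avg_mul_left]
    apply avg_congr
    intro G _
    split_ifs with hG
    · rw [mul_zero]
    · rw [hH.numPresent_eq hG hK]
      push_cast
      rw [Finset.prod_mul_distrib]
      field_simp
  · congr 1
    have h5 : Fintype.card (Σ c : (Σ i : s, Fin (a i)), T c.1) =
        ∑ i : s, a i * Fintype.card (T i) := by
      rw [Fintype.card_sigma, Fintype.sum_sigma]
      refine Finset.sum_congr rfl fun i _ => ?_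
      show ∑ _j : Fin (a i), Fintype.card (T i) = _
      rw [Finset.sum_const, Finset.card_univ, Fintype.card_fin, smul_eq_mul]
    rw [h5, Finset.sum_coe_sort s (fun i => a i * Fintype.card (T i)), ← Finset.prod_pow_eq_pow_sum,
      ← Finset.prod_div_distrib]
    refine Finset.prod_congr rfl fun i _ => ?_
    rw [div_pow, ← pow_mul, mul_comm]

theorem Bad.mono {L : ℕ} {G : SimpleGraph (Fin n)} (h : Bad R K G) (hKL : K ≤ L) : Bad R L G :=
  let ⟨V, hV, hd⟩ := h
  ⟨V, hV.trans hKL, hd⟩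

/-- The numbers of occurrences of patterns are asymptotically independent Poisson variables. -/
theorem IsPatternFamily.tendsto_prob (hH : IsPatternFamily H s) (hR : 0 < R)
    (X : ∀ n, SimpleGraph (Fin n) → ι → ℕ)
    (hX : ∀ n, ∀ G ∈ graphs n R, ¬ Bad R K G → ∀ i ∈ s, X n G i = numCls R (H i) G)
    (x : ι → ℕ) :
    Tendsto (fun n => prob n R (fun G => ∀ i ∈ s, X n G i = x i)) atTop
      (𝓝 (∏ i ∈ s, poissonMass (((R : ℝ) - 1) ^ Fintype.card (T i) / Nat.card (H i ≃g H i))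
        (x i))) := by
  -- The bound is enlarged so that two occurrences fit together below it; being at least K, it still
  -- guarantees that `X` agrees with the number of copies.
  set L := K + 2 * s.sup (fun i => Fintype.card (T i)) with hL
  have hL' : ∀ i ∈ s, ∀ j ∈ s, Fintype.card (T i) + Fintype.card (T j) ≤ L := by
    intro i hi j hj
    have h1 := Finset.le_sup (f := fun i => Fintype.card (T i)) hi
    have h2 := Finset.le_sup (f := fun i => Fintype.card (T i)) hj
    omega
  have key := tendsto_sum_prod_indicator (Ω := fun n => SimpleGraph (Fin n)) s
    (fun i => ((R : ℝ) - 1) ^ Fintype.card (T i) / Nat.card (H i ≃g H i)) x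
    (X := fun n G i => numCls R (H i) G)
    (w := fun n G => if G ∈ graphs n R then
      (if ¬ Bad R L G then 1 else 0) / ((graphs n R).ncard : ℝ) else 0) (c := 1)
    (by
      intro n G
      split_ifs <;> positivity)
    (by
      intro a
      rw [one_mul]
      refine (hH.tendsto_avg hR hL' a).congr fun n => ?_
      unfold avg
      rw [Finset.sum_div, Finset.sum_filter]
      refine Finset.sum_congr rfl fun G _ => ?_
      split_ifs <;> simp [div_eq_inv_mul])
  rw [one_mul] at key
  have key2 : Tendsto (fun n => prob n R (fun G => ¬ Bad R L G ∧ ∀ i ∈ s, X n G i = x i)) atTop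
      (𝓝 (∏ i ∈ s, poissonMass (((R : ℝ) - 1) ^ Fintype.card (T i) / Nat.card (H i ≃g H i))
        (x i))) := by
    refine key.congr fun n => ?_
    unfold prob avg
    rw [Finset.sum_div, Finset.sum_filter]
    refine Finset.sum_congr rfl fun G _ => ?_
    by_cases hG : G ∈ graphs n R
    · by_cases hB : Bad R L G
      · simp [hB]
      · have h1 : ∀ i ∈ s, numCls R (H i) G = X n G i := fun i hi =>
          (hX n G hG (fun h => hB (h.mono (Nat.le_add_right _ _))) i hi).symm
        rw [Finset.prod_ite_zero, Finset.prod_const_one]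
        by_cases h2 : ∀ i ∈ s, X n G i = x i
        · have h3 : ∀ i ∈ s, numCls R (H i) G = x i := fun i hi => (h1 i hi).trans (h2 i hi)
          simp only [if_pos hG, if_pos hB, if_pos h3, if_pos (And.intro hB h2)]
          ring
        · have h3 : ¬ ∀ i ∈ s, numCls R (H i) G = x i := fun h =>
            h2 fun i hi => (h1 i hi).symm.trans (h i hi)
          have h4 : ¬ (¬ Bad R L G ∧ ∀ i ∈ s, X n G i = x i) := fun h => h2 h.2
          simp only [if_pos hG, if_pos hB, if_neg h3, if_neg h4]
          ring
    · simp [hG]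
  have key3 := key2.add (tendsto_prob_bad hR L)
  rw [add_zero] at key3
  -- The moments only see graphs that are not `Bad`; the others have vanishing probability.
  refine tendsto_of_tendsto_of_tendsto_of_le_of_le key2 key3 (fun n => ?_) (fun n => ?_)
  · exact prob_mono fun G _ h => h.2
  · refine prob_le_add fun G _ h => ?_
    by_cases hB : Bad R L G
    · exact Or.inr hB
    · exact Or.inl ⟨hB, h⟩

end Family

end

/-! ### Cycle and path patterns and their automorphism groups -/

section

theorem pdeg_eq_degree {T : Type*} [Fintype T] (H : SimpleGraph T) (x : T)
    [Fintype (H.neighborSet x)] : pdeg H x = H.degree x := by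
  unfold pdeg
  rw [← SimpleGraph.card_neighborFinset_eq_degree]
  congr 1
  ext y
  simp

theorem pdeg_cycleGraph {p : ℕ} (hp : 3 ≤ p) (x : Fin p) :
    pdeg (SimpleGraph.cycleGraph p) x = 2 := by
  obtain ⟨m, rfl⟩ := Nat.exists_eq_add_of_le' hp
  rw [pdeg_eq_degree, SimpleGraph.cycleGraph_degree_three_le]

theorem card_filter_val_eq (m c : ℕ) :
    (Finset.univ.filter (fun y : Fin m => y.val = c)).card = if c < m then 1 else 0 := by
  split_ifs with h
  · rw [Finset.card_eq_one]
    refine ⟨⟨c, h⟩, ?_⟩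
    ext y
    simp [Fin.ext_iff]
  · rw [Finset.card_eq_zero, Finset.filter_eq_empty_iff]
    intro y _
    omega

theorem pdeg_pathGraph {p : ℕ} (x : Fin (p + 1)) :
    pdeg (SimpleGraph.pathGraph (p + 1)) x =
      (if x.val = 0 then 0 else 1) + (if x.val = p then 0 else 1) := by
  have h1 : Finset.univ.filter (fun y => (SimpleGraph.pathGraph (p + 1)).Adj x y) =
      Finset.univ.filter (fun y : Fin (p + 1) => x.val ≠ 0 ∧ y.val = x.val - 1) ∪
      Finset.univ.filter (fun y : Fin (p + 1) => y.val = x.val + 1) := by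
    ext y
    simp only [SimpleGraph.pathGraph_adj, Finset.mem_union, Finset.mem_filter, Finset.mem_univ,
      true_and]
    omega
  unfold pdeg
  rw [h1, Finset.card_union_of_disjoint]
  · rw [card_filter_val_eq]
    have hx := x.isLt
    congr 1
    · split_ifs with h
      · simp [h]
      · simp only [h, ne_eq, not_false_eq_true, true_and]
        rw [card_filter_val_eq, if_pos (by omega)]
    · split_ifs <;> omega
  · rw [Finset.disjoint_filter]
    intro y _ h h'
    omega

theorem pdeg_pathGraph_zero_le (p : ℕ) : pdeg (SimpleGraph.pathGraph (p + 1)) 0 ≤ 1 := by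
  refine (pdeg_pathGraph 0).trans_le ?_
  rw [if_pos (Fin.val_zero _), zero_add]
  split_ifs <;> simp

/-- The 2p automorphisms are the maps x ↦ a + x and x ↦ a - x. There are no others: the images of 0
and 1 determine the rest, since each vertex has only one neighbour besides its predecessor. The
bound p ≥ 3 gives 1 ≠ -1. -/
theorem card_iso_cycleGraph {p : ℕ} (hp : 3 ≤ p) :
    Nat.card (SimpleGraph.cycleGraph p ≃g SimpleGraph.cycleGraph p) = 2 * p := by
  obtain ⟨m, rfl⟩ := Nat.exists_eq_add_of_le' hp
  have h2 : (1 : Fin (m + 3)) ≠ -1 := by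
    intro h
    have h3 : (1 : Fin (m + 3)) + 1 = 0 := by
      nth_rw 1 [h]
      exact neg_add_cancel 1
    have h4 := congrArg Fin.val h3
    rw [Fin.val_add, Fin.val_one, Nat.mod_eq_of_lt (by omega)] at h4
    exact two_ne_zero h4
  set F : Fin (m + 3) × Bool →
      (SimpleGraph.cycleGraph (m + 3) ≃g SimpleGraph.cycleGraph (m + 3)) := fun q =>
    if q.2 then ⟨Equiv.addLeft q.1, by
      intro x y
      simp [SimpleGraph.cycleGraph_adj]⟩
    else ⟨Equiv.subLeft q.1, by
      intro x y
      simp only [SimpleGraph.cycleGraph_adj, Equiv.subLeft_apply, sub_sub_sub_cancel_left]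
      exact or_comm⟩ with hF
  have hF0 : ∀ q, F q 0 = q.1 := by
    rintro ⟨a, b⟩
    cases b
    · exact sub_zero a
    · exact add_zero a
  have hF1 : ∀ q, F q 1 = if q.2 then q.1 + 1 else q.1 - 1 := by
    rintro ⟨a, b⟩
    cases b <;> rfl
  have hinj : Function.Injective F := by
    rintro ⟨a, b⟩ ⟨a', b'⟩ h
    have h0 : a = a' := (hF0 (a, b)).symm.trans ((DFunLike.congr_fun h 0).trans (hF0 (a', b')))
    subst h0
    have h1 : F (a, b) 1 = F (a, b') 1 := by rw [h]
    rw [hF1, hF1] at h1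
    cases b <;> cases b' <;> simp [sub_eq_add_neg] at h1 ⊢
    · exact h2 h1.symm
    · exact h2 h1
  have hnb : ∀ v u w w' : Fin (m + 3), (SimpleGraph.cycleGraph (m + 3)).Adj v u →
      (SimpleGraph.cycleGraph (m + 3)).Adj v w → (SimpleGraph.cycleGraph (m + 3)).Adj v w' →
      w ≠ u → w' ≠ u → w = w' := by
    intro v u w w' h h' h'' hw hw'
    rw [← SimpleGraph.mem_neighborSet, SimpleGraph.cycleGraph_neighborSet] at h h' h''
    simp only [Set.mem_insert_iff, Set.mem_singleton_iff] at h h' h''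
    grind
  have hadj : ∀ x : Fin (m + 3), (SimpleGraph.cycleGraph (m + 3)).Adj x (x + 1) := by
    intro x
    rw [SimpleGraph.cycleGraph_adj]
    right
    exact add_sub_cancel_left x 1
  have hext : ∀ σ τ : SimpleGraph.cycleGraph (m + 3) ≃g SimpleGraph.cycleGraph (m + 3),
      σ 0 = τ 0 → σ 1 = τ 1 → σ = τ := by
    intro σ τ h h'
    have key : ∀ x : Fin (m + 3), σ x = τ x ∧ σ (x + 1) = τ (x + 1) := by
      intro x
      induction x using Fin.induction with
      | zero => exact ⟨h, by rwa [zero_add]⟩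
      | succ i ih =>
        rw [Fin.coeSucc_eq_succ] at ih
        refine ⟨ih.2, ?_⟩
        have hne : i.succ + 1 ≠ i.castSucc := by
          intro hh
          rw [← Fin.coeSucc_eq_succ (a := i)] at hh
          have h3 : i.castSucc + ((1 : Fin (m + 3)) + 1) = i.castSucc := (add_assoc _ _ _).symm.trans hh
          exact h2 (eq_neg_of_add_eq_zero_left (left_eq_add.1 h3.symm))
        have hadj' : (SimpleGraph.cycleGraph (m + 3)).Adj i.succ i.castSucc := by
          have := (hadj i.castSucc).symm
          rwa [Fin.coeSucc_eq_succ] at this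
        refine hnb (σ i.succ) (σ i.castSucc) _ _ (σ.map_rel_iff.2 hadj')
          (σ.map_rel_iff.2 (hadj _)) ?_ ?_ ?_
        · rw [ih.2]
          exact τ.map_rel_iff.2 (hadj _)
        · exact fun hh => hne (σ.injective hh)
        · rw [ih.1]
          exact fun hh => hne (τ.injective hh)
    ext x
    rw [(key x).1]
  have hsurj : Function.Surjective F := by
    intro σ
    have h1 := σ.map_rel_iff.2 (hadj 0)
    rw [zero_add, SimpleGraph.cycleGraph_adj] at h1
    rcases h1 with h1 | h1
    · refine ⟨(σ 0, false), hext _ _ (hF0 _) ?_⟩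
      rw [hF1]
      simp only [Bool.false_eq_true, if_false]
      exact sub_eq_of_eq_add' ((sub_eq_iff_eq_add.1 h1).trans rfl)
    · refine ⟨(σ 0, true), hext _ _ (hF0 _) ?_⟩
      rw [hF1]
      simp only [if_true]
      exact (sub_eq_iff_eq_add'.1 h1).symm
  rw [← Nat.card_congr (Equiv.ofBijective F ⟨hinj, hsurj⟩)]
  simp [mul_comm]

/-- An automorphism preserves degrees, so it sends 0 to an end, and the image of 0 determines it by
walking along the path. -/
theorem card_iso_pathGraph {p : ℕ} (hp : 1 ≤ p) :
    Nat.card (SimpleGraph.pathGraph (p + 1) ≃g SimpleGraph.pathGraph (p + 1)) = 2 := by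
  set F : Bool → (SimpleGraph.pathGraph (p + 1) ≃g SimpleGraph.pathGraph (p + 1)) := fun b =>
    if b then SimpleGraph.Iso.refl else ⟨Fin.revPerm, by
      intro x y
      simp only [SimpleGraph.pathGraph_adj, Fin.revPerm_apply, Fin.val_rev]
      omega⟩ with hF
  have hF0 : ∀ b, (F b 0).val = if b then 0 else p := by
    intro b
    cases b <;> simp [hF]
  have hinj : Function.Injective F := by
    intro b b' h
    have h1 := hF0 b
    rw [h, hF0 b'] at h1
    cases b <;> cases b' <;> simp at h1 ⊢ <;> omega
  have hext : ∀ σ τ : SimpleGraph.pathGraph (p + 1) ≃g SimpleGraph.pathGraph (p + 1),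
      σ 0 = τ 0 → (σ 0).val = 0 ∨ (σ 0).val = p → σ = τ := by
    intro σ τ h h0
    have key : ∀ i : ℕ, ∀ hi : i < p + 1, σ ⟨i, hi⟩ = τ ⟨i, hi⟩ := by
      intro i
      induction i using Nat.strong_induction_on with
      | _ i ih =>
        intro hi
        match i, ih, hi with
        | 0, _, _ => exact h
        | 1, ih, hi =>
          have ha : (SimpleGraph.pathGraph (p + 1)).Adj 0 ⟨1, hi⟩ := by
            simp [SimpleGraph.pathGraph_adj]
          have h1 := σ.map_rel_iff.2 ha
          have h2 := τ.map_rel_iff.2 ha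
          rw [SimpleGraph.pathGraph_adj] at h1 h2
          rw [← h] at h2
          apply Fin.ext
          omega
        | i + 2, ih, hi =>
          have ha : (SimpleGraph.pathGraph (p + 1)).Adj ⟨i + 1, by omega⟩ ⟨i + 2, hi⟩ := by
            simp [SimpleGraph.pathGraph_adj]
          have ha' : (SimpleGraph.pathGraph (p + 1)).Adj ⟨i, by omega⟩ ⟨i + 1, by omega⟩ := by
            simp [SimpleGraph.pathGraph_adj]
          have h1 := σ.map_rel_iff.2 ha
          have h2 := τ.map_rel_iff.2 ha
          have h3 := σ.map_rel_iff.2 ha'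
          have h4 : σ ⟨i, by omega⟩ ≠ σ ⟨i + 2, hi⟩ := fun hh => by
            simpa using σ.injective hh
          have h5 : τ ⟨i, by omega⟩ ≠ τ ⟨i + 2, hi⟩ := fun hh => by
            simpa using τ.injective hh
          have h6 := ih i (by omega) (by omega)
          have h7 := ih (i + 1) (by omega) (by omega)
          rw [← h7] at h2
          rw [← h6] at h5
          rw [SimpleGraph.pathGraph_adj] at h1 h2 h3
          rw [ne_eq, Fin.ext_iff] at h4 h5
          apply Fin.ext
          omega
    ext x
    rw [key x.val x.isLt]
  have hsurj : Function.Surjective F := by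
    intro σ
    have h1 := pdeg_iso σ 0
    have h2 : (σ 0).val = 0 ∨ (σ 0).val = p := by
      by_contra! h
      have h3 := pdeg_pathGraph_zero_le p
      rw [← h1, pdeg_pathGraph, if_neg h.1, if_neg h.2] at h3
      omega
    rcases h2 with h2 | h2
    · have h3 := hF0 true
      exact ⟨true, hext _ _ (Fin.ext (by rw [h3, h2]; rfl)) (Or.inl h3)⟩
    · have h3 := hF0 false
      exact ⟨false, hext _ _ (Fin.ext (by rw [h3, h2]; rfl)) (Or.inr h3)⟩
  rw [← Nat.card_congr (Equiv.ofBijective F ⟨hinj, hsurj⟩)]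
  simp

theorem card_iso_pathGraph_one :
    Nat.card (SimpleGraph.pathGraph 1 ≃g SimpleGraph.pathGraph 1) = 1 := by
  rw [Nat.card_eq_one_iff_unique]
  refine ⟨⟨fun σ τ => ?_⟩, ⟨SimpleGraph.Iso.refl⟩⟩
  ext x
  rw [Subsingleton.elim (σ x) (τ x)]

/-- The number of vertices of a pattern. -/
def patternOrder : ℕ ⊕ ℕ → ℕ
  | Sum.inl p => p
  | Sum.inr p => p + 1

/-- The patterns to be counted: the cycles with `p` edges and the paths with `p` edges. -/
def pattern : ∀ i : ℕ ⊕ ℕ, SimpleGraph (Fin (patternOrder i))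
  | Sum.inl p => SimpleGraph.cycleGraph p
  | Sum.inr p => SimpleGraph.pathGraph (p + 1)

theorem isPatternFamily_pattern {s : Finset (ℕ ⊕ ℕ)} (hs : ∀ p, Sum.inl p ∈ s → 3 ≤ p) :
    IsPatternFamily pattern s := by
  refine ⟨?_, ?_, ?_, ?_⟩
  · rintro (p | p) hi
    · have := hs p hi
      exact ⟨⟨0, by show 0 < p; omega⟩⟩
    · exact ⟨⟨0, Nat.succ_pos p⟩⟩
  · rintro (p | p) _
    · exact SimpleGraph.cycleGraph_preconnected
    · exact SimpleGraph.pathGraph_preconnected _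
  · rintro (p | p) hi x
    · exact (pdeg_cycleGraph (hs p hi) x).le
    · refine (pdeg_pathGraph x).trans_le ?_
      split_ifs <;> simp
  -- A path has a vertex of degree at most 1 and a cycle has none; within each kind the number of
  -- vertices decides.
  · have main : ∀ p q : ℕ, 3 ≤ p → ∀ e : Fin p ≃ Fin (q + 1),
        (∀ x, pdeg (SimpleGraph.pathGraph (q + 1)) (e x) = 2) → False := by
      intro p q hp e h
      have h1 := h (e.symm 0)
      rw [e.apply_symm_apply] at h1
      have h2 := pdeg_pathGraph_zero_le q
      omega
    rintro (p | p) hi (q | q) hj e he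
    · exact congrArg _ (Fin.equiv_iff_eq.1 ⟨e⟩ : p = q)
    · exact (main p q (hs p hi) e fun x => (he x).trans (pdeg_cycleGraph (hs p hi) x)).elim
    · refine (main q p (hs q hj) e.symm fun x => ?_).elim
      exact (he (e.symm x)).symm.trans (pdeg_cycleGraph (hs q hj) _)
    · exact congrArg _ (Nat.succ_injective (Fin.equiv_iff_eq.1 ⟨e⟩ : p + 1 = q + 1))

end

/-! ### Cycles, paths and vertices of degree R - 2 as pattern occurrences -/

section

variable {n : ℕ}

section Occurrences

variable {T : Type*} [Fintype T] {R K : ℕ} {G : SimpleGraph (Fin n)} {H : SimpleGraph T}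

/-- In a graph without small dense sets, a subgraph containing an occurrence of a pattern and
having the same vertices is induced. -/
theorem Present.eq_induce (hG : ¬ Bad R K G) {φ : T ↪ Fin n} (hφ : Present R H φ G)
    (hK : Fintype.card T + Fintype.card T ≤ K) {S : G.Subgraph}
    (hS : ∀ x y, H.Adj x y → S.Adj (φ x) (φ y)) (hv : S.verts = cls φ) :
    S = (⊤ : G.Subgraph).induce (cls φ : Finset (Fin n)) := by
  apply le_antisymm
  · rw [← hv]
    exact SimpleGraph.Subgraph.le_induce_top_verts
  · refine ⟨?_, ?_⟩
    · rw [hv]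
      rfl
    · rintro a b ⟨ha, hb, hab⟩
      obtain ⟨x, rfl⟩ := mem_cls.1 (Finset.mem_coe.1 ha)
      obtain ⟨y, rfl⟩ := mem_cls.1 (Finset.mem_coe.1 hb)
      exact hS x y ((hφ.adj_iff hG hK).1 hab)

/-- If the subgraphs to be counted are exactly the ones induced on images of occurrences, they
correspond to those vertex sets. -/
theorem ncard_eq_numCls {𝒮 : Set G.Subgraph}
    (h₁ : ∀ S ∈ 𝒮, ∃ φ : T ↪ Fin n, Present R H φ G ∧
      S = (⊤ : G.Subgraph).induce (cls φ : Finset (Fin n)))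
    (h₂ : ∀ φ : T ↪ Fin n, Present R H φ G →
      (⊤ : G.Subgraph).induce (cls φ : Finset (Fin n)) ∈ 𝒮) : 𝒮.ncard = numCls R H G := by
  have h : 𝒮 = (fun V : Finset (Fin n) => (⊤ : G.Subgraph).induce (V : Set (Fin n))) ''
      ((Finset.univ.filter (fun φ : T ↪ Fin n => Present R H φ G)).image cls : Finset _) := by
    ext S
    simp only [Finset.coe_image, Finset.coe_filter, Finset.mem_univ, true_and, Set.mem_image,
      Set.mem_ofPred_eq, exists_exists_and_eq_and]
    constructor
    · intro hS
      obtain ⟨φ, hφ, rfl⟩ := h₁ S hS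
      exact ⟨φ, hφ, rfl⟩
    · rintro ⟨φ, hφ, rfl⟩
      exact h₂ φ hφ
  rw [h, Set.ncard_image_of_injective, Set.ncard_coe_finset]
  · unfold numCls
    congr!
  · intro V W hVW
    have := congrArg SimpleGraph.Subgraph.verts hVW
    exact Finset.coe_injective this

end Occurrences

section Cycles

variable {R K : ℕ} {G : SimpleGraph (Fin n)}

theorem exists_embedding_of_isCycle {p : ℕ} {v : Fin n} {c : G.Walk v v} (hc : c.IsCycle)
    (hp : c.length = p) : ∃ φ : Fin p ↪ Fin n,
      (∀ x y, (SimpleGraph.cycleGraph p).Adj x y → c.toSubgraph.Adj (φ x) (φ y)) ∧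
      c.toSubgraph.verts = cls φ := by
  have h3 := hc.three_le_length
  refine ⟨⟨fun i => c.getVert i, ?_⟩, ?_, ?_⟩
  · intro i j hij
    have hi := i.isLt
    have hj := j.isLt
    exact Fin.ext (hc.getVert_injOn' (by rw [Set.mem_ofPred_eq]; omega)
      (by rw [Set.mem_ofPred_eq]; omega) hij)
  · have key : ∀ x y : Fin p, (y - x).val = 1 →
        c.toSubgraph.Adj (c.getVert x) (c.getVert y) := by
      intro x y hxy
      have hx := x.isLt
      have hy := y.isLt
      rcases le_or_gt x y with h | h
      · rw [Fin.coe_sub_iff_le.2 h] at hxy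
        have := c.toSubgraph_adj_getVert (i := x) (by omega)
        rwa [show x.val + 1 = y.val by omega] at this
      · rw [Fin.coe_sub_iff_lt.2 h] at hxy
        have h0 : y.val = 0 := by
          have : y.val < x.val := h
          omega
        have := c.toSubgraph_adj_getVert (i := x) (by omega)
        rw [show x.val + 1 = c.length by omega, c.getVert_length] at this
        rwa [h0, c.getVert_zero]
    intro x y hxy
    rcases SimpleGraph.cycleGraph_adj'.1 hxy with h | h
    · exact (key y x h).symm
    · exact key x y h
  · ext w
    rw [SimpleGraph.Walk.mem_verts_toSubgraph, SimpleGraph.Walk.mem_support_iff_exists_getVert,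
      Finset.mem_coe, mem_cls]
    constructor
    · rintro ⟨i, rfl, hi⟩
      rcases hi.lt_or_eq with hi | rfl
      · exact ⟨⟨i, hp ▸ hi⟩, rfl⟩
      · refine ⟨⟨0, by omega⟩, ?_⟩
        show c.getVert 0 = _
        rw [c.getVert_zero, c.getVert_length]
    · rintro ⟨i, rfl⟩
      exact ⟨i, rfl, by have := i.isLt; omega⟩

theorem present_cycleGraph {p : ℕ} (hp : 3 ≤ p) {φ : Fin p ↪ Fin n} :
    Present R (SimpleGraph.cycleGraph p) φ G ↔
      ∀ x y, (SimpleGraph.cycleGraph p).Adj x y → G.Adj (φ x) (φ y) := by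
  refine ⟨fun h => h.1, fun h => ⟨h, fun x hx => ?_⟩⟩
  rw [pdeg_cycleGraph hp] at hx
  omega

theorem numCycles_eq_numCls (hG : ¬ Bad R K G) {p : ℕ} (hp : 3 ≤ p) (hK : p + p ≤ K) :
    numCycles G p = numCls R (SimpleGraph.cycleGraph p) G := by
  have hK' : Fintype.card (Fin p) + Fintype.card (Fin p) ≤ K := by rwa [Fintype.card_fin]
  have main : ∀ (v : Fin n) (c : G.Walk v v), c.IsCycle → c.length = p →
      ∃ φ : Fin p ↪ Fin n, Present R (SimpleGraph.cycleGraph p) φ G ∧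
        c.toSubgraph.verts = cls φ ∧
        c.toSubgraph = (⊤ : G.Subgraph).induce (cls φ : Finset (Fin n)) := by
    intro v c hc hl
    obtain ⟨φ, h1, h2⟩ := exists_embedding_of_isCycle hc hl
    have hφ : Present R (SimpleGraph.cycleGraph p) φ G :=
      (present_cycleGraph hp).2 fun x y h => (h1 x y h).adj_sub
    exact ⟨φ, hφ, h2, hφ.eq_induce hG hK' h1 h2⟩
  apply ncard_eq_numCls
  · rintro _ ⟨v, c, hc, hl, rfl⟩
    obtain ⟨φ, hφ, -, h⟩ := main v c hc hl
    exact ⟨φ, hφ, h⟩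
  · intro φ hφ
    obtain ⟨m, rfl⟩ := Nat.exists_eq_add_of_le' hp
    set f : SimpleGraph.cycleGraph (m + 3) →g G := ⟨φ, fun {x y} h => hφ.1 x y h⟩ with hf
    have hc : ((SimpleGraph.cycleGraph.cycle m).map f).IsCycle :=
      (SimpleGraph.Walk.isCycle_map_iff_of_injective φ.injective).2
        SimpleGraph.cycleGraph.isCycle_cycle
    have hl : ((SimpleGraph.cycleGraph.cycle m).map f).length = m + 3 := by
      rw [SimpleGraph.Walk.length_map, SimpleGraph.cycleGraph.length_cycle]
    obtain ⟨ψ, -, h2, h3⟩ := main _ _ hc hl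
    refine ⟨_, _, hc, hl, h3.trans ?_⟩
    -- The embedding `ψ` read off the walk may differ from `φ` by an automorphism; only the equality
    -- of the two images is needed.
    congr 2
    apply Finset.eq_of_subset_of_card_le
    · intro w hw
      rw [← Finset.mem_coe, ← h2, SimpleGraph.Walk.mem_verts_toSubgraph,
        SimpleGraph.Walk.support_map, List.mem_map] at hw
      obtain ⟨x, -, rfl⟩ := hw
      exact apply_mem_cls x
    · rw [card_cls, card_cls]

end Cycles

section Paths

variable {R K : ℕ} {G : SimpleGraph (Fin n)}

theorem exists_embedding_of_isPath {p : ℕ} {u v : Fin n} {w : G.Walk u v} (hw : w.IsPath)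
    (hp : w.length = p) : ∃ φ : Fin (p + 1) ↪ Fin n,
      (∀ x y, (SimpleGraph.pathGraph (p + 1)).Adj x y → w.toSubgraph.Adj (φ x) (φ y)) ∧
      w.toSubgraph.verts = cls φ ∧ φ 0 = u ∧ φ (Fin.last p) = v := by
  refine ⟨⟨fun i => w.getVert i, ?_⟩, ?_, ?_, ?_, ?_⟩
  · intro i j hij
    have hi := i.isLt
    have hj := j.isLt
    exact Fin.ext (hw.getVert_injOn (by rw [Set.mem_ofPred_eq]; omega)
      (by rw [Set.mem_ofPred_eq]; omega) hij)
  · have key : ∀ x y : Fin (p + 1), x.val + 1 = y.val →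
        w.toSubgraph.Adj (w.getVert x) (w.getVert y) := by
      intro x y hxy
      have hy := y.isLt
      rw [← hxy]
      exact w.toSubgraph_adj_getVert (by omega)
    intro x y hxy
    rcases SimpleGraph.pathGraph_adj.1 hxy with h | h
    · exact key x y h
    · exact (key y x h).symm
  · ext z
    rw [SimpleGraph.Walk.mem_verts_toSubgraph, SimpleGraph.Walk.mem_support_iff_exists_getVert,
      Finset.mem_coe, mem_cls]
    constructor
    · rintro ⟨i, rfl, hi⟩
      exact ⟨⟨i, by omega⟩, rfl⟩
    · rintro ⟨i, rfl⟩
      exact ⟨i, rfl, by have := i.isLt; omega⟩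
  · exact w.getVert_zero
  · show w.getVert p = v
    rw [← hp, w.getVert_length]

theorem exists_isPath_of_embedding {p : ℕ} {φ : Fin (p + 1) ↪ Fin n}
    (hφ : ∀ x y, (SimpleGraph.pathGraph (p + 1)).Adj x y → G.Adj (φ x) (φ y)) :
    ∃ w : G.Walk (φ 0) (φ (Fin.last p)), w.IsPath ∧ w.length = p ∧
      ∀ z ∈ w.support, z ∈ cls φ := by
  have key : ∀ i : ℕ, ∀ hi : i < p + 1, ∃ w : G.Walk (φ 0) (φ ⟨i, hi⟩), w.IsPath ∧
      w.length = i ∧ ∀ z ∈ w.support, ∃ x : Fin (p + 1), x.val ≤ i ∧ φ x = z := by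
    intro i
    induction i with
    | zero =>
      intro hi
      refine ⟨SimpleGraph.Walk.nil, SimpleGraph.Walk.IsPath.nil, rfl, ?_⟩
      intro z hz
      exact ⟨0, le_rfl, (List.mem_singleton.1 hz).symm⟩
    | succ i ih =>
      intro hi
      obtain ⟨w, hw, hl, hs⟩ := ih (by omega)
      have ha : G.Adj (φ ⟨i, by omega⟩) (φ ⟨i + 1, hi⟩) :=
        hφ _ _ (by simp [SimpleGraph.pathGraph_adj])
      refine ⟨w.concat ha, hw.concat ?_ ha, by rw [SimpleGraph.Walk.length_concat, hl], ?_⟩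
      · intro hmem
        obtain ⟨x, hx, hxe⟩ := hs _ hmem
        have := congrArg Fin.val (φ.injective hxe)
        simp only at this
        omega
      · intro z hz
        rw [SimpleGraph.Walk.support_concat, List.mem_append,
          List.mem_singleton] at hz
        rcases hz with hz | rfl
        · obtain ⟨x, hx, hxe⟩ := hs z hz
          exact ⟨x, by omega, hxe⟩
        · exact ⟨_, le_rfl, rfl⟩
  obtain ⟨w, hw, hl, hs⟩ := key p (Nat.lt_succ_self p)
  exact ⟨w, hw, hl, fun z hz => let ⟨x, _, hx⟩ := hs z hz; mem_cls.2 ⟨x, hx⟩⟩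

theorem present_pathGraph {p : ℕ} (hp : 1 ≤ p) {φ : Fin (p + 1) ↪ Fin n} :
    Present R (SimpleGraph.pathGraph (p + 1)) φ G ↔
      (∀ x y, (SimpleGraph.pathGraph (p + 1)).Adj x y → G.Adj (φ x) (φ y)) ∧
      dfc R G (φ 0) = 1 ∧ dfc R G (φ (Fin.last p)) = 1 := by
  have h0 : pdeg (SimpleGraph.pathGraph (p + 1)) 0 = 1 := by
    rw [pdeg_pathGraph, if_pos (Fin.val_zero _), if_neg (by rw [Fin.val_zero]; omega)]
  have h1 : pdeg (SimpleGraph.pathGraph (p + 1)) (Fin.last p) = 1 := by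
    rw [pdeg_pathGraph, if_neg (by rw [Fin.val_last]; omega), if_pos (Fin.val_last p)]
  constructor
  · rintro ⟨h, h'⟩
    have h2 := h' 0
    have h3 := h' (Fin.last p)
    exact ⟨h, by omega, by omega⟩
  · rintro ⟨h, h2, h3⟩
    refine ⟨h, fun x hx => ?_⟩
    by_cases hx0 : x = 0
    · subst hx0
      omega
    · by_cases hx1 : x = Fin.last p
      · subst hx1
        omega
      · exfalso
        have h4 : x.val ≠ 0 := fun h => hx0 (Fin.ext (h.trans (Fin.val_zero _).symm))
        have h5 : x.val ≠ p := fun h => hx1 (Fin.ext h)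
        rw [pdeg_pathGraph, if_neg h4, if_neg h5] at hx
        omega

theorem deg_eq_sub_iff (hmem : G ∈ graphs n R) {d : ℕ} (hd : d ≤ R) {v : Fin n} :
    deg G v = R - d ↔ dfc R G v = d := by
  have := deg_add_dfc hmem v
  omega

theorem numPaths_eq_numCls (hR : 1 ≤ R) (hmem : G ∈ graphs n R) (hG : ¬ Bad R K G) {p : ℕ}
    (hp : 1 ≤ p) (hK : (p + 1) + (p + 1) ≤ K) :
    numPaths G (R - 1) p = numCls R (SimpleGraph.pathGraph (p + 1)) G := by
  have hK' : Fintype.card (Fin (p + 1)) + Fintype.card (Fin (p + 1)) ≤ K := by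
    rwa [Fintype.card_fin]
  have main : ∀ (u v : Fin n) (w : G.Walk u v), w.IsPath → w.length = p → deg G u = R - 1 →
      deg G v = R - 1 → ∃ φ : Fin (p + 1) ↪ Fin n,
        Present R (SimpleGraph.pathGraph (p + 1)) φ G ∧ w.toSubgraph.verts = cls φ ∧
        w.toSubgraph = (⊤ : G.Subgraph).induce (cls φ : Finset (Fin n)) := by
    intro u v w hw hl hu hv
    obtain ⟨φ, h1, h2, rfl, rfl⟩ := exists_embedding_of_isPath hw hl
    rw [deg_eq_sub_iff hmem hR] at hu hv
    have hφ : Present R (SimpleGraph.pathGraph (p + 1)) φ G :=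
      (present_pathGraph hp).2 ⟨fun x y h => (h1 x y h).adj_sub, hu, hv⟩
    exact ⟨φ, hφ, h2, hφ.eq_induce hG hK' h1 h2⟩
  apply ncard_eq_numCls
  · rintro _ ⟨u, v, w, hw, hl, hu, hv, rfl⟩
    obtain ⟨φ, hφ, -, h⟩ := main u v w hw hl hu hv
    exact ⟨φ, hφ, h⟩
  · intro φ hφ
    obtain ⟨ha, hu, hv⟩ := (present_pathGraph hp).1 hφ
    obtain ⟨w, hw, hl, hs⟩ := exists_isPath_of_embedding ha
    rw [← deg_eq_sub_iff hmem hR] at hu hv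
    obtain ⟨ψ, -, h2, h3⟩ := main _ _ w hw hl hu hv
    refine ⟨_, _, w, hw, hl, hu, hv, h3.trans ?_⟩
    congr 2
    apply Finset.eq_of_subset_of_card_le
    · intro z hz
      rw [← Finset.mem_coe, ← h2, SimpleGraph.Walk.mem_verts_toSubgraph] at hz
      exact hs z hz
    · rw [card_cls, card_cls]

/-- The one-vertex path has pattern degree 0, so its presence is a condition on the deficiency
alone. This puts vertices of degree R - 2 in the same family as the longer paths. -/
theorem present_pathGraph_one {φ : Fin 1 ↪ Fin n} :
    Present R (SimpleGraph.pathGraph 1) φ G ↔ dfc R G (φ 0) = 2 := by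
  have h0 : pdeg (SimpleGraph.pathGraph 1) 0 = 0 := by
    rw [pdeg_pathGraph]
    simp
  constructor
  · rintro ⟨-, h⟩
    have := h 0
    omega
  · intro h
    refine ⟨fun x y hxy => (hxy.ne (Subsingleton.elim x y)).elim, fun x _ => ?_⟩
    rw [Subsingleton.elim x 0]
    omega

theorem numDeg_eq_numCls (hR : 2 ≤ R) (hmem : G ∈ graphs n R) :
    numDeg G (R - 2) = numCls R (SimpleGraph.pathGraph 1) G := by
  have h : (((Finset.univ.filter
      (fun φ : Fin 1 ↪ Fin n => Present R (SimpleGraph.pathGraph 1) φ G)).image cls : Finset _) :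
      Set (Finset (Fin n))) = (fun v => {v}) '' {v : Fin n | deg G v = R - 2} := by
    ext V
    simp only [Finset.coe_image, Finset.coe_filter, Finset.mem_univ, true_and, Set.mem_image,
      Set.mem_ofPred_eq, present_pathGraph_one, deg_eq_sub_iff hmem hR]
    have hc : ∀ φ : Fin 1 ↪ Fin n, cls φ = {φ 0} := by
      intro φ
      simp [cls]
    constructor
    · rintro ⟨φ, hφ, rfl⟩
      exact ⟨φ 0, hφ, (hc φ).symm⟩
    · rintro ⟨v, hv, rfl⟩
      exact ⟨⟨fun _ => v, fun x y _ => Subsingleton.elim x y⟩, hv, hc _⟩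
  unfold numDeg
  rw [← Set.ncard_image_of_injective _ (Finset.singleton_injective), ← h, Set.ncard_coe_finset]
  unfold numCls
  congr!

end Paths

end

/-! ### Poisson limits for the actual counts -/

section

variable {n : ℕ}

/-- The number of occurrences of a pattern: cycles, vertices of degree `R - 2`, and paths with
endpoints of degree `R - 1`. -/
def count (R : ℕ) (G : SimpleGraph (Fin n)) : ℕ ⊕ ℕ → ℕ
  | Sum.inl p => numCycles G p
  | Sum.inr 0 => numDeg G (R - 2)
  | Sum.inr (p + 1) => numPaths G (R - 1) (p + 1)

/-- The limiting mean of `count`. -/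
def countMean (R : ℕ) : ℕ ⊕ ℕ → ℝ
  | Sum.inl p => cycleMean R p
  | Sum.inr 0 => (R : ℝ) - 1
  | Sum.inr (p + 1) => pathMean R (p + 1)

theorem countMean_eq (R : ℕ) {i : ℕ ⊕ ℕ} (hi : ∀ p, i = Sum.inl p → 3 ≤ p) :
    ((R : ℝ) - 1) ^ Fintype.card (Fin (patternOrder i)) / Nat.card (pattern i ≃g pattern i) =
      countMean R i := by
  rw [Fintype.card_fin]
  match i, hi with
  | Sum.inl p, hi =>
    have h : Nat.card (pattern (Sum.inl p) ≃g pattern (Sum.inl p)) = 2 * p :=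
      card_iso_cycleGraph (hi p rfl)
    rw [h]
    push_cast
    rfl
  | Sum.inr 0, _ =>
    have h : Nat.card (pattern (Sum.inr 0) ≃g pattern (Sum.inr 0)) = 1 := card_iso_pathGraph_one
    rw [h]
    simp [patternOrder, countMean]
  | Sum.inr (p + 1), _ =>
    have h : Nat.card (pattern (Sum.inr (p + 1)) ≃g pattern (Sum.inr (p + 1))) = 2 :=
      card_iso_pathGraph (Nat.succ_pos p)
    rw [h]
    push_cast
    rfl

theorem count_eq_numCls {R K : ℕ} (hR : 2 ≤ R) {G : SimpleGraph (Fin n)} (hmem : G ∈ graphs n R)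
    (hG : ¬ Bad R K G) {i : ℕ ⊕ ℕ} (hi : ∀ p, i = Sum.inl p → 3 ≤ p)
    (hK : patternOrder i + patternOrder i ≤ K) : count R G i = numCls R (pattern i) G := by
  match i, hi, hK with
  | Sum.inl p, hi, hK => exact numCycles_eq_numCls hG (hi p rfl) hK
  | Sum.inr 0, _, _ => exact numDeg_eq_numCls hR hmem
  | Sum.inr (p + 1), _, hK =>
    exact numPaths_eq_numCls (by omega) hmem hG (Nat.succ_pos p) hK

theorem tendsto_prob_count {R : ℕ} (hR : 2 ≤ R) {s : Finset (ℕ ⊕ ℕ)}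
    (hs : ∀ p, Sum.inl p ∈ s → 3 ≤ p) (x : ℕ ⊕ ℕ → ℕ) :
    Tendsto (fun n => prob n R (fun G => ∀ i ∈ s, count R G i = x i)) atTop
      (𝓝 (∏ i ∈ s, poissonMass (countMean R i) (x i))) := by
  have hs' : ∀ i ∈ s, ∀ p, i = Sum.inl p → 3 ≤ p := by
    rintro _ hi p rfl
    exact hs p hi
  have h := (isPatternFamily_pattern hs).tendsto_prob (R := R) (K := 2 * s.sup patternOrder)
    (by omega) (fun n G i => count R G i)
    (fun n G hmem hG i hi => count_eq_numCls hR hmem hG (hs' i hi)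
      (by
        have := Finset.le_sup (f := patternOrder) hi
        omega)) x
  rwa [Finset.prod_congr rfl fun i hi => by rw [countMean_eq R (hs' i hi)]] at h

theorem hasCounts_iff {R k : ℕ} {r s : ℕ → ℕ} {G : SimpleGraph (Fin n)} :
    HasCounts R k r s G ↔ ∀ i ∈ (Finset.Icc 3 k).disjSum (Finset.Icc 1 k),
      count R G i = Sum.elim r s i := by
  have h : ∀ p ∈ Finset.Icc 1 k, count R G (Sum.inr p) = numPaths G (R - 1) p := by
    rintro (_ | p) hp
    · simp at hp
    · rfl
  constructor
  · rintro ⟨h1, h2⟩ (p | p) hp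
    · exact h1 p (Finset.inl_mem_disjSum.1 hp)
    · have hp' := Finset.inr_mem_disjSum.1 hp
      exact (h p hp').trans (h2 p hp')
  · intro h1
    refine ⟨fun p hp => h1 (Sum.inl p) (Finset.inl_mem_disjSum.2 hp), fun p hp => ?_⟩
    rw [← h p hp]
    exact h1 (Sum.inr p) (Finset.inr_mem_disjSum.2 hp)

theorem jointMass_eq (R k : ℕ) (r s : ℕ → ℕ) :
    ∏ i ∈ (Finset.Icc 3 k).disjSum (Finset.Icc 1 k),
      poissonMass (countMean R i) (Sum.elim r s i) = jointMass R k r s := by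
  rw [Finset.prod_disjSum]
  unfold jointMass
  congr 1
  refine Finset.prod_congr rfl ?_
  rintro (_ | p) hp
  · simp at hp
  · rfl

theorem three_le_of_inl_mem {k l : ℕ} {p : ℕ}
    (hp : Sum.inl p ∈ (Finset.Icc 3 k).disjSum (Finset.Icc l k)) : 3 ≤ p :=
  (Finset.mem_Icc.1 (Finset.inl_mem_disjSum.1 hp)).1

theorem tendsto_prob_hasCounts {R : ℕ} (hR : 2 ≤ R) (k : ℕ) (r s : ℕ → ℕ) :
    Tendsto (fun n => prob n R (HasCounts R k r s)) atTop (𝓝 (jointMass R k r s)) := by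
  have h := tendsto_prob_count hR (s := (Finset.Icc 3 k).disjSum (Finset.Icc 1 k))
    (fun _ => three_le_of_inl_mem) (Sum.elim r s)
  rw [jointMass_eq] at h
  exact h.congr fun n => prob_congr fun G _ => hasCounts_iff.symm

theorem tendsto_prob_numDeg {R : ℕ} (hR : 2 ≤ R) (q : ℕ) :
    Tendsto (fun n => prob n R (fun G => numDeg G (R - 2) = q)) atTop
      (𝓝 (poissonMass ((R : ℝ) - 1) q)) := by
  have h := tendsto_prob_count hR (s := {Sum.inr 0}) (fun p hp => by simp at hp) (fun _ => q)
  rw [Finset.prod_singleton] at h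
  exact h.congr fun n => prob_congr fun G _ => by simp [count]

theorem tendsto_prob_hasCounts_and {R : ℕ} (hR : 2 ≤ R) (k : ℕ) (r s : ℕ → ℕ) (q : ℕ) :
    Tendsto (fun n => prob n R (fun G => HasCounts R k r s G ∧ numDeg G (R - 2) = q)) atTop
      (𝓝 (jointMass R k r s * poissonMass ((R : ℝ) - 1) q)) := by
  set S := (Finset.Icc 3 k).disjSum (Finset.Icc 1 k) with hS
  have h0 : (Sum.inr 0 : ℕ ⊕ ℕ) ∉ S := by simp [hS]
  set x : ℕ ⊕ ℕ → ℕ := Function.update (Sum.elim r s) (Sum.inr 0) q with hx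
  have hx0 : x (Sum.inr 0) = q := Function.update_self ..
  have hx1 : ∀ i ∈ S, x i = Sum.elim r s i := fun i hi =>
    Function.update_of_ne (ne_of_mem_of_not_mem hi h0) ..
  have h := tendsto_prob_count hR (s := insert (Sum.inr 0) S)
    (fun p hp => three_le_of_inl_mem ((Finset.mem_insert.1 hp).resolve_left (by simp))) x
  rw [Finset.prod_insert h0, hx0,
    Finset.prod_congr rfl (fun i hi => by rw [hx1 i hi]), hS, jointMass_eq, mul_comm] at h
  refine h.congr fun n => prob_congr fun G _ => ?_
  rw [Finset.forall_mem_insert, hx0, hasCounts_iff, and_comm]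
  exact and_congr_left' (forall₂_congr fun i hi => by rw [hx1 i hi])

/-- This also holds when the conditioning class is empty: both sides are then 0 by the convention on
division by zero. -/
theorem proportion_sep_eq {R : ℕ} (P Q : SimpleGraph (Fin n) → Prop) :
    proportion {G | G ∈ graphs n R ∧ Q G} P = prob n R (fun G => P G ∧ Q G) / prob n R Q := by
  rw [← proportion_eq_prob, ← proportion_eq_prob]
  unfold proportion
  rw [div_div_div_cancel_right₀ (ncard_graphs_pos n R).ne']
  congr 3
  ext G
  simp only [Set.mem_ofPred_eq]
  tauto

theorem poissonMass_pos {μ : ℝ} (hμ : 0 < μ) (j : ℕ) : 0 < poissonMass μ j := by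
  unfold poissonMass
  positivity

end

end BoundedDegree

end

/-! ### The theorem -/

theorem theorem3p1 (R : ℕ) (hR : 2 ≤ R) :
    -- the structural properties hold almost surely
    (∀ k : ℕ, 0 < k →
      Tendsto (fun n : ℕ => BoundedDegree.proportion (BoundedDegree.graphs n R) (fun G =>
          BoundedDegree.NoDenseSubgraph k G ∧
          BoundedDegree.NoCloseCycles k G ∧
          BoundedDegree.NoCycleNearSmallDegree R k G ∧
          BoundedDegree.NoThreeClose R k G ∧
          BoundedDegree.NoCloseToVerySmallDegree R k G))
        atTop (𝓝 1)) ∧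
    -- the counts are asymptotically independent Poisson variables,
    -- also jointly with, and conditionally on, the number of vertices of degree `R - 2`
    (∀ k : ℕ, 3 ≤ k → ∀ r s : ℕ → ℕ,
      Tendsto (fun n : ℕ => BoundedDegree.proportion (BoundedDegree.graphs n R)
          (BoundedDegree.HasCounts R k r s))
        atTop (𝓝 (BoundedDegree.jointMass R k r s)) ∧
      ∀ q : ℕ,
        Tendsto (fun n : ℕ => BoundedDegree.proportion (BoundedDegree.graphs n R) (fun G =>
            BoundedDegree.HasCounts R k r s G ∧ BoundedDegree.numDeg G (R - 2) = q))
          atTop (𝓝 (BoundedDegree.jointMass R k r s *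
            BoundedDegree.poissonMass ((R : ℝ) - 1) q)) ∧
        Tendsto (fun n : ℕ => BoundedDegree.proportion
            {G | G ∈ BoundedDegree.graphs n R ∧ BoundedDegree.numDeg G (R - 2) = q}
            (BoundedDegree.HasCounts R k r s))
          atTop (𝓝 (BoundedDegree.jointMass R k r s))) ∧
    -- there are almost surely no components of bounded size
    (3 ≤ R → ∀ k : ℕ,
      Tendsto (fun n : ℕ => BoundedDegree.proportion (BoundedDegree.graphs n R)
          (BoundedDegree.HasSmallComponent k))
        atTop (𝓝 0)) := by
  have hR0 : 0 < R := by omega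
  refine ⟨fun k _ => ?_, fun k _ r s => ⟨?_, fun q => ⟨?_, ?_⟩⟩, fun hR3 k => ?_⟩
  · simp only [BoundedDegree.proportion_eq_prob]
    -- The five properties need sets of at most k, k + 3, 2k + 2, 2k + 2 and k + 1 vertices; 2k + 3
    -- covers them all.
    have h := (BoundedDegree.tendsto_prob_bad hR0 (2 * k + 3)).const_sub 1
    rw [sub_zero] at h
    refine tendsto_of_tendsto_of_tendsto_of_le_of_le h tendsto_const_nhds (fun n => ?_)
      (fun n => BoundedDegree.prob_le_one _)
    simp only [← BoundedDegree.prob_not]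
    refine BoundedDegree.prob_mono fun G hmem hG => ⟨?_, ?_, ?_, ?_, ?_⟩
    · exact BoundedDegree.noDenseSubgraph_of_not_bad hG (by omega)
    · exact BoundedDegree.noCloseCycles_of_not_bad hG (by omega)
    · exact BoundedDegree.noCycleNearSmallDegree_of_not_bad hG (by omega)
    · exact BoundedDegree.noThreeClose_of_not_bad (by omega) hG (by omega)
    · exact BoundedDegree.noCloseToVerySmallDegree_of_not_bad (by omega) hG (by omega)
  · simp only [BoundedDegree.proportion_eq_prob]
    exact BoundedDegree.tendsto_prob_hasCounts hR k r s
  · simp only [BoundedDegree.proportion_eq_prob]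
    exact BoundedDegree.tendsto_prob_hasCounts_and hR k r s q
  · have hpos : 0 < BoundedDegree.poissonMass ((R : ℝ) - 1) q := by
      apply BoundedDegree.poissonMass_pos
      have : (2 : ℝ) ≤ R := by exact_mod_cast hR
      linarith
    -- The conditional proportion is a quotient of two convergent probabilities, and the limit of
    -- the denominator is positive because R - 1 > 0.
    have h := (BoundedDegree.tendsto_prob_hasCounts_and hR k r s q).div
      (BoundedDegree.tendsto_prob_numDeg hR q) hpos.ne'
    rw [mul_div_cancel_right₀ _ hpos.ne'] at h
    exact h.congr fun n => (BoundedDegree.proportion_sep_eq _ _).symm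
  · simp only [BoundedDegree.proportion_eq_prob]
    refine squeeze_zero (fun n => BoundedDegree.prob_nonneg _) (fun n => ?_)
      (BoundedDegree.tendsto_prob_bad hR0 k)
    refine BoundedDegree.prob_mono fun G hmem hG => ?_
    by_contra hB
    exact BoundedDegree.not_hasSmallComponent_of_not_bad hR3 hmem hB le_rfl hG
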